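/- A lattice triangulation of the rectangle $[0,m]\times[0,n]$ (with $m,n$ positive integers) is a triangulation of it, in the usual sense that any two triangles are disjoint or meet in a common vertex or a common edge, all of whose vertices lie in $\mathbb{Z}^2$; the triangles need not be primitive, i.e. they may have area greater than $1/2$. Let $f^{\mathrm{np}}(m,n)$ be the number of all lattice triangulations of $[0,m]\times[0,n]$. Then the limit $\lim_{n\to\infty} f^{\mathrm{np}}(n,n)^{1/n^2}$ exists as a real number, and $$\lim_{n\to\infty} f^{\mathrm{np}}(n,n)^{1/n^2}\ \ge\ 5.$$ -/

import Mathlib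

/-- The closed rectangle `[0, m] × [0, n]` in the plane. -/
def latticeRectangle (m n : ℕ) : Set (ℝ × ℝ) :=
  Set.Icc (0 : ℝ) (m : ℝ) ×ˢ Set.Icc (0 : ℝ) (n : ℝ)

/-- The lattice triangulations (not necessarily primitive) of the `m × n` rectangle: the geometric
simplicial complexes in the plane that fill the rectangle and whose vertices are all points of
`ℤ × ℤ`. The glueing condition of a simplicial complex says that two triangles meet in a common
face or not at all. -/
def latticeTriangulations (m n : ℕ) : Set (Geometry.SimplicialComplex ℝ (ℝ × ℝ)) :=
  {K | K.space = latticeRectangle m n ∧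
    ∀ v ∈ K.vertices, ∃ a b : ℤ, v = ((a : ℝ), (b : ℝ))}

/-- There are only finitely many lattice triangulations of a rectangle, so that counting them by
`Set.ncard` is meaningful. -/
theorem latticeTriangulations_finite (m n : ℕ) : (latticeTriangulations m n).Finite := by
  set P : Set (ℝ × ℝ) :=
    (fun p : ℤ × ℤ => ((p.1 : ℝ), (p.2 : ℝ))) '' (Set.Icc 0 (m : ℤ) ×ˢ Set.Icc 0 (n : ℤ)) with hP
  have hfin : P.Finite := ((Set.finite_Icc _ _).prod (Set.finite_Icc _ _)).image _
  have hQ : {s : Finset (ℝ × ℝ) | (s : Set (ℝ × ℝ)) ⊆ P}.Finite := by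
    refine (hfin.finite_subsets.preimage (f := fun s : Finset (ℝ × ℝ) => (s : Set (ℝ × ℝ)))
      Finset.coe_injective.injOn).subset ?_
    intro s hs
    exact hs
  refine Set.Finite.of_finite_image (f := fun K => K.faces)
    (hQ.finite_subsets.subset ?_) ?_
  · rintro _ ⟨K, ⟨hK, hv⟩, rfl⟩ s hs x hx
    have hxv : x ∈ K.vertices :=
      K.down_closed hs (Finset.singleton_subset_iff.2 hx) (Finset.singleton_nonempty x)
    have hxs : x ∈ latticeRectangle m n := hK ▸ K.subset_space hs hx
    obtain ⟨a, b, rfl⟩ := hv x hxv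
    obtain ⟨⟨h1, h2⟩, h3, h4⟩ := hxs
    dsimp only at h1 h2 h3 h4
    refine ⟨(a, b), ⟨⟨?_, ?_⟩, ?_, ?_⟩, rfl⟩ <;> dsimp only <;> first
      | exact_mod_cast h1 | exact_mod_cast h2 | exact_mod_cast h3 | exact_mod_cast h4
  · intro K _ L _ h
    exact Geometry.SimplicialComplex.ext h

/-- The number of all lattice triangulations of the `m × n` rectangle. -/
noncomputable def numLatticeTriangulations (m n : ℕ) : ℕ :=
  (latticeTriangulations m n).ncard

/-! Lower bound. Cut the square into vertical strips of width one and put `j` interior vertices on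
every vertical line except the leftmost, where any fixed start will do. Triangulating a strip
without further vertices means climbing its two sides alternately, that is, choosing a lattice path,
so there are C(2j+2, j+1) ways (`exists_ladders`). The vertices on the next line can be chosen in
C(n-1, j) ways. Up to a polynomial factor C(2j+2, j+1) is 4^j, and the sum of C(n-1, j) 4^j is
5^(n-1). The largest term therefore gives 5^n per strip up to polynomial factors, and 5^(n^2) up to
exp(O(n log n)) in all.

Existence of the limit. Two triangulations can be glued along a common side only if they have the
same vertices there, but a strip of width one bridges any two of them (`exists_bridge`). Hence f(a,
n) f(b, n) ≤ f(a+1+b, n). With the symmetry of f, a two-dimensional Fekete argument shows that log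
f(n, n) / n^2 tends to the supremum of log f(m, m) / (m+1)^2, provided that this supremum is finite.

Finiteness. Subdivide each triangle by primitive segments until every half-integral, non-integral
point of the square is the midpoint of one segment, no two of them crossing. Scan the midpoints in a
linear order. If two such systems agree at all earlier midpoints, their directions at the next one
have determinant at most 2, since otherwise a segment at an earlier midpoint would cross one of the
two (`exists_blocking`). Among three directions with this property two coincide (`eq_of_three`), so
one bit per midpoint encodes the system. A second bit tells whether the segment lies in an edge of
the given triangulation. The union of the edges determines the triangulation, hence f(n, n) ≤
4^((2n+1)^2). -/

/-! ### Determinants, crossing segments and blocking displacements -/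

/-- The determinant of two integer vectors. -/
def idet (u v : ℤ × ℤ) : ℤ := u.1 * v.2 - u.2 * v.1

/-- Two segments `q + (-1, 1) U` and `q + d + (-1, 1) V` cross transversally. -/
def SegCross (d U V : ℤ × ℤ) : Prop :=
  |idet d V| < |idet U V| ∧ |idet d U| < |idet U V|

/-- Congruence modulo two of integer vectors. -/
def EvenDiff (u v : ℤ × ℤ) : Prop := 2 ∣ u.1 - v.1 ∧ 2 ∣ u.2 - v.2

theorem idet_neg_left (u v : ℤ × ℤ) : idet (-u) v = -idet u v := by
  simp only [idet, Prod.fst_neg, Prod.snd_neg]; ring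

theorem idet_neg_right (u v : ℤ × ℤ) : idet u (-v) = -idet u v := by
  simp only [idet, Prod.fst_neg, Prod.snd_neg]; ring

theorem idet_comm (u v : ℤ × ℤ) : idet u v = -idet v u := by
  simp only [idet]; ring

theorem segCross_neg_left {d U V : ℤ × ℤ} : SegCross (-d) U V ↔ SegCross d U V := by
  simp only [SegCross, idet_neg_left, abs_neg]

theorem segCross_neg_mid {d U V : ℤ × ℤ} : SegCross d (-U) V ↔ SegCross d U V := by
  simp only [SegCross, idet_neg_left, idet_neg_right, abs_neg]

theorem segCross_neg_right {d U V : ℤ × ℤ} : SegCross d U (-V) ↔ SegCross d U V := by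
  simp only [SegCross, idet_neg_right, abs_neg]

theorem segCross_swap {d U V : ℤ × ℤ} : SegCross d U V ↔ SegCross d V U := by
  simp only [SegCross, idet_comm V U, abs_neg, and_comm]

theorem exists_two_mul_abs_sub_le (a : ℤ) {b : ℤ} (hb : b ≠ 0) :
    ∃ k : ℤ, 2 * |a - k * b| ≤ |b| := by
  refine ⟨round ((a : ℚ) / b), ?_⟩
  have h := abs_sub_round ((a : ℚ) / b)
  have hb' : (b : ℚ) ≠ 0 := by exact_mod_cast hb
  have hpos : 0 < |(b : ℚ)| := abs_pos.2 hb'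
  have h2 : |(a : ℚ) - round ((a : ℚ) / b) * b| = |(a : ℚ) / b - round ((a : ℚ) / b)| * |(b : ℚ)| := by
    rw [← abs_mul, sub_mul, div_mul_cancel₀ _ hb']
  have h3 : 2 * |(a : ℚ) - round ((a : ℚ) / b) * b| ≤ |(b : ℚ)| := by
    rw [h2]; nlinarith
  exact_mod_cast h3

/-- If two primitive segments with a common midpoint span a parallelogram of determinant more than
two, then there is a half-integral displacement inside that parallelogram such that every
primitive segment centred there crosses one of the two. -/
theorem exists_blocking {X V : ℤ × ℤ} (hX : IsCoprime X.1 X.2) (hV : IsCoprime V.1 V.2)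
    (hXV : EvenDiff V X) (h : 2 < |idet X V|) :
    ∃ Y : ℤ × ℤ, (∀ m : ℤ, |X.1| ≤ m → |V.1| ≤ m → |Y.1| ≤ m) ∧
      (∀ m : ℤ, |X.2| ≤ m → |V.2| ≤ m → |Y.2| ≤ m) ∧
      ¬ EvenDiff (X + Y) 0 ∧ Y ≠ 0 ∧
      ∀ H : ℤ × ℤ, EvenDiff H (X + Y) → SegCross Y X H ∨ SegCross Y V H := by
  -- Every `(-y, x) + k X` has determinant one with `X`. The multiple `k` is chosen by rounding so
  -- that the determinant `α` of `V` and `Y` is at most half of `β = idet X V` in absolute value.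
  obtain ⟨x, y, hxy⟩ := hX
  obtain ⟨k, hk⟩ := exists_two_mul_abs_sub_le (idet V (-y, x))
    (b := idet X V) (by intro h0; simp [h0] at h)
  obtain ⟨Y, hYdef⟩ : ∃ Y : ℤ × ℤ, Y = (-y + k * X.1, x + k * X.2) := ⟨_, rfl⟩
  have hXY : idet X Y = 1 := by
    rw [hYdef]; simp only [idet]; linear_combination hxy
  obtain ⟨α, hα⟩ : ∃ α, α = idet V Y := ⟨_, rfl⟩
  obtain ⟨β, hβ⟩ : ∃ β, β = idet X V := ⟨_, rfl⟩
  have hk' : 2 * |α| ≤ |β| := by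
    have : α = idet V (-y, x) - k * idet X V := by
      rw [hα, hYdef]; simp only [idet]; ring
    rw [this, hβ]; exact hk
  rw [← hβ] at h
  have hV1 : V.1 = α * X.1 + β * Y.1 := by
    simp only [idet] at hα hβ hXY
    rw [hα, hβ]; linear_combination (-V.1) * hXY
  have hV2 : V.2 = α * X.2 + β * Y.2 := by
    simp only [idet] at hα hβ hXY
    rw [hα, hβ]; linear_combination (-V.2) * hXY
  have hcop : IsCoprime α β := by
    obtain ⟨p, r, hpr⟩ := hV
    exact ⟨p * X.1 + r * X.2, p * Y.1 + r * Y.2, by rw [← hpr, hV1, hV2]; ring⟩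
  have hβ2 : (2 : ℤ) ∣ β := by
    obtain ⟨⟨a, ha⟩, b, hb⟩ := hXV
    refine ⟨X.1 * b - X.2 * a, ?_⟩
    rw [hβ]; simp only [idet]; linear_combination X.1 * hb - X.2 * ha
  have hα2 : ¬ (2 : ℤ) ∣ α := by
    intro h2
    have := hcop.isUnit_of_dvd' h2 hβ2
    exact absurd this (by decide)
  -- Equality would make `α` a divisor of the coprime `β`, so |α| = 1 and |β| = 2, which `h`
  -- excludes.
  have hlt : 2 * |α| < |β| := by
    refine lt_of_le_of_ne hk' fun heq => ?_
    have hdvd : α ∣ β := by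
      rw [← abs_dvd_abs]; exact ⟨2, by rw [← heq]; ring⟩
    have hu : IsUnit α := hcop.isUnit_of_dvd' dvd_rfl hdvd
    have : |α| = 1 := Int.isUnit_iff_abs_eq.1 hu
    omega
  have hβpos : 0 < |β| := by omega
  -- Since `β Y = V - α X` and 1 + |α| ≤ |β|, a common bound for a coordinate of `X` and `V` also
  -- bounds that coordinate of `Y`. This keeps the displaced midpoint in the square.
  have bound : ∀ (s t u m : ℤ), t = α * s + β * u → |s| ≤ m → |t| ≤ m → |u| ≤ m := by
    intro s t u m ht hs htm
    have h1 : |β| * |u| ≤ |t| + |α| * |s| := by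
      rw [← abs_mul, ← abs_mul]
      have : β * u = t - α * s := by rw [ht]; ring
      rw [this]; exact abs_sub _ _
    have hm : 0 ≤ m := (abs_nonneg s).trans hs
    have h2 : |α| * |s| ≤ |α| * m := mul_le_mul_of_nonneg_left hs (abs_nonneg _)
    have h3 : (1 + |α|) * m ≤ |β| * m := mul_le_mul_of_nonneg_right (by omega) hm
    have h4 : |β| * |u| ≤ |β| * m := by linarith
    exact le_of_mul_le_mul_left h4 hβpos
  refine ⟨Y, fun m => bound _ _ _ m hV1, fun m => bound _ _ _ m hV2, ?_, ?_, ?_⟩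
  · rintro ⟨⟨a, ha⟩, b, hb⟩
    simp only [Prod.fst_add, Prod.snd_add, Prod.fst_zero, Prod.snd_zero] at ha hb
    have : (1 : ℤ) = 2 * (X.1 * b - X.2 * a) := by
      rw [← hXY]; simp only [idet]; linear_combination X.1 * hb - X.2 * ha
    omega
  · rintro h0
    rw [h0] at hXY
    simp [idet] at hXY
  -- In the basis `X`, `Y` one has `H = a X + b Y` with `a`, `b` odd. If |a| < |b|, then `H` crosses
  -- `X`. Otherwise it crosses `V`, because |αb - βa| ≥ (|β| - |α|)|a| ≥ (|α| + 1)|a| exceeds both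
  -- |a| and |α|; here |α| ≥ 1 because `α` is odd.
  · rintro H ⟨⟨p, hp⟩, r, hr⟩
    simp only [Prod.fst_add, Prod.snd_add] at hp hr
    obtain ⟨a, ha⟩ : ∃ a, a = idet H Y := ⟨_, rfl⟩
    obtain ⟨b, hb⟩ : ∃ b, b = idet X H := ⟨_, rfl⟩
    have ha2 : a = 1 + 2 * (p * Y.2 - r * Y.1) := by
      rw [ha, ← hXY]; simp only [idet]; linear_combination Y.2 * hp - Y.1 * hr
    have hb2 : b = 1 + 2 * (X.1 * r - X.2 * p) := by
      rw [hb, ← hXY]; simp only [idet]; linear_combination X.1 * hr - X.2 * hp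
    have hH1 : H.1 = a * X.1 + b * Y.1 := by
      simp only [idet] at ha hb hXY
      rw [ha, hb]; linear_combination (-H.1) * hXY
    have hH2 : H.2 = a * X.2 + b * Y.2 := by
      simp only [idet] at ha hb hXY
      rw [ha, hb]; linear_combination (-H.2) * hXY
    have e1 : idet Y H = -a := by rw [idet_comm, ha]
    have e2 : idet Y X = -1 := by rw [idet_comm, hXY]
    have e3 : idet Y V = -α := by rw [idet_comm, hα]
    have e4 : idet V H = α * b - β * a := by
      simp only [idet] at hXY ⊢
      rw [hH1, hH2, hV1, hV2]; linear_combination (α * b - β * a) * hXY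
    simp only [SegCross, ← hb, e1, e2, e3, e4, abs_neg, abs_one]
    have ha0 : 1 ≤ |a| := Int.one_le_abs (by omega)
    by_cases hab : |a| < |b|
    · left; exact ⟨hab, lt_of_le_of_lt ha0 hab⟩
    right
    have hab' : |b| ≤ |a| := not_lt.1 hab
    have h1 : |β| * |a| - |α| * |b| ≤ |α * b - β * a| := by
      rw [← abs_mul, ← abs_mul, abs_sub_comm]; exact abs_sub_abs_le_abs_sub _ _
    have h2 : |α| * |b| ≤ |α| * |a| := mul_le_mul_of_nonneg_left hab' (abs_nonneg _)
    have h3 : (|α| + 2) * |a| ≤ |β| * |a| := by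
      refine mul_le_mul_of_nonneg_right ?_ (abs_nonneg _)
      have : 0 < |α| := abs_pos.2 fun h0 => hα2 (h0 ▸ dvd_zero _)
      omega
    have h4 : (|α| + 1) * |a| ≤ (|β| - |α|) * |a| := mul_le_mul_of_nonneg_right (by omega) (abs_nonneg _)
    constructor <;> nlinarith [abs_nonneg α]

theorem idet_eq_zero_of_primitive {U V : ℤ × ℤ} (hU : IsCoprime U.1 U.2) (hV : IsCoprime V.1 V.2)
    (h : idet U V = 0) : U = V ∨ U = -V := by
  obtain ⟨x, y, hxy⟩ := hU
  obtain ⟨z, w, hzw⟩ := hV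
  simp only [idet] at h
  have h1 : V.1 = (x * V.1 + y * V.2) * U.1 := by linear_combination (-V.1) * hxy - y * h
  have h2 : V.2 = (x * V.1 + y * V.2) * U.2 := by linear_combination (-V.2) * hxy + x * h
  have hu : IsUnit (x * V.1 + y * V.2) := by
    refine IsUnit.of_mul_eq_one (z * U.1 + w * U.2) ?_
    linear_combination hzw - z * h1 - w * h2
  rcases Int.isUnit_iff.1 hu with h3 | h3
  · left; ext
    · rw [h1, h3, one_mul]
    · rw [h2, h3, one_mul]
  · right; ext
    · rw [Prod.fst_neg, h1, h3]; ring
    · rw [Prod.snd_neg, h2, h3]; ring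

/-- The representative of a primitive direction that points to the upper half plane. -/
def IsUpper (U : ℤ × ℤ) : Prop := 0 < U.2 ∨ U.2 = 0 ∧ 0 < U.1

theorem IsUpper.eq_of_primitive {U V : ℤ × ℤ} (hU : IsCoprime U.1 U.2) (hV : IsCoprime V.1 V.2)
    (hU' : IsUpper U) (hV' : IsUpper V) (h : idet U V = 0) : U = V := by
  rcases idet_eq_zero_of_primitive hU hV h with h | h
  · exact h
  · rw [h] at hU'
    simp only [IsUpper, Prod.fst_neg, Prod.snd_neg] at hU' hV'
    omega

theorem isUpper_or_neg {U : ℤ × ℤ} (hU : U ≠ 0) : IsUpper U ∨ IsUpper (-U) := by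
  simp only [IsUpper, Prod.fst_neg, Prod.snd_neg]
  have : U.1 ≠ 0 ∨ U.2 ≠ 0 := by
    by_contra! h
    exact hU (Prod.ext h.1 h.2)
  omega

theorem even_idet {U V : ℤ × ℤ} (h : EvenDiff V U) : (2 : ℤ) ∣ idet U V := by
  obtain ⟨⟨a, ha⟩, b, hb⟩ := h
  exact ⟨U.1 * b - U.2 * a, by simp only [idet]; linear_combination U.1 * hb - U.2 * ha⟩

/-- Among three primitive directions in the same nonzero class modulo two with pairwise
determinants at most two, two coincide. -/
theorem eq_of_three {q U V W : ℤ × ℤ} (hq : ¬ EvenDiff q 0)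
    (hU : IsCoprime U.1 U.2) (hV : IsCoprime V.1 V.2) (hW : IsCoprime W.1 W.2)
    (hU' : IsUpper U) (hV' : IsUpper V) (hW' : IsUpper W)
    (hqU : EvenDiff q U) (hqV : EvenDiff q V) (hqW : EvenDiff q W)
    (h1 : |idet U V| ≤ 2) (h2 : |idet V W| ≤ 2) (h3 : |idet W U| ≤ 2) :
    U = V ∨ V = W ∨ W = U := by
  have aux : ∀ {A B : ℤ × ℤ}, IsCoprime A.1 A.2 → IsCoprime B.1 B.2 → IsUpper A → IsUpper B →
      EvenDiff q A → EvenDiff q B → |idet A B| ≤ 2 → A = B ∨ idet A B = 2 ∨ idet A B = -2 := by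
    intro A B hA hB hA' hB' hqA hqB h
    have h2 : (2 : ℤ) ∣ idet A B := by
      apply even_idet
      simp only [EvenDiff] at *
      omega
    by_cases h0 : idet A B = 0
    · exact Or.inl (hA'.eq_of_primitive hA hB hB' h0)
    · right
      rw [abs_le] at h
      omega
  rcases aux hU hV hU' hV' hqU hqV h1 with h | h
  · exact Or.inl h
  rcases aux hV hW hV' hW' hqV hqW h2 with h' | h'
  · exact Or.inr (Or.inl h')
  rcases aux hW hU hW' hU' hqW hqU h3 with h'' | h''
  · exact Or.inr (Or.inr h'')
  exfalso
  -- The linear relation between three plane vectors. With all coefficients ±2 it becomes ±U ± V ± W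
  -- = 0, and modulo two this says that `q` vanishes.
  have i1 : idet V W * U.1 + idet W U * V.1 + idet U V * W.1 = 0 := by simp only [idet]; ring
  have i2 : idet V W * U.2 + idet W U * V.2 + idet U V * W.2 = 0 := by simp only [idet]; ring
  apply hq
  simp only [EvenDiff, Prod.fst_zero, Prod.snd_zero] at *
  rcases h with h | h <;> rcases h' with h' | h' <;> rcases h'' with h'' | h'' <;>
    rw [h, h', h''] at i1 i2 <;> omega

/-! ### One bit per value -/

/-- A family of functions in which every value is one of at most two, once the values of smaller
rank are known, is encoded by one bit for each value. -/
theorem exists_code {ι X : Type*} (C : Set ι) (κ : ι → ℕ) (F : Set (ι → X))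
    (hF : ∀ i ∈ C, ∀ f ∈ F, ∀ g ∈ F, ∀ h ∈ F, (∀ j ∈ C, κ j < κ i → f j = g j) →
      (∀ j ∈ C, κ j < κ i → h j = f j) → f i = g i ∨ g i = h i ∨ h i = f i) :
    ∃ Φ : (ι → X) → ι → Prop, ∀ f ∈ F, ∀ g ∈ F, (∀ i ∈ C, Φ f i ↔ Φ g i) →
      ∀ i ∈ C, f i = g i := by
  classical
  have key : ∀ (i : ι) (f : ι → X), f ∈ F →
      ∃ h : ι → X, h ∈ F ∧ ∀ j ∈ C, κ j < κ i → h j = f j :=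
    fun i f hf => ⟨f, hf, fun _ _ _ => rfl⟩
  obtain ⟨P, hP⟩ : ∃ P : ι → (ι → X) → (ι → X) → Prop, P = fun i f h =>
    h ∈ F ∧ ∀ j ∈ C, κ j < κ i → h j = f j := ⟨_, rfl⟩
  rcases F.eq_empty_or_nonempty with hemp | ⟨f₀, hf₀⟩
  · exact ⟨fun _ _ => True, fun f hf => by simp [hemp] at hf⟩
  -- A choice function on predicates: the reference `c (P i f)` depends on `f` only through its
  -- values of smaller rank, so functions that agree there share their reference.
  obtain ⟨c, hc⟩ : ∃ c : ((ι → X) → Prop) → (ι → X), ∀ p : (ι → X) → Prop, (∃ h, p h) → p (c p) :=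
    ⟨fun p => if h : ∃ f, p f then h.choose else f₀, fun p hp => by
      simp only [hp, dif_pos]; exact hp.choose_spec⟩
  -- Two values that both equal the reference value coincide trivially; two that both differ from it
  -- coincide by `hF`.
  refine ⟨fun f i => f i = c (P i f) i, fun f hf g hg hfg => ?_⟩
  have main : ∀ (k : ℕ), ∀ i ∈ C, κ i = k → f i = g i := by
    intro k
    induction k using Nat.strong_induction_on with
    | _ k ih =>
      intro i hi hk
      have hag : ∀ j ∈ C, κ j < κ i → f j = g j := fun j hj hlt => ih _ (hk ▸ hlt) j hj rfl
      have hPeq : P i f = P i g := by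
        rw [hP]
        funext h
        refine propext (and_congr_right fun _ => forall₃_congr fun j hj hlt => ?_)
        rw [hag j hj hlt]
      have hcP : P i f (c (P i f)) := hc _ (by rw [hP]; exact key i f hf)
      have hcP' := hcP
      rw [hP] at hcP'
      have h1 : f i = c (P i f) i ↔ g i = c (P i g) i := hfg i hi
      rw [← hPeq, hP] at h1
      rcases hF i hi f hf g hg _ hcP'.1 hag hcP'.2 with h | h | h
      · exact h
      · exact (h1.2 h).trans h.symm
      · exact h.symm.trans (h1.1 h.symm).symm
  exact fun i hi => main _ i hi rfl

/-! ### Direction fields and their encoding -/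

/-- The doubled midpoints of lattice segments in the doubled square `[0, N]²`. -/
def midpointBox (N : ℤ) : Set (ℤ × ℤ) :=
  {q | 0 ≤ q.1 ∧ q.1 ≤ N ∧ 0 ≤ q.2 ∧ q.2 ≤ N ∧ ¬ EvenDiff q 0}

/-- A direction field chooses for every half-integral point of the square a primitive segment
centred there, such that no two of these segments cross. -/
structure IsDirField (N : ℤ) (τ : ℤ × ℤ → ℤ × ℤ) : Prop where
  upper : ∀ q ∈ midpointBox N, IsUpper (τ q)
  primitive : ∀ q ∈ midpointBox N, IsCoprime (τ q).1 (τ q).2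
  parity : ∀ q ∈ midpointBox N, EvenDiff q (τ q)
  box_fst : ∀ q ∈ midpointBox N, |(τ q).1| ≤ q.1 ∧ |(τ q).1| ≤ N - q.1
  box_snd : ∀ q ∈ midpointBox N, |(τ q).2| ≤ q.2 ∧ |(τ q).2| ≤ N - q.2
  not_cross : ∀ q ∈ midpointBox N, ∀ r ∈ midpointBox N, ¬ SegCross (r - q) (τ q) (τ r)

/-- An injective linear ranking of the points of `[0, N]²`. -/
def boxRank (N : ℤ) (q : ℤ × ℤ) : ℕ := (q.1 + (N + 1) * q.2).toNat

/-- For a larger determinant take a blocking displacement `Y`. One of `q + Y`, `q - Y` has smaller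
rank, so both fields have the same segment there, and it crosses `τ q` or `σ q`. -/
theorem IsDirField.abs_idet_le_two {N : ℤ} {τ σ : ℤ × ℤ → ℤ × ℤ} (hτ : IsDirField N τ)
    (hσ : IsDirField N σ) {q : ℤ × ℤ} (hq : q ∈ midpointBox N)
    (h : ∀ r ∈ midpointBox N, boxRank N r < boxRank N q → τ r = σ r) :
    |idet (τ q) (σ q)| ≤ 2 := by
  by_contra! hdet
  have h1 := hτ.parity q hq
  have h2 := hσ.parity q hq
  have hpar : EvenDiff (σ q) (τ q) := by simp only [EvenDiff] at *; omega
  obtain ⟨Y, hY1, hY2, hYpar, hY0, hcross⟩ :=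
    exists_blocking (hτ.primitive q hq) (hσ.primitive q hq) hpar hdet
  have a1 := hY1 _ (hτ.box_fst q hq).1 (hσ.box_fst q hq).1
  have a2 := hY1 _ (hτ.box_fst q hq).2 (hσ.box_fst q hq).2
  have b1 := hY2 _ (hτ.box_snd q hq).1 (hσ.box_snd q hq).1
  have b2 := hY2 _ (hτ.box_snd q hq).2 (hσ.box_snd q hq).2
  rw [abs_le] at a1 a2 b1 b2
  -- The sign of the displacement matters only for the rank: neither classes modulo two nor crossing
  -- depend on it.
  have aux : ∀ Z : ℤ × ℤ, (Z = Y ∨ Z = -Y) → 0 < Z.1 + (N + 1) * Z.2 → False := by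
    intro Z hZ hneg
    have hmem : q - Z ∈ midpointBox N := by
      simp only [midpointBox, EvenDiff, Set.mem_ofPred_eq, Prod.fst_sub, Prod.snd_sub,
        Prod.fst_add, Prod.snd_add, Prod.fst_zero, Prod.snd_zero] at *
      rcases hZ with rfl | rfl
      · omega
      · simp only [Prod.fst_neg, Prod.snd_neg]; omega
    have hrank : boxRank N (q - Z) < boxRank N q := by
      simp only [boxRank, Prod.fst_sub, Prod.snd_sub]
      have e : q.1 - Z.1 + (N + 1) * (q.2 - Z.2) = q.1 + (N + 1) * q.2 - (Z.1 + (N + 1) * Z.2) := by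
        ring
      have hpos : 0 ≤ q.1 - Z.1 + (N + 1) * (q.2 - Z.2) := by
        have := hmem
        simp only [midpointBox, Set.mem_ofPred_eq, Prod.fst_sub, Prod.snd_sub] at this
        have h3 : 0 ≤ (N + 1) * (q.2 - Z.2) := mul_nonneg (by omega) (by omega)
        omega
      rw [e] at hpos ⊢
      generalize q.1 + (N + 1) * q.2 = A at *
      generalize Z.1 + (N + 1) * Z.2 = B at *
      omega
    have heq := h _ hmem hrank
    have hH : EvenDiff (τ (q - Z)) (τ q + Y) := by
      have h3 := hτ.parity _ hmem
      simp only [EvenDiff, Prod.fst_sub, Prod.snd_sub, Prod.fst_add, Prod.snd_add] at *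
      rcases hZ with rfl | rfl
      · omega
      · simp only [Prod.fst_neg, Prod.snd_neg] at *; omega
    have hd : ∀ U V, SegCross Y U V → SegCross (q - Z - q) U V := by
      intro U V hUV
      rcases hZ with rfl | rfl
      · rw [show q - Z - q = -Z by abel, segCross_neg_left]; exact hUV
      · rw [show q - -Y - q = Y by abel]; exact hUV
    rcases hcross _ hH with hc | hc
    · exact hτ.not_cross q hq _ hmem (hd _ _ hc)
    · refine hσ.not_cross q hq _ hmem ?_
      rw [← heq]
      exact hd _ _ hc
  rcases lt_trichotomy 0 (Y.1 + (N + 1) * Y.2) with hs | hs | hs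
  · exact aux Y (Or.inl rfl) hs
  -- The coordinate `Y.1` is too small to cancel a nonzero multiple of `N + 1`, so rank difference
  -- zero forces `Y = 0`.
  · have hY2 : Y.2 = 0 := by
      by_contra hne
      have hN : 0 < N + 1 := by omega
      rcases lt_or_gt_of_ne hne with h3 | h3
      · have : (N + 1) * Y.2 ≤ (N + 1) * (-1) := mul_le_mul_of_nonneg_left (by omega) hN.le
        omega
      · have : (N + 1) * 1 ≤ (N + 1) * Y.2 := mul_le_mul_of_nonneg_left (by omega) hN.le
        omega
    rw [hY2] at hs
    exact hY0 (Prod.ext (by simpa using hs.symm) hY2)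
  · refine aux (-Y) (Or.inr rfl) ?_
    simp only [Prod.fst_neg, Prod.snd_neg]
    linarith

/-- Three fields that agree at smaller rank have pairwise determinants at most two at `q`, so
`eq_of_three` supplies the hypothesis of `exists_code`. -/
theorem exists_dirField_code (N : ℤ) :
    ∃ Φ : (ℤ × ℤ → ℤ × ℤ) → ℤ × ℤ → Prop, ∀ τ σ, IsDirField N τ → IsDirField N σ →
      (∀ q ∈ midpointBox N, Φ τ q ↔ Φ σ q) → ∀ q ∈ midpointBox N, τ q = σ q := by
  obtain ⟨Φ, hΦ⟩ := exists_code (midpointBox N) (boxRank N) {τ | IsDirField N τ} (by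
    intro q hq f hf g hg h hh hfg hhf
    replace hf : IsDirField N f := hf
    replace hg : IsDirField N g := hg
    replace hh : IsDirField N h := hh
    refine eq_of_three hq.2.2.2.2 (hf.primitive q hq) (hg.primitive q hq) (hh.primitive q hq)
      (hf.upper q hq) (hg.upper q hq) (hh.upper q hq) (hf.parity q hq) (hg.parity q hq)
      (hh.parity q hq) (hf.abs_idet_le_two hg hq hfg) (hg.abs_idet_le_two hh hq ?_)
      (hh.abs_idet_le_two hf hq hhf)
    intro r hr hlt
    rw [← hfg r hr hlt, hhf r hr hlt])
  exact ⟨Φ, fun τ σ hτ hσ h => hΦ τ hτ σ hσ h⟩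

/-! ### Systems of primitive segments in a lattice triangle -/

/-- The position of the doubled point `z` relative to the line from `a` to `b`. -/
def lineDet (a b z : ℤ × ℤ) : ℤ := idet (b - a) (z - 2 • a)

theorem lineDet_eq (a b z : ℤ × ℤ) :
    lineDet a b z = (b.1 - a.1) * (z.2 - 2 * a.2) - (b.2 - a.2) * (z.1 - 2 * a.1) := by
  obtain ⟨a1, a2⟩ := a
  simp only [lineDet, idet, Prod.fst_sub, Prod.snd_sub, Prod.smul_mk, nsmul_eq_mul, Nat.cast_ofNat]

/-- The doubled point `z` lies in the positively oriented triangle `a b c`. -/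
def InTri (a b c z : ℤ × ℤ) : Prop := 0 ≤ lineDet a b z ∧ 0 ≤ lineDet b c z ∧ 0 ≤ lineDet c a z

/-- A set of pairwise noncrossing primitive segments in the triangle `a b c` such that every
half-integral point of the triangle is the midpoint of one of them. -/
structure IsTriSystem (a b c : ℤ × ℤ) (S : Set ((ℤ × ℤ) × (ℤ × ℤ))) : Prop where
  primitive : ∀ x ∈ S, IsCoprime x.2.1 x.2.2
  parity : ∀ x ∈ S, EvenDiff x.1 x.2
  inTri_add : ∀ x ∈ S, InTri a b c (x.1 + x.2)
  inTri_sub : ∀ x ∈ S, InTri a b c (x.1 - x.2)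
  not_cross : ∀ x ∈ S, ∀ y ∈ S, ¬ SegCross (y.1 - x.1) x.2 y.2
  complete : ∀ q, ¬ EvenDiff q 0 → InTri a b c q → ∃ U, (q, U) ∈ S

/-- Separation by a line of direction `w` gives |w∧U| + |w∧V| ≤ |w∧(r-q)|, while (U∧V)(w∧(r-q)) =
((r-q)∧V)(w∧U) - ((r-q)∧U)(w∧V). The strict inequalities of a crossing make these incompatible
unless `U` and `V` are both parallel to `w`, and then U∧V = 0. -/
theorem not_cross_of_separated {w p q U r V : ℤ × ℤ} (hw : w ≠ 0)
    (h1 : 0 ≤ idet w (q + U - p)) (h2 : 0 ≤ idet w (q - U - p))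
    (h3 : idet w (r + V - p) ≤ 0) (h4 : idet w (r - V - p) ≤ 0) : ¬ SegCross (r - q) U V := by
  rintro ⟨c1, c2⟩
  have hU : |idet w U| ≤ idet w (q - p) := by
    rw [abs_le]
    simp only [idet, Prod.fst_add, Prod.snd_add, Prod.fst_sub, Prod.snd_sub] at *
    constructor <;> linarith
  have hV : |idet w V| ≤ idet w (p - r) := by
    rw [abs_le]
    simp only [idet, Prod.fst_add, Prod.snd_add, Prod.fst_sub, Prod.snd_sub] at *
    constructor <;> linarith
  have hsum : idet w (q - p) + idet w (p - r) = - idet w (r - q) := by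
    simp only [idet, Prod.fst_sub, Prod.snd_sub]; ring
  have hid : idet U V * idet w (r - q) =
      idet (r - q) V * idet w U - idet (r - q) U * idet w V := by
    simp only [idet]; ring
  have hD : 0 < |idet U V| := lt_of_le_of_lt (abs_nonneg _) c1
  have hle : |idet U V| * (|idet w U| + |idet w V|) ≤
      |idet (r - q) V| * |idet w U| + |idet (r - q) U| * |idet w V| := by
    calc |idet U V| * (|idet w U| + |idet w V|)
        ≤ |idet U V| * |idet w (r - q)| := by
          refine mul_le_mul_of_nonneg_left ?_ hD.le
          have := neg_le_abs (idet w (r - q))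
          linarith
      _ = |idet (r - q) V * idet w U - idet (r - q) U * idet w V| := by rw [← abs_mul, hid]
      _ ≤ |idet (r - q) V * idet w U| + |idet (r - q) U * idet w V| := abs_sub _ _
      _ = _ := by rw [abs_mul, abs_mul]
  have hU0 : idet w U = 0 := by
    by_contra hne
    have := abs_pos.2 hne
    nlinarith [abs_nonneg (idet w V)]
  have hV0 : idet w V = 0 := by
    by_contra hne
    have := abs_pos.2 hne
    nlinarith [abs_nonneg (idet w U)]
  have e1 : w.1 * idet U V = 0 := by
    simp only [idet] at *
    linear_combination U.1 * hV0 - V.1 * hU0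
  have e2 : w.2 * idet U V = 0 := by
    simp only [idet] at *
    linear_combination U.2 * hV0 - V.2 * hU0
  have hne : idet U V ≠ 0 := abs_pos.1 hD
  exact hw (Prod.ext ((mul_eq_zero.1 e1).resolve_right hne) ((mul_eq_zero.1 e2).resolve_right hne))

/-- The three determinants at `v` are its barycentric weights times the determinant `D` of the
triangle. The strict bounds say that `v` is not a vertex; it may lie on a side. -/
theorem exists_latticePoint_in_triangle {a b c : ℤ × ℤ} (h : 2 ≤ idet (b - a) (c - a)) :
    ∃ v : ℤ × ℤ, 0 ≤ idet (b - v) (c - v) ∧ 0 ≤ idet (c - v) (a - v) ∧ 0 ≤ idet (a - v) (b - v) ∧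
      idet (b - v) (c - v) < idet (b - a) (c - a) ∧ idet (c - v) (a - v) < idet (b - a) (c - a) ∧
      idet (a - v) (b - v) < idet (b - a) (c - a) := by
  obtain ⟨D, hD⟩ : ∃ D, D = idet (b - a) (c - a) := ⟨_, rfl⟩
  rw [← hD] at h ⊢
  -- Otherwise both unit vectors would have integral coordinates with respect to `b - a`, `c - a`,
  -- and `D` would be a unit.
  have hz : ∃ z : ℤ × ℤ, ¬ (D ∣ idet z (c - a) ∧ D ∣ idet (b - a) z) := by
    by_contra! hall
    obtain ⟨⟨x1, h1⟩, y1, h2⟩ := hall (1, 0)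
    obtain ⟨⟨x2, h3⟩, y2, h4⟩ := hall (0, 1)
    have h5 : D * 1 = D * (D * (y2 * x1 - y1 * x2)) := by
      simp only [idet] at *
      linear_combination hD + (b - a).1 * h1 + D * x1 * h4 + (c - a).1 * h2 - D * y1 * h3
    have h6 := mul_left_cancel₀ (by omega) h5
    have h7 : IsUnit D := IsUnit.of_mul_eq_one _ h6.symm
    have := Int.isUnit_iff.1 h7
    omega
  obtain ⟨z, hz⟩ := hz
  obtain ⟨X, hX⟩ : ∃ X, X = idet z (c - a) := ⟨_, rfl⟩
  obtain ⟨Y, hY⟩ : ∃ Y, Y = idet (b - a) z := ⟨_, rfl⟩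
  rw [← hX, ← hY] at hz
  have hX0 := Int.emod_nonneg X (show D ≠ 0 by omega)
  have hY0 := Int.emod_nonneg Y (show D ≠ 0 by omega)
  have hX1 := Int.emod_lt_of_pos X (show 0 < D by omega)
  have hY1 := Int.emod_lt_of_pos Y (show 0 < D by omega)
  have hXY : ¬ (X % D = 0 ∧ Y % D = 0) := by
    rintro ⟨h1, h2⟩
    exact hz ⟨Int.dvd_of_emod_eq_zero h1, Int.dvd_of_emod_eq_zero h2⟩
  have eX := Int.emod_add_mul_ediv X D
  have eY := Int.emod_add_mul_ediv Y D
  -- Fractional parts of the coordinates X/D, Y/D of `z` give a lattice point of the parallelogram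
  -- spanned at `a`. It lies in the triangle if their sum is at most one; otherwise its reflection
  -- in the centre of the parallelogram does.
  by_cases hs : X % D + Y % D ≤ D
  · refine ⟨a + z - (X / D) • (b - a) - (Y / D) • (c - a), ?_⟩
    have e1 : idet (c - (a + z - (X / D) • (b - a) - (Y / D) • (c - a)))
        (a - (a + z - (X / D) • (b - a) - (Y / D) • (c - a))) = X % D := by
      simp only [idet, Prod.fst_add, Prod.snd_add, Prod.fst_sub, Prod.snd_sub, Prod.smul_fst,
        Prod.smul_snd, smul_eq_mul] at *
      linear_combination -hX - eX + (X / D) * hD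
    have e2 : idet (a - (a + z - (X / D) • (b - a) - (Y / D) • (c - a)))
        (b - (a + z - (X / D) • (b - a) - (Y / D) • (c - a))) = Y % D := by
      simp only [idet, Prod.fst_add, Prod.snd_add, Prod.fst_sub, Prod.snd_sub, Prod.smul_fst,
        Prod.smul_snd, smul_eq_mul] at *
      linear_combination -hY - eY + (Y / D) * hD
    have e3 : ∀ v : ℤ × ℤ, idet (b - v) (c - v) = D - idet (c - v) (a - v) - idet (a - v) (b - v) := by
      intro v
      rw [hD]
      simp only [idet, Prod.fst_sub, Prod.snd_sub]
      ring
    rw [e3, e1, e2]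
    omega
  · refine ⟨b + c - a - z + (X / D) • (b - a) + (Y / D) • (c - a), ?_⟩
    have e1 : idet (c - (b + c - a - z + (X / D) • (b - a) + (Y / D) • (c - a)))
        (a - (b + c - a - z + (X / D) • (b - a) + (Y / D) • (c - a))) = D - X % D := by
      simp only [idet, Prod.fst_add, Prod.snd_add, Prod.fst_sub, Prod.snd_sub, Prod.smul_fst,
        Prod.smul_snd, smul_eq_mul] at *
      linear_combination hX + eX - (X / D) * hD - hD
    have e2 : idet (a - (b + c - a - z + (X / D) • (b - a) + (Y / D) • (c - a)))
        (b - (b + c - a - z + (X / D) • (b - a) + (Y / D) • (c - a))) = D - Y % D := by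
      simp only [idet, Prod.fst_add, Prod.snd_add, Prod.fst_sub, Prod.snd_sub, Prod.smul_fst,
        Prod.smul_snd, smul_eq_mul] at *
      linear_combination hY + eY - (Y / D) * hD - hD
    have e3 : ∀ v : ℤ × ℤ, idet (b - v) (c - v) = D - idet (c - v) (a - v) - idet (a - v) (b - v) := by
      intro v
      rw [hD]
      simp only [idet, Prod.fst_sub, Prod.snd_sub]
      ring
    rw [e3, e1, e2]
    omega

/-- The doubled points of a unimodular triangle have nonnegative integral barycentric weights of sum
two. Weights 2, 0, 0 give doubled vertices, which are even; weights 1, 1, 0 give the doubled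
midpoints of the sides. -/
theorem isTriSystem_of_det_eq_one {a b c : ℤ × ℤ} (h : idet (b - a) (c - a) = 1) :
    IsTriSystem a b c {(a + b, b - a), (b + c, c - b), (c + a, a - c)} := by
  obtain ⟨a1, a2⟩ := a
  obtain ⟨b1, b2⟩ := b
  obtain ⟨c1, c2⟩ := c
  simp only [idet, Prod.mk_sub_mk] at h
  constructor
  · rintro x (rfl | rfl | rfl) <;> simp only [Prod.mk_sub_mk]
    · exact ⟨c2 - a2, -(c1 - a1), by linear_combination h⟩
    · exact ⟨-(b2 - a2), b1 - a1, by linear_combination h⟩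
    · exact ⟨b2 - a2, -(b1 - a1), by linear_combination h⟩
  · rintro x (rfl | rfl | rfl) <;> simp only [Prod.mk_sub_mk, Prod.mk_add_mk, EvenDiff] <;> omega
  · rintro x (rfl | rfl | rfl) <;>
    simp only [Prod.mk_sub_mk, Prod.mk_add_mk, InTri, lineDet, idet, Prod.smul_mk, nsmul_eq_mul,
      Nat.cast_ofNat] <;> refine ⟨?_, ?_, ?_⟩ <;> linarith
  · rintro x (rfl | rfl | rfl) <;>
    simp only [Prod.mk_sub_mk, Prod.mk_add_mk, InTri, lineDet, idet, Prod.smul_mk, nsmul_eq_mul,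
      Nat.cast_ofNat] <;> refine ⟨?_, ?_, ?_⟩ <;> linarith
  -- Two sides touch only at an end point, which makes the first inequality of `SegCross` an
  -- equality; for a side and itself both its terms are zero.
  · have e : ∀ x y z w : ℤ, |x| = |y| → ¬ (|x| < |y| ∧ |z| < |w|) := fun x y z w hxy hc => by
      omega
    rintro x (rfl | rfl | rfl) y (rfl | rfl | rfl) <;> apply e <;> rw [abs_eq_abs] <;>
      simp only [Prod.mk_sub_mk, Prod.mk_add_mk, idet] <;>
      first
        | (left; ring1)
        | (right; ring1)
  · rintro ⟨q1, q2⟩ hq ⟨h1, h2, h3⟩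
    simp only [Prod.mk_sub_mk, lineDet, idet, Prod.smul_mk, nsmul_eq_mul, Nat.cast_ofNat, EvenDiff,
      Prod.fst_zero, Prod.snd_zero, sub_zero] at hq h1 h2 h3
    obtain ⟨p, hp⟩ : ∃ p, p = (c1 - b1) * (q2 - 2 * b2) - (c2 - b2) * (q1 - 2 * b1) := ⟨_, rfl⟩
    obtain ⟨q, hq'⟩ : ∃ q, q = (a1 - c1) * (q2 - 2 * c2) - (a2 - c2) * (q1 - 2 * c1) := ⟨_, rfl⟩
    obtain ⟨r, hr⟩ : ∃ r, r = (b1 - a1) * (q2 - 2 * a2) - (b2 - a2) * (q1 - 2 * a1) := ⟨_, rfl⟩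
    rw [← hp] at h2
    rw [← hq'] at h3
    rw [← hr] at h1
    have hsum : p + q + r = 2 := by rw [hp, hq', hr]; linear_combination 2 * h
    have hz1 : q1 = p * a1 + q * b1 + r * c1 := by
      rw [hp, hq', hr]; linear_combination (-q1) * h
    have hz2 : q2 = p * a2 + q * b2 + r * c2 := by
      rw [hp, hq', hr]; linear_combination (-q2) * h
    clear hp hq' hr
    have hp2 : p ≤ 2 := by omega
    have hq2 : q ≤ 2 := by omega
    obtain rfl : r = 2 - p - q := by omega
    interval_cases p <;> interval_cases q <;> first
      | (exfalso; omega)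
      | (refine ⟨(b1, b2) - (a1, a2), Or.inl ?_⟩
         simp only [Prod.mk_add_mk, hz1, hz2]; congr 2 <;> ring1)
      | (refine ⟨(c1, c2) - (b1, b2), Or.inr (Or.inl ?_)⟩
         simp only [Prod.mk_add_mk, hz1, hz2]; congr 2 <;> ring1)
      | (refine ⟨(a1, a2) - (c1, c2), Or.inr (Or.inr ?_)⟩
         simp only [Prod.mk_add_mk, hz1, hz2]; congr 2 <;> ring1)

/-- The smallest of p/x, q/y, r/z among those with positive denominator, in cross-multiplied form.
For the weights x, y, z of `v` and p, q, r of a point, it names the part containing the point when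
the triangle is split at `v`. -/
theorem exists_min_ratio {x y z p q r : ℤ} (hx : 0 ≤ x) (hy : 0 ≤ y) (hz : 0 ≤ z) (hp : 0 ≤ p)
    (hq : 0 ≤ q) (hr : 0 ≤ r) (h : 0 < x + y + z) :
    (0 < x ∧ p * y ≤ q * x ∧ p * z ≤ r * x) ∨ (0 < y ∧ q * x ≤ p * y ∧ q * z ≤ r * y) ∨
      (0 < z ∧ r * x ≤ p * z ∧ r * y ≤ q * z) := by
  by_cases h1 : 0 < x ∧ p * y ≤ q * x
  · obtain ⟨hx0, h1⟩ := h1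
    by_cases h2 : p * z ≤ r * x
    · exact Or.inl ⟨hx0, h1, h2⟩
    push Not at h2
    have hz0 : 0 < z := by
      rcases hz.eq_or_lt with rfl | hz0
      · nlinarith
      · exact hz0
    refine Or.inr (Or.inr ⟨hz0, h2.le, le_of_mul_le_mul_left (a := x) ?_ hx0⟩)
    nlinarith
  have h1' : q * x ≤ p * y := by
    by_cases hx0 : 0 < x
    · by_contra! h2
      exact h1 ⟨hx0, h2.le⟩
    · obtain rfl : x = 0 := by omega
      nlinarith
  by_cases hy0 : 0 < y
  · by_cases h2 : q * z ≤ r * y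
    · exact Or.inr (Or.inl ⟨hy0, h1', h2⟩)
    push Not at h2
    have hz0 : 0 < z := by
      rcases hz.eq_or_lt with rfl | hz0
      · nlinarith
      · exact hz0
    refine Or.inr (Or.inr ⟨hz0, le_of_mul_le_mul_left (a := y) ?_ hy0, h2.le⟩)
    nlinarith
  · obtain rfl : y = 0 := by omega
    obtain rfl : x = 0 := by
      by_contra hx0
      exact h1 ⟨by omega, by nlinarith⟩
    exact Or.inr (Or.inr ⟨by omega, by nlinarith, by nlinarith⟩)

theorem inTri_rotate {a b c z : ℤ × ℤ} : InTri a b c z ↔ InTri b c a z := by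
  simp only [InTri]; tauto

theorem inTri_of_inTri_sub {a b c v z : ℤ × ℤ} (hx : 0 < idet (b - v) (c - v))
    (hy : 0 ≤ idet (c - v) (a - v)) (hz : 0 ≤ idet (a - v) (b - v))
    (h : InTri v b c z) : InTri a b c z := by
  obtain ⟨h1, h2, h3⟩ := h
  obtain ⟨D, hD⟩ : ∃ D, D = idet (b - v) (c - v) + idet (c - v) (a - v) + idet (a - v) (b - v) :=
    ⟨_, rfl⟩
  have i1 : idet (b - v) (c - v) * lineDet a b z =
      lineDet b c z * idet (a - v) (b - v) + lineDet v b z * D := by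
    rw [hD]
    simp only [lineDet_eq, idet, Prod.fst_sub, Prod.snd_sub]
    ring
  have i2 : idet (b - v) (c - v) * lineDet c a z =
      lineDet b c z * idet (c - v) (a - v) + lineDet c v z * D := by
    rw [hD]
    simp only [lineDet_eq, idet, Prod.fst_sub, Prod.snd_sub]
    ring
  have hD0 : 0 ≤ D := by omega
  refine ⟨nonneg_of_mul_nonneg_right (a := idet (b - v) (c - v)) ?_ hx, h2,
    nonneg_of_mul_nonneg_right (a := idet (b - v) (c - v)) ?_ hx⟩
  · rw [i1]; positivity
  · rw [i2]; positivity

/-- Writing the vertex `a` through `v`, `b`, `c` turns the weights of `z` into weights for the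
triangle `v b c`; the two ratio inequalities say that the new weights of `b` and `c` are
nonnegative. -/
theorem inTri_sub_of_ratio {a b c v z : ℤ × ℤ} (hD : 0 < idet (b - a) (c - a))
    (h : InTri a b c z)
    (h1 : lineDet b c z * idet (c - v) (a - v) ≤ lineDet c a z * idet (b - v) (c - v))
    (h2 : lineDet b c z * idet (a - v) (b - v) ≤ lineDet a b z * idet (b - v) (c - v)) :
    InTri v b c z := by
  have i1 : idet (b - a) (c - a) * lineDet v b z =
      lineDet a b z * idet (b - v) (c - v) - lineDet b c z * idet (a - v) (b - v) := by
    simp only [lineDet_eq, idet, Prod.fst_sub, Prod.snd_sub]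
    ring
  have i2 : idet (b - a) (c - a) * lineDet c v z =
      lineDet c a z * idet (b - v) (c - v) - lineDet b c z * idet (c - v) (a - v) := by
    simp only [lineDet_eq, idet, Prod.fst_sub, Prod.snd_sub]
    ring
  refine ⟨nonneg_of_mul_nonneg_right (a := idet (b - a) (c - a)) ?_ hD, h.2.1,
    nonneg_of_mul_nonneg_right (a := idet (b - a) (c - a)) ?_ hD⟩
  · rw [i1]; linarith
  · rw [i2]; linarith

theorem lineDet_swap (a b z : ℤ × ℤ) : lineDet b a z = -lineDet a b z := by
  simp only [lineDet_eq]
  ring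

theorem not_cross_of_lineDet {u v q U r V : ℤ × ℤ} (huv : u ≠ v)
    (h1 : 0 ≤ lineDet u v (q + U)) (h2 : 0 ≤ lineDet u v (q - U))
    (h3 : 0 ≤ lineDet v u (r + V)) (h4 : 0 ≤ lineDet v u (r - V)) :
    ¬ SegCross (r - q) U V ∧ ¬ SegCross (q - r) V U := by
  rw [lineDet_swap] at h3 h4
  have h : ¬ SegCross (r - q) U V :=
    not_cross_of_separated (sub_ne_zero.2 huv.symm) h1 h2 (by unfold lineDet at h3; omega)
      (by unfold lineDet at h4; omega)
  refine ⟨h, fun hc => h ?_⟩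
  rw [show r - q = -(q - r) by abel, segCross_neg_left]
  exact segCross_swap.1 hc

/-- Every lattice triangle has a system of primitive segments. -/
theorem exists_isTriSystem (a b c : ℤ × ℤ) (h : 0 < idet (b - a) (c - a)) :
    ∃ S, IsTriSystem a b c S := by
  obtain ⟨k, hk⟩ : ∃ k : ℕ, k = (idet (b - a) (c - a)).toNat := ⟨_, rfl⟩
  induction k using Nat.strong_induction_on generalizing a b c with
  | _ k ih =>
  by_cases h1 : idet (b - a) (c - a) = 1
  · exact ⟨_, isTriSystem_of_det_eq_one h1⟩
  obtain ⟨v, hx, hy, hz, hx', hy', hz'⟩ :=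
    exists_latticePoint_in_triangle (a := a) (b := b) (c := c) (by omega)
  -- Induction on the determinant, splitting at `v`. If `v` lies on a side, one part is degenerate
  -- and receives the empty system, so a member of a part's system certifies that the part is
  -- nondegenerate.
  have sub : ∀ a' b' c' : ℤ × ℤ, idet (b' - a') (c' - a') < idet (b - a) (c - a) →
      ∃ S, (0 < idet (b' - a') (c' - a') → IsTriSystem a' b' c' S) ∧
        (S.Nonempty → 0 < idet (b' - a') (c' - a')) := by
    intro a' b' c' hlt
    by_cases hpos : 0 < idet (b' - a') (c' - a')
    · obtain ⟨S, hS⟩ := ih _ (by omega) a' b' c' hpos rfl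
      exact ⟨S, fun _ => hS, fun _ => hpos⟩
    · exact ⟨∅, fun h => absurd h hpos, fun h => absurd h Set.not_nonempty_empty⟩
  obtain ⟨S1, hS1, hn1⟩ := sub v b c hx'
  obtain ⟨S2, hS2, hn2⟩ := sub v c a hy'
  obtain ⟨S3, hS3, hn3⟩ := sub v a b hz'
  have hsum : idet (b - v) (c - v) + idet (c - v) (a - v) + idet (a - v) (b - v) =
      idet (b - a) (c - a) := by
    simp only [idet, Prod.fst_sub, Prod.snd_sub]; ring
  have hva : v ≠ a := by rintro rfl; exact hx'.ne rfl
  have hvb : v ≠ b := by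
    rintro rfl
    simp [idet] at hsum hy'
    linarith
  have hvc : v ≠ c := by
    rintro rfl
    simp [idet] at hsum hz'
    linarith
  have in1 : ∀ z, 0 < idet (b - v) (c - v) → InTri v b c z → InTri a b c z :=
    fun z hp hz0 => inTri_of_inTri_sub hp hy hz hz0
  have in2 : ∀ z, 0 < idet (c - v) (a - v) → InTri v c a z → InTri a b c z :=
    fun z hp hz0 => inTri_rotate.2 (inTri_of_inTri_sub hp hz hx hz0)
  have in3 : ∀ z, 0 < idet (a - v) (b - v) → InTri v a b z → InTri a b c z :=
    fun z hp hz0 => inTri_rotate.1 (inTri_of_inTri_sub hp hx hy hz0)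
  refine ⟨S1 ∪ S2 ∪ S3, ?_, ?_, ?_, ?_, ?_, ?_⟩
  · rintro x ((h | h) | h)
    · exact (hS1 (hn1 ⟨x, h⟩)).primitive x h
    · exact (hS2 (hn2 ⟨x, h⟩)).primitive x h
    · exact (hS3 (hn3 ⟨x, h⟩)).primitive x h
  · rintro x ((h | h) | h)
    · exact (hS1 (hn1 ⟨x, h⟩)).parity x h
    · exact (hS2 (hn2 ⟨x, h⟩)).parity x h
    · exact (hS3 (hn3 ⟨x, h⟩)).parity x h
  · rintro x ((h | h) | h)
    · exact in1 _ (hn1 ⟨x, h⟩) ((hS1 (hn1 ⟨x, h⟩)).inTri_add x h)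
    · exact in2 _ (hn2 ⟨x, h⟩) ((hS2 (hn2 ⟨x, h⟩)).inTri_add x h)
    · exact in3 _ (hn3 ⟨x, h⟩) ((hS3 (hn3 ⟨x, h⟩)).inTri_add x h)
  · rintro x ((h | h) | h)
    · exact in1 _ (hn1 ⟨x, h⟩) ((hS1 (hn1 ⟨x, h⟩)).inTri_sub x h)
    · exact in2 _ (hn2 ⟨x, h⟩) ((hS2 (hn2 ⟨x, h⟩)).inTri_sub x h)
    · exact in3 _ (hn3 ⟨x, h⟩) ((hS3 (hn3 ⟨x, h⟩)).inTri_sub x h)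
  -- Segments of different parts are separated by the line through `v` and the vertex that these
  -- parts share.
  · have c12 : ∀ x ∈ S1, ∀ y ∈ S2,
        ¬ SegCross (y.1 - x.1) x.2 y.2 ∧ ¬ SegCross (x.1 - y.1) y.2 x.2 := fun x hx y hy =>
      not_cross_of_lineDet hvc.symm ((hS1 (hn1 ⟨x, hx⟩)).inTri_add x hx).2.2
        ((hS1 (hn1 ⟨x, hx⟩)).inTri_sub x hx).2.2 ((hS2 (hn2 ⟨y, hy⟩)).inTri_add y hy).1
        ((hS2 (hn2 ⟨y, hy⟩)).inTri_sub y hy).1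
    have c23 : ∀ x ∈ S2, ∀ y ∈ S3,
        ¬ SegCross (y.1 - x.1) x.2 y.2 ∧ ¬ SegCross (x.1 - y.1) y.2 x.2 := fun x hx y hy =>
      not_cross_of_lineDet hva.symm ((hS2 (hn2 ⟨x, hx⟩)).inTri_add x hx).2.2
        ((hS2 (hn2 ⟨x, hx⟩)).inTri_sub x hx).2.2 ((hS3 (hn3 ⟨y, hy⟩)).inTri_add y hy).1
        ((hS3 (hn3 ⟨y, hy⟩)).inTri_sub y hy).1
    have c31 : ∀ x ∈ S3, ∀ y ∈ S1,
        ¬ SegCross (y.1 - x.1) x.2 y.2 ∧ ¬ SegCross (x.1 - y.1) y.2 x.2 := fun x hx y hy =>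
      not_cross_of_lineDet hvb.symm ((hS3 (hn3 ⟨x, hx⟩)).inTri_add x hx).2.2
        ((hS3 (hn3 ⟨x, hx⟩)).inTri_sub x hx).2.2 ((hS1 (hn1 ⟨y, hy⟩)).inTri_add y hy).1
        ((hS1 (hn1 ⟨y, hy⟩)).inTri_sub y hy).1
    rintro x ((hx | hx) | hx) y ((hy | hy) | hy)
    · exact (hS1 (hn1 ⟨x, hx⟩)).not_cross x hx y hy
    · exact (c12 x hx y hy).1
    · exact (c31 y hy x hx).2
    · exact (c12 y hy x hx).2
    · exact (hS2 (hn2 ⟨x, hx⟩)).not_cross x hx y hy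
    · exact (c23 x hx y hy).1
    · exact (c31 x hx y hy).1
    · exact (c23 y hy x hx).2
    · exact (hS3 (hn3 ⟨x, hx⟩)).not_cross x hx y hy
  · intro q hq hin
    rcases exists_min_ratio hx hy hz hin.2.1 hin.2.2 hin.1 (by omega) with
      ⟨h0, h1, h2⟩ | ⟨h0, h1, h2⟩ | ⟨h0, h1, h2⟩
    · obtain ⟨U, hU⟩ := (hS1 h0).complete q hq (inTri_sub_of_ratio h hin h1 h2)
      exact ⟨U, Or.inl (Or.inl hU)⟩
    · have hD' : 0 < idet (c - b) (a - b) := by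
        simp only [idet, Prod.fst_sub, Prod.snd_sub] at h ⊢; linarith
      obtain ⟨U, hU⟩ := (hS2 h0).complete q hq
        (inTri_sub_of_ratio hD' (inTri_rotate.1 hin) h2 h1)
      exact ⟨U, Or.inl (Or.inr hU)⟩
    · have hD' : 0 < idet (a - c) (b - c) := by
        simp only [idet, Prod.fst_sub, Prod.snd_sub] at h ⊢; linarith
      obtain ⟨U, hU⟩ := (hS3 h0).complete q hq
        (inTri_sub_of_ratio hD' (inTri_rotate.2 hin) h1 h2)
      exact ⟨U, Or.inr hU⟩

/-! ### Faces of a simplex -/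

section Simplices

variable {E : Type*} [AddCommGroup E] [Module ℝ E]

/-- A convex combination of affinely independent points that lies in the hull of some of them has
weight zero on the others. -/
theorem AffineIndependent.weight_eq_zero {s t : Finset E}
    (hs : AffineIndependent ℝ ((↑) : s → E)) (hts : t ⊆ s) {w : E → ℝ} (hw : ∑ y ∈ s, w y = 1)
    (hx : ∑ y ∈ s, w y • y ∈ convexHull ℝ (t : Set E)) {y : E} (hy : y ∈ s) (hyt : y ∉ t) :
    w y = 0 := by
  classical
  obtain ⟨u, -, hu1, hux⟩ := Finset.mem_convexHull'.1 hx
  have h1 : ∑ y ∈ s, (if y ∈ t then u y else 0) = 1 := by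
    rw [← Finset.sum_filter, Finset.filter_mem_eq_inter, Finset.inter_eq_right.2 hts, hu1]
  have h2 : ∑ y ∈ s, (if y ∈ t then u y else 0) • y = ∑ y ∈ s, w y • y := by
    simp_rw [ite_smul, zero_smul]
    rw [← Finset.sum_filter, Finset.filter_mem_eq_inter, Finset.inter_eq_right.2 hts, hux]
  have h3 := hs.eq_zero_of_sum_eq_zero_subtype (w := fun y => w y - if y ∈ t then u y else 0)
    (by rw [Finset.sum_sub_distrib, hw, h1, sub_self])
    (by simp_rw [sub_smul]; rw [Finset.sum_sub_distrib, h2, sub_self]) y hy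
  simpa [hyt] using h3

/-- The faces of a simplex are extreme. -/
theorem AffineIndependent.mem_convexHull_of_mem_openSegment {s t : Finset E}
    (hs : AffineIndependent ℝ ((↑) : s → E)) (hts : t ⊆ s) {p q x : E}
    (hp : p ∈ convexHull ℝ (s : Set E)) (hq : q ∈ convexHull ℝ (s : Set E))
    (hx : x ∈ openSegment ℝ p q) (hxt : x ∈ convexHull ℝ (t : Set E)) :
    p ∈ convexHull ℝ (t : Set E) := by
  classical
  obtain ⟨w, hw0, hw1, rfl⟩ := Finset.mem_convexHull'.1 hp
  obtain ⟨v, hv0, hv1, rfl⟩ := Finset.mem_convexHull'.1 hq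
  obtain ⟨a, b, ha, hb, hab, rfl⟩ := hx
  have hsum : ∑ y ∈ s, (a * w y + b * v y) • y = a • ∑ y ∈ s, w y • y + b • ∑ y ∈ s, v y • y := by
    simp_rw [add_smul, mul_smul, Finset.sum_add_distrib, Finset.smul_sum]
  rw [← hsum] at hxt
  have hone : ∑ y ∈ s, (a * w y + b * v y) = 1 := by
    rw [Finset.sum_add_distrib, ← Finset.mul_sum, ← Finset.mul_sum, hw1, hv1, mul_one, mul_one, hab]
  have hzero : ∀ y ∈ s, y ∉ t → w y = 0 := by
    intro y hy hyt
    have h0 := hs.weight_eq_zero hts hone hxt hy hyt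
    have h1 := mul_nonneg hb.le (hv0 y hy)
    have h2 := mul_nonneg ha.le (hw0 y hy)
    have h3 : a * w y = 0 := by linarith
    exact (mul_eq_zero.1 h3).resolve_left ha.ne'
  refine Finset.mem_convexHull'.2 ⟨w, fun y hy => hw0 y (hts hy), ?_, ?_⟩
  · rw [← hw1]
    exact Finset.sum_subset hts fun y hy hyt => hzero y hy hyt
  · exact Finset.sum_subset hts fun y hy hyt => by rw [hzero y hy hyt, zero_smul]

theorem AffineIndependent.extremePoints_convexHull {s : Finset E}
    (hs : AffineIndependent ℝ ((↑) : s → E)) :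
    (convexHull ℝ (s : Set E)).extremePoints ℝ = s := by
  refine Set.Subset.antisymm extremePoints_convexHull_subset fun v hv => ?_
  refine mem_extremePoints_iff_left.2 ⟨subset_convexHull ℝ _ hv, fun p hp q hq hvpq => ?_⟩
  have h := hs.mem_convexHull_of_mem_openSegment (t := {v}) (by simpa using hv) hp hq hvpq (by simp)
  simpa using h

/-- The witness is the barycentre, which has no zero weight. It serves to show that a face whose
barycentre lies in another face is contained in that face. -/
theorem AffineIndependent.exists_mem_convexHull_forall_subset {s : Finset E} (hne : s.Nonempty)
    (hs : AffineIndependent ℝ ((↑) : s → E)) :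
    ∃ x ∈ convexHull ℝ (s : Set E), ∀ t ⊆ s, x ∈ convexHull ℝ (t : Set E) → t = s := by
  have hc : (0 : ℝ) < s.card := by exact_mod_cast hne.card_pos
  have h1 : ∑ _y ∈ s, (s.card : ℝ)⁻¹ = 1 := by
    rw [Finset.sum_const, nsmul_eq_mul, mul_inv_cancel₀ hc.ne']
  refine ⟨∑ y ∈ s, (s.card : ℝ)⁻¹ • y,
    Finset.mem_convexHull'.2 ⟨_, fun _ _ => (inv_pos.2 hc).le, h1, rfl⟩, fun t ht hx => ?_⟩
  refine ht.antisymm fun y hy => ?_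
  by_contra hyt
  exact (inv_pos.2 hc).ne' (hs.weight_eq_zero ht h1 hx hy hyt)

end Simplices

/-! ### Recovering triangles from the union of the edges -/

section PlaneTriangles

open Geometry

theorem interior_triangle {t : Finset (ℝ × ℝ)} (ht : AffineIndependent ℝ ((↑) : t → ℝ × ℝ))
    (hc : t.card = 3) (x : ℝ × ℝ) :
    x ∈ interior (convexHull ℝ (t : Set (ℝ × ℝ))) ↔
      ∃ w : ℝ × ℝ → ℝ, (∀ y ∈ t, 0 < w y) ∧ ∑ y ∈ t, w y = 1 ∧ ∑ y ∈ t, w y • y = x := by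
  classical
  have htop : affineSpan ℝ (Set.range ((↑) : t → ℝ × ℝ)) = ⊤ := by
    rw [ht.affineSpan_eq_top_iff_card_eq_finrank_add_one, Module.finrank_prod, Module.finrank_self,
      Fintype.card_coe, hc]
  obtain ⟨b, hb⟩ : ∃ b : AffineBasis t ℝ (ℝ × ℝ), b = ⟨(↑), ht, htop⟩ := ⟨_, rfl⟩
  have hbc : ∀ y : t, b y = y := fun y => by rw [hb]; rfl
  have hr : Set.range b = (t : Set (ℝ × ℝ)) := by
    ext y; constructor
    · rintro ⟨z, rfl⟩; rw [hbc]; exact z.2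
    · intro hy; exact ⟨⟨y, hy⟩, hbc _⟩
  rw [← hr, b.interior_convexHull, Set.mem_ofPred_eq]
  constructor
  · intro h
    refine ⟨fun y => if hy : y ∈ t then b.coord ⟨y, hy⟩ x else 0, ?_, ?_, ?_⟩
    · intro y hy; simp only [hy, dif_pos]; exact h _
    · rw [← Finset.sum_coe_sort, ← b.sum_coord_apply_eq_one x]
      refine Finset.sum_congr rfl fun y _ => ?_
      simp only [y.2, dif_pos]
    · rw [← Finset.sum_coe_sort]
      conv_rhs => rw [← b.linear_combination_coord_eq_self x]
      refine Finset.sum_congr rfl fun y _ => ?_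
      simp only [y.2, dif_pos, hbc]
  · rintro ⟨w, hw0, hw1, rfl⟩ i
    have h1 : ∑ y : t, w y = 1 := by rw [Finset.sum_coe_sort t w, hw1]
    have h2 : ∑ y ∈ t, w y • y = Finset.univ.affineCombination ℝ b (fun y : t => w y) := by
      rw [Finset.affineCombination_eq_linear_combination _ _ _ h1,
        ← Finset.sum_coe_sort t fun y => w y • y]
      exact Finset.sum_congr rfl fun y _ => by rw [hbc]
    rw [h2, b.coord_apply_combination_of_mem (Finset.mem_univ i) h1]
    exact hw0 _ i.2

theorem interior_triangle_nonempty {t : Finset (ℝ × ℝ)}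
    (ht : AffineIndependent ℝ ((↑) : t → ℝ × ℝ)) (hc : t.card = 3) :
    (interior (convexHull ℝ (t : Set (ℝ × ℝ)))).Nonempty := by
  refine ⟨∑ y ∈ t, (1 / 3 : ℝ) • y, (interior_triangle ht hc _).2 ⟨fun _ => 1 / 3, ?_, ?_, rfl⟩⟩
  · intro _ _; norm_num
  · rw [Finset.sum_const, hc]; norm_num

theorem notMem_interior_triangle {t u : Finset (ℝ × ℝ)}
    (ht : AffineIndependent ℝ ((↑) : t → ℝ × ℝ)) (hc : t.card = 3) (hu : u ⊆ t)
    (hu' : u.card < 3) {x : ℝ × ℝ} (hx : x ∈ convexHull ℝ (u : Set (ℝ × ℝ))) :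
    x ∉ interior (convexHull ℝ (t : Set (ℝ × ℝ))) := by
  rw [interior_triangle ht hc]
  rintro ⟨w, hw0, hw1, rfl⟩
  obtain ⟨y, hy, hyu⟩ := Finset.exists_mem_notMem_of_card_lt_card (hu'.trans_eq hc.symm)
  exact (hw0 y hy).ne' (ht.weight_eq_zero hu hw1 hx hy hyu)

theorem isCompact_convexHull_finset (t : Finset (ℝ × ℝ)) :
    IsCompact (convexHull ℝ (t : Set (ℝ × ℝ))) :=
  t.finite_toSet.isCompact_convexHull ℝ

theorem exists_edge_of_mem_frontier {t : Finset (ℝ × ℝ)}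
    (ht : AffineIndependent ℝ ((↑) : t → ℝ × ℝ)) (hc : t.card = 3) {x : ℝ × ℝ}
    (hx : x ∈ frontier (convexHull ℝ (t : Set (ℝ × ℝ)))) :
    ∃ e ⊆ t, e.card = 2 ∧ x ∈ convexHull ℝ (e : Set (ℝ × ℝ)) := by
  classical
  rw [(isCompact_convexHull_finset t).isClosed.frontier_eq] at hx
  obtain ⟨w, hw0, hw1, hwx⟩ := Finset.mem_convexHull'.1 hx.1
  obtain ⟨y, hy, hy0⟩ : ∃ y ∈ t, w y = 0 := by
    by_contra! h
    exact hx.2 ((interior_triangle ht hc x).2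
      ⟨w, fun y hy => (hw0 y hy).lt_of_ne' (h y hy), hw1, hwx⟩)
  refine ⟨t.erase y, Finset.erase_subset _ _, by rw [Finset.card_erase_of_mem hy, hc], ?_⟩
  refine Finset.mem_convexHull'.2 ⟨w, fun z hz => hw0 z (Finset.mem_of_mem_erase hz), ?_, ?_⟩
  · rw [Finset.sum_erase _ hy0, hw1]
  · rw [Finset.sum_erase _ (by rw [hy0, zero_smul]), hwx]

/-- The union of the edges of a complex. -/
def edgeSpace (K : SimplicialComplex ℝ (ℝ × ℝ)) : Set (ℝ × ℝ) :=
  ⋃ e ∈ {e ∈ K.faces | e.card = 2}, convexHull ℝ (e : Set (ℝ × ℝ))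

theorem disjoint_interior_edgeSpace {K : SimplicialComplex ℝ (ℝ × ℝ)} {t : Finset (ℝ × ℝ)}
    (ht : t ∈ K.faces) (hc : t.card = 3) :
    Disjoint (interior (convexHull ℝ (t : Set (ℝ × ℝ)))) (edgeSpace K) := by
  classical
  rw [Set.disjoint_left]
  intro x hx hxe
  obtain ⟨e, ⟨he, hec⟩, hxe⟩ := Set.mem_iUnion₂.1 hxe
  have h1 := K.inter_subset_convexHull ht he ⟨interior_subset hx, hxe⟩
  rw [← Finset.coe_inter] at h1
  refine notMem_interior_triangle (K.indep ht) hc Finset.inter_subset_left ?_ h1 hx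
  exact (Finset.card_le_card Finset.inter_subset_right).trans_lt (by omega)

theorem frontier_subset_edgeSpace {K : SimplicialComplex ℝ (ℝ × ℝ)} {t : Finset (ℝ × ℝ)}
    (ht : t ∈ K.faces) (hc : t.card = 3) :
    frontier (convexHull ℝ (t : Set (ℝ × ℝ))) ⊆ edgeSpace K := by
  intro x hx
  obtain ⟨e, het, hec, hxe⟩ := exists_edge_of_mem_frontier (K.indep ht) hc hx
  exact Set.mem_iUnion₂.2 ⟨e, ⟨K.down_closed ht het (Finset.card_pos.1 (by omega)), hec⟩, hxe⟩

theorem IsPreconnected.subset_interior_of_disjoint_frontier {X : Type*} [TopologicalSpace X]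
    {s t : Set X} (hs : IsPreconnected s) (h : (s ∩ interior t).Nonempty)
    (hd : Disjoint s (frontier t)) : s ⊆ interior t := by
  refine IsPreconnected.subset_left_of_subset_union (v := (closure t)ᶜ) isOpen_interior
    isClosed_closure.isOpen_compl ?_ ?_ h hs
  · exact Set.disjoint_compl_right_iff_subset.2 (interior_subset.trans subset_closure)
  · intro x hx
    by_contra hn
    rw [Set.mem_union, not_or, Set.mem_compl_iff, not_not] at hn
    exact Set.disjoint_left.1 hd hx ⟨hn.2, hn.1⟩

/-- A triangle of one complex is a triangle of every other complex with the same edges that covers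
it by triangles. -/
theorem triangle_mem_of_edgeSpace_eq {K L : SimplicialComplex ℝ (ℝ × ℝ)}
    (h : edgeSpace K = edgeSpace L) {t : Finset (ℝ × ℝ)} (ht : t ∈ K.faces) (hc : t.card = 3)
    (hL : ∀ x ∈ convexHull ℝ (t : Set (ℝ × ℝ)),
      ∃ u ∈ L.faces, u.card = 3 ∧ x ∈ convexHull ℝ (u : Set (ℝ × ℝ))) : t ∈ L.faces := by
  obtain ⟨x, hx⟩ := interior_triangle_nonempty (K.indep ht) hc
  obtain ⟨u, hu, huc, hxu⟩ := hL x (interior_subset hx)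
  have conn : ∀ v : Finset (ℝ × ℝ), IsPreconnected (interior (convexHull ℝ (v : Set (ℝ × ℝ)))) :=
    fun v => (convex_convexHull ℝ _).interior.isPreconnected
  -- A point inside `t` is on no edge of `K`, hence on no edge of `L`, so it is not on the boundary
  -- of `u`.
  have hxu' : x ∈ interior (convexHull ℝ (u : Set (ℝ × ℝ))) := by
    by_contra hn
    refine Set.disjoint_left.1 (disjoint_interior_edgeSpace ht hc) hx ?_
    rw [h]
    refine frontier_subset_edgeSpace hu huc ?_
    rw [(isCompact_convexHull_finset u).isClosed.frontier_eq]
    exact ⟨hxu, hn⟩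
  -- The interior of `t` is connected and avoids all edges, in particular the boundary of `u`. By
  -- symmetry the interiors are equal, then so are the closures and their extreme points.
  have h1 : interior (convexHull ℝ (t : Set (ℝ × ℝ))) ⊆ interior (convexHull ℝ (u : Set (ℝ × ℝ))) :=
    (conn t).subset_interior_of_disjoint_frontier ⟨x, hx, hxu'⟩
      ((disjoint_interior_edgeSpace ht hc).mono_right
        ((frontier_subset_edgeSpace hu huc).trans h.superset))
  have h2 : interior (convexHull ℝ (u : Set (ℝ × ℝ))) ⊆ interior (convexHull ℝ (t : Set (ℝ × ℝ))) :=
    (conn u).subset_interior_of_disjoint_frontier ⟨x, hxu', hx⟩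
      ((disjoint_interior_edgeSpace hu huc).mono_right
        ((frontier_subset_edgeSpace ht hc).trans h.subset))
  have hcl : ∀ v : Finset (ℝ × ℝ), (interior (convexHull ℝ (v : Set (ℝ × ℝ)))).Nonempty →
      closure (interior (convexHull ℝ (v : Set (ℝ × ℝ)))) = convexHull ℝ (v : Set (ℝ × ℝ)) :=
    fun v hv => by
      rw [(convex_convexHull ℝ _).closure_interior_eq_closure_of_nonempty_interior hv,
        (isCompact_convexHull_finset v).isClosed.closure_eq]
  have h3 : convexHull ℝ (t : Set (ℝ × ℝ)) = convexHull ℝ (u : Set (ℝ × ℝ)) := by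
    rw [← hcl t ⟨x, hx⟩, ← hcl u ⟨x, hxu'⟩, h1.antisymm h2]
  have h4 : (t : Set (ℝ × ℝ)) = u := by
    rw [← (K.indep ht).extremePoints_convexHull, ← (L.indep hu).extremePoints_convexHull, h3]
  rw [Finset.coe_injective h4]
  exact hu

end PlaneTriangles

/-! ### Covering by triangles -/

section Purity

open Geometry MeasureTheory

theorem faces_finite {m n : ℕ} {K : SimplicialComplex ℝ (ℝ × ℝ)}
    (hK : K ∈ latticeTriangulations m n) : K.faces.Finite := by
  set P : Set (ℝ × ℝ) :=
    (fun p : ℤ × ℤ => ((p.1 : ℝ), (p.2 : ℝ))) '' (Set.Icc 0 (m : ℤ) ×ˢ Set.Icc 0 (n : ℤ)) with hP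
  have hfin : P.Finite := ((Set.finite_Icc _ _).prod (Set.finite_Icc _ _)).image _
  refine (hfin.finite_subsets.preimage (f := fun s : Finset (ℝ × ℝ) => (s : Set (ℝ × ℝ)))
    Finset.coe_injective.injOn).subset ?_
  intro s hs x hx
  have hxv : x ∈ K.vertices :=
    K.down_closed hs (Finset.singleton_subset_iff.2 hx) (Finset.singleton_nonempty x)
  have hxs : x ∈ latticeRectangle m n := hK.1 ▸ K.subset_space hs hx
  obtain ⟨a, b, rfl⟩ := hK.2 x hxv
  obtain ⟨⟨h1, h2⟩, h3, h4⟩ := hxs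
  dsimp only at h1 h2 h3 h4
  exact ⟨(a, b), ⟨⟨by exact_mod_cast h1, by exact_mod_cast h2⟩, by exact_mod_cast h3,
    by exact_mod_cast h4⟩, rfl⟩

theorem volume_convexHull_eq_zero {s : Finset (ℝ × ℝ)}
    (hs : AffineIndependent ℝ ((↑) : s → ℝ × ℝ)) (hc : s.card ≠ 3) :
    volume (convexHull ℝ (s : Set (ℝ × ℝ))) = 0 := by
  refine measure_mono_null (convexHull_subset_affineSpan _)
    (Measure.addHaar_affineSubspace volume _ fun htop => hc ?_)
  have h : affineSpan ℝ (Set.range ((↑) : s → ℝ × ℝ)) = ⊤ := by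
    rw [Subtype.range_coe_subtype]; exact htop
  rw [hs.affineSpan_eq_top_iff_card_eq_finrank_add_one, Module.finrank_prod, Module.finrank_self,
    Fintype.card_coe] at h
  exact h

/-- A finite planar complex that fills a set which is the closure of its interior covers it by
triangles. -/
theorem exists_triangle_of_mem_space {K : SimplicialComplex ℝ (ℝ × ℝ)} (hfin : K.faces.Finite)
    (hK : K.space ⊆ closure (interior K.space)) {x : ℝ × ℝ} (hx : x ∈ K.space) :
    ∃ t ∈ K.faces, t.card = 3 ∧ x ∈ convexHull ℝ (t : Set (ℝ × ℝ)) := by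
  by_contra! hn
  obtain ⟨A, hA⟩ : ∃ A, A = ⋃ t ∈ {t ∈ K.faces | t.card = 3}, convexHull ℝ (t : Set (ℝ × ℝ)) :=
    ⟨_, rfl⟩
  obtain ⟨B, hB⟩ : ∃ B, B = ⋃ t ∈ {t ∈ K.faces | t.card ≠ 3}, convexHull ℝ (t : Set (ℝ × ℝ)) :=
    ⟨_, rfl⟩
  have hAc : IsClosed A := by
    rw [hA]
    exact (hfin.subset (Set.sep_subset _ _)).isClosed_biUnion
      fun t _ => (isCompact_convexHull_finset t).isClosed
  have hB0 : volume B = 0 := by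
    rw [hB, measure_biUnion_null_iff (hfin.subset (Set.sep_subset _ _)).countable]
    exact fun s hs => volume_convexHull_eq_zero (K.indep hs.1) hs.2
  have hxA : x ∈ Aᶜ := by
    intro hxA
    rw [hA] at hxA
    obtain ⟨t, ht, hxt⟩ := Set.mem_iUnion₂.1 hxA
    exact hn t ht.1 ht.2 hxt
  obtain ⟨y, hy⟩ := mem_closure_iff.1 (hK hx) _ hAc.isOpen_compl hxA
  -- The part of the interior outside all triangles is open and nonempty, yet it is covered by
  -- finitely many faces of measure zero.
  have hpos := (hAc.isOpen_compl.inter isOpen_interior).measure_pos volume ⟨y, hy⟩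
  refine hpos.ne' (measure_mono_null ?_ hB0)
  rintro z ⟨hzA, hz⟩
  obtain ⟨s, hs, hzs⟩ := SimplicialComplex.mem_space_iff.1 (interior_subset hz)
  rw [hB]
  refine Set.mem_iUnion₂.2 ⟨s, ⟨hs, fun hc => hzA ?_⟩, hzs⟩
  rw [hA]
  exact Set.mem_iUnion₂.2 ⟨s, ⟨hs, hc⟩, hzs⟩

theorem latticeRectangle_subset_closure_interior {m n : ℕ} (hm : 0 < m) (hn : 0 < n) :
    latticeRectangle m n ⊆ closure (interior (latticeRectangle m n)) := by
  have hm' : (0 : ℝ) ≠ m := by exact_mod_cast hm.ne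
  have hn' : (0 : ℝ) ≠ n := by exact_mod_cast hn.ne
  rw [latticeRectangle, interior_prod_eq, closure_prod_eq, interior_Icc, interior_Icc,
    closure_Ioo hm', closure_Ioo hn']

theorem exists_triangle_of_mem_rectangle {m n : ℕ} (hm : 0 < m) (hn : 0 < n)
    {K : SimplicialComplex ℝ (ℝ × ℝ)} (hK : K ∈ latticeTriangulations m n) {x : ℝ × ℝ}
    (hx : x ∈ latticeRectangle m n) :
    ∃ t ∈ K.faces, t.card = 3 ∧ x ∈ convexHull ℝ (t : Set (ℝ × ℝ)) := by
  refine exists_triangle_of_mem_space (faces_finite hK) ?_ (hK.1 ▸ hx)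
  rw [hK.1]
  exact latticeRectangle_subset_closure_interior hm hn

/-- A triangle `t` of `K` through the barycentre of `s` contains `s` as a face, and `t` is also a
triangle of `L`. -/
theorem faces_subset_of_edgeSpace_eq {m n : ℕ} (hm : 0 < m) (hn : 0 < n)
    {K L : SimplicialComplex ℝ (ℝ × ℝ)} (hK : K ∈ latticeTriangulations m n)
    (hL : L ∈ latticeTriangulations m n) (h : edgeSpace K = edgeSpace L) : K.faces ⊆ L.faces := by
  classical
  intro s hs
  have hne := SimplicialComplex.nonempty_of_mem_faces hs
  obtain ⟨x, hxs, hx⟩ := (K.indep hs).exists_mem_convexHull_forall_subset hne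
  obtain ⟨t, ht, htc, hxt⟩ := exists_triangle_of_mem_rectangle hm hn hK
    (hK.1 ▸ SimplicialComplex.convexHull_subset_space hs hxs)
  have hst : s ∩ t = s := by
    refine hx _ Finset.inter_subset_left ?_
    rw [Finset.coe_inter]
    exact K.inter_subset_convexHull hs ht ⟨hxs, hxt⟩
  refine L.down_closed (triangle_mem_of_edgeSpace_eq h ht htc fun y hy => ?_)
    (Finset.inter_eq_left.1 hst) hne
  exact exists_triangle_of_mem_rectangle hm hn hL
    (hK.1 ▸ SimplicialComplex.convexHull_subset_space ht hy)

/-- A lattice triangulation is determined by the union of its edges. -/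
theorem eq_of_edgeSpace_eq {m n : ℕ} (hm : 0 < m) (hn : 0 < n)
    {K L : SimplicialComplex ℝ (ℝ × ℝ)} (hK : K ∈ latticeTriangulations m n)
    (hL : L ∈ latticeTriangulations m n) (h : edgeSpace K = edgeSpace L) : K = L :=
  SimplicialComplex.ext ((faces_subset_of_edgeSpace_eq hm hn hK hL h).antisymm
    (faces_subset_of_edgeSpace_eq hm hn hL hK h.symm))

end Purity

/-! ### Lattice segments in the plane -/

section LatticeSegments

open Geometry

/-- The point of the plane with the given integer coordinates. -/
def toPlane (v : ℤ × ℤ) : ℝ × ℝ := (v.1, v.2)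

/-- Half of an integer vector. -/
noncomputable def halfPoint (q : ℤ × ℤ) : ℝ × ℝ := ((q.1 : ℝ) / 2, (q.2 : ℝ) / 2)

/-- Cramer's rule: the parameters of the intersection of the two lines are the quotients `l`, `k` of
determinants, and `SegCross` says that both are less than one in absolute value. -/
theorem SegCross.exists_mem_openSegment {q U r V : ℤ × ℤ} (h : SegCross (r - q) U V) :
    ∃ x ∈ openSegment ℝ (halfPoint (q + U)) (halfPoint (q - U)),
      x ∈ openSegment ℝ (halfPoint (r + V)) (halfPoint (r - V)) := by
  obtain ⟨h1, h2⟩ := h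
  have hD : (idet U V : ℝ) ≠ 0 := by
    have := lt_of_le_of_lt (abs_nonneg _) h1
    exact_mod_cast abs_pos.1 this
  have aux : ∀ e : ℤ, |e| < |idet U V| → |(e : ℝ) / idet U V| < 1 := by
    intro e he
    rw [abs_div, div_lt_one (abs_pos.2 hD)]
    exact_mod_cast he
  have a1 := abs_lt.1 (aux _ h1)
  have a2 := abs_lt.1 (aux _ h2)
  obtain ⟨l, hl⟩ : ∃ l : ℝ, l = idet (r - q) V / idet U V := ⟨_, rfl⟩
  obtain ⟨k, hk⟩ : ∃ k : ℝ, k = idet (r - q) U / idet U V := ⟨_, rfl⟩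
  rw [← hl] at a1
  rw [← hk] at a2
  have hl' : l * idet U V = idet (r - q) V := by rw [hl, div_mul_cancel₀ _ hD]
  have hk' : k * idet U V = idet (r - q) U := by rw [hk, div_mul_cancel₀ _ hD]
  simp only [idet, Prod.fst_sub, Prod.snd_sub] at hl' hk' hD
  push_cast at hl' hk' hD
  have e1 : (q.1 : ℝ) + l * U.1 = r.1 + k * V.1 := by
    refine mul_right_cancel₀ hD ?_
    linear_combination U.1 * hl' - V.1 * hk'
  have e2 : (q.2 : ℝ) + l * U.2 = r.2 + k * V.2 := by
    refine mul_right_cancel₀ hD ?_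
    linear_combination U.2 * hl' - V.2 * hk'
  refine ⟨(((q.1 : ℝ) + l * U.1) / 2, ((q.2 : ℝ) + l * U.2) / 2),
    ⟨(1 + l) / 2, (1 - l) / 2, by linarith, by linarith, by ring, ?_⟩,
    ⟨(1 + k) / 2, (1 - k) / 2, by linarith, by linarith, by ring, ?_⟩⟩
  · ext
    · simp [halfPoint]; ring
    · simp [halfPoint]; ring
  · ext
    · simp [halfPoint]; linear_combination (-1 / 2) * e1
    · simp [halfPoint]; linear_combination (-1 / 2) * e2

theorem idet_eq_zero_of_card_le_two {s : Finset (ℝ × ℝ)} (hs : s.card ≤ 2) {q U r V : ℤ × ℤ}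
    (h1 : halfPoint (q + U) ∈ convexHull ℝ (s : Set (ℝ × ℝ)))
    (h2 : halfPoint (q - U) ∈ convexHull ℝ (s : Set (ℝ × ℝ)))
    (h3 : halfPoint (r + V) ∈ convexHull ℝ (s : Set (ℝ × ℝ)))
    (h4 : halfPoint (r - V) ∈ convexHull ℝ (s : Set (ℝ × ℝ))) : idet U V = 0 := by
  obtain ⟨a, b, hab⟩ : ∃ a b : ℝ × ℝ, (s : Set (ℝ × ℝ)) ⊆ {a, b} := by
    rcases Nat.lt_or_ge s.card 2 with hc | hc
    · rcases Nat.lt_or_ge s.card 1 with hc | hc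
      · rw [Nat.lt_one_iff, Finset.card_eq_zero] at hc
        exact ⟨0, 0, by simp [hc]⟩
      · obtain ⟨a, ha⟩ := Finset.card_eq_one.1 (show s.card = 1 by omega)
        exact ⟨a, a, by simp [ha]⟩
    · obtain ⟨a, b, -, ha⟩ := Finset.card_eq_two.1 (show s.card = 2 by omega)
      exact ⟨a, b, by simp [ha]⟩
  have hseg : convexHull ℝ (s : Set (ℝ × ℝ)) ⊆ segment ℝ a b := by
    rw [← convexHull_pair]; exact convexHull_mono hab
  have key : ∀ {p W : ℤ × ℤ}, halfPoint (p + W) ∈ convexHull ℝ (s : Set (ℝ × ℝ)) →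
      halfPoint (p - W) ∈ convexHull ℝ (s : Set (ℝ × ℝ)) →
      ∃ t : ℝ, (W.1 : ℝ) = t * (b.1 - a.1) ∧ (W.2 : ℝ) = t * (b.2 - a.2) := by
    intro p W hp hm
    rw [← add_sub_cancel a b] at hseg
    have e1 := hseg hp
    have e2 := hseg hm
    rw [segment_eq_image'] at e1 e2
    obtain ⟨t1, -, ht1⟩ := e1
    obtain ⟨t2, -, ht2⟩ := e2
    simp only [halfPoint, Prod.ext_iff, Prod.fst_add, Prod.snd_add, Prod.smul_fst, Prod.smul_snd,
      Prod.fst_sub, Prod.snd_sub, smul_eq_mul] at ht1 ht2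
    push_cast at ht1 ht2
    exact ⟨t1 - t2, by linarith [ht1.1, ht2.1], by linarith [ht1.2, ht2.2]⟩
  obtain ⟨t, ht1, ht2⟩ := key h1 h2
  obtain ⟨u, hu1, hu2⟩ := key h3 h4
  have : (idet U V : ℝ) = 0 := by
    simp only [idet]
    push_cast
    rw [ht1, ht2, hu1, hu2]; ring
  exact_mod_cast this

/-- A lattice segment is covered by primitive segments. -/
theorem exists_primitive_piece {a b : ℤ × ℤ} (hab : a ≠ b) {x : ℝ × ℝ}
    (hx : x ∈ segment ℝ (toPlane a) (toPlane b)) :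
    ∃ q U : ℤ × ℤ, IsCoprime U.1 U.2 ∧ EvenDiff q U ∧
      x ∈ segment ℝ (halfPoint (q + U)) (halfPoint (q - U)) ∧
      halfPoint (q + U) ∈ segment ℝ (toPlane a) (toPlane b) ∧
      halfPoint (q - U) ∈ segment ℝ (toPlane a) (toPlane b) := by
  obtain ⟨g, w, hg, hw, hb1, hb2⟩ : ∃ (g : ℕ) (w : ℤ × ℤ), 0 < g ∧ IsCoprime w.1 w.2 ∧
      b.1 = a.1 + g * w.1 ∧ b.2 = a.2 + g * w.2 := by
    have hne : Int.gcd (b.1 - a.1) (b.2 - a.2) ≠ 0 := by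
      rw [Ne, Int.gcd_eq_zero_iff]
      rintro ⟨h1, h2⟩
      exact hab (Prod.ext (by omega) (by omega))
    obtain ⟨c, d, hcd, h1, h2⟩ := Int.exists_gcd_one (Nat.pos_of_ne_zero hne)
    refine ⟨_, (c, d), Nat.pos_of_ne_zero hne, Int.isCoprime_iff_gcd_eq_one.2 hcd, ?_, ?_⟩
    · linarith
    · linarith
  have hg' : (0 : ℝ) < g := by exact_mod_cast hg
  rw [segment_eq_image'] at hx
  obtain ⟨θ, ⟨h0, h1⟩, rfl⟩ := hx
  -- The end point `θ = 1` belongs to the last piece, of index `g - 1`, where the floor would give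
  -- `g`.
  obtain ⟨i, hi, hi1, hi2⟩ : ∃ i : ℕ, i < g ∧ (i : ℝ) ≤ θ * g ∧ θ * g ≤ i + 1 := by
    have hnn : 0 ≤ θ * g := by positivity
    rcases h1.eq_or_lt with rfl | h1
    · refine ⟨g - 1, by omega, ?_, ?_⟩
      · rw [one_mul]; exact_mod_cast Nat.sub_le _ _
      · rw [one_mul]; exact_mod_cast (show g ≤ g - 1 + 1 by omega)
    · refine ⟨⌊θ * g⌋₊, ?_, Nat.floor_le hnn, (Nat.lt_floor_add_one _).le⟩
      rw [Nat.floor_lt hnn]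
      nlinarith
  have hi' : (i : ℝ) + 1 ≤ g := by exact_mod_cast hi
  have hbr1 : (b.1 : ℝ) = a.1 + g * w.1 := by exact_mod_cast hb1
  have hbr2 : (b.2 : ℝ) = a.2 + g * w.2 := by exact_mod_cast hb2
  -- Twice the midpoint of the piece from `a + i w` to `a + (i + 1) w`.
  refine ⟨2 • a + (2 * i + 1 : ℤ) • w, w, hw, ?_, ?_, ?_, ?_⟩
  · obtain ⟨a1, a2⟩ := a
    obtain ⟨w1, w2⟩ := w
    simp only [EvenDiff, Prod.smul_mk, Prod.mk_add_mk, nsmul_eq_mul, smul_eq_mul, Nat.cast_ofNat]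
    exact ⟨⟨a1 + i * w1, by ring⟩, ⟨a2 + i * w2, by ring⟩⟩
  · refine ⟨θ * g - i, i + 1 - θ * g, by linarith, by linarith, by ring, ?_⟩
    obtain ⟨a1, a2⟩ := a
    obtain ⟨w1, w2⟩ := w
    ext
    · simp [halfPoint, toPlane, hbr1]; ring
    · simp [halfPoint, toPlane, hbr2]; ring
  · rw [segment_eq_image']
    refine ⟨(i + 1) / g, ⟨by positivity, (div_le_one hg').2 hi'⟩, ?_⟩
    obtain ⟨a1, a2⟩ := a
    obtain ⟨w1, w2⟩ := w
    ext
    · simp [halfPoint, toPlane, hbr1]; field_simp; ring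
    · simp [halfPoint, toPlane, hbr2]; field_simp; ring
  · rw [segment_eq_image']
    refine ⟨i / g, ⟨by positivity, (div_le_one hg').2 (by linarith)⟩, ?_⟩
    obtain ⟨a1, a2⟩ := a
    obtain ⟨w1, w2⟩ := w
    ext
    · simp [halfPoint, toPlane, hbr1]; field_simp; ring
    · simp [halfPoint, toPlane, hbr2]; field_simp; ring

end LatticeSegments

/-! ### Segment systems in the triangles of a complex -/

section FaceSystems

open Geometry

theorem planeDet_ne_zero {a b c : ℝ × ℝ} (hab : a ≠ b) (hac : a ≠ c) (hbc : b ≠ c)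
    (h : AffineIndependent ℝ ((↑) : ({a, b, c} : Finset (ℝ × ℝ)) → ℝ × ℝ)) :
    (b.1 - a.1) * (c.2 - a.2) - (b.2 - a.2) * (c.1 - a.1) ≠ 0 := by
  intro h0
  have key : ∀ u v : ℝ, u • (c - a) + v • (b - a) = 0 → u = 0 := by
    intro u v huv
    have h1 := h.eq_zero_of_sum_eq_zero_subtype
      (w := fun y => if y = a then -(u + v) else if y = b then v else u) (by
        rw [Finset.sum_insert (by simp [hab, hac]), Finset.sum_insert (by simp [hbc]),
          Finset.sum_singleton]
        simp [hab.symm, hac.symm, hbc.symm]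
        ring) (by
        rw [Finset.sum_insert (by simp [hab, hac]), Finset.sum_insert (by simp [hbc]),
          Finset.sum_singleton]
        simp only [if_true, hab.symm, hac.symm, hbc.symm, if_false]
        rw [← huv]; module) c (by simp)
    simpa [hac.symm, hbc.symm] using h1
  have k1 := key (b.1 - a.1) (-(c.1 - a.1)) (by
    ext
    · simp; ring
    · simp; linarith)
  have k2 := key (b.2 - a.2) (-(c.2 - a.2)) (by
    ext
    · simp; linarith
    · simp; ring)
  exact hab (Prod.ext (by linarith) (by linarith))

theorem mem_convexHull_triple {a b c x : ℝ × ℝ} (hab : a ≠ b) (hac : a ≠ c) (hbc : b ≠ c) :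
    x ∈ convexHull ℝ (({a, b, c} : Finset (ℝ × ℝ)) : Set (ℝ × ℝ)) ↔
      ∃ u v w : ℝ, 0 ≤ u ∧ 0 ≤ v ∧ 0 ≤ w ∧ u + v + w = 1 ∧ u • a + v • b + w • c = x := by
  rw [Finset.mem_convexHull']
  constructor
  · rintro ⟨f, hf0, hf1, hfx⟩
    rw [Finset.sum_insert (by simp [hab, hac]), Finset.sum_insert (by simp [hbc]),
      Finset.sum_singleton] at hf1 hfx
    exact ⟨f a, f b, f c, hf0 _ (by simp), hf0 _ (by simp), hf0 _ (by simp), by linarith,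
      by rw [← hfx, add_assoc]⟩
  · rintro ⟨u, v, w, hu, hv, hw, h1, hx⟩
    refine ⟨fun y => if y = a then u else if y = b then v else w, ?_, ?_, ?_⟩
    · intro y _
      dsimp only
      split_ifs <;> assumption
    · rw [Finset.sum_insert (by simp [hab, hac]), Finset.sum_insert (by simp [hbc]),
        Finset.sum_singleton]
      simp [hab.symm, hac.symm, hbc.symm, ← h1, add_assoc]
    · rw [Finset.sum_insert (by simp [hab, hac]), Finset.sum_insert (by simp [hbc]),
        Finset.sum_singleton]
      simp [hab.symm, hac.symm, hbc.symm, ← hx, add_assoc]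

theorem mem_convexHull_iff_inTri {a b c : ℤ × ℤ} (hD : 0 < idet (b - a) (c - a)) (z : ℤ × ℤ) :
    halfPoint z ∈ convexHull ℝ (({toPlane a, toPlane b, toPlane c} : Finset (ℝ × ℝ)) :
      Set (ℝ × ℝ)) ↔ InTri a b c z := by
  have hinj : ∀ u v : ℤ × ℤ, toPlane u = toPlane v → u = v := by
    intro u v huv
    simp only [toPlane, Prod.mk.injEq, Int.cast_inj] at huv
    exact Prod.ext huv.1 huv.2
  have hab : toPlane a ≠ toPlane b := fun h => by
    rw [hinj _ _ h] at hD; simp [idet] at hD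
  have hac : toPlane a ≠ toPlane c := fun h => by
    rw [hinj _ _ h] at hD; simp [idet] at hD
  have hbc : toPlane b ≠ toPlane c := fun h => by
    rw [hinj _ _ h] at hD; simp [idet, mul_comm] at hD
  have hD' : (0 : ℝ) < (b.1 - a.1) * (c.2 - a.2) - (b.2 - a.2) * (c.1 - a.1) := by
    have : (0 : ℝ) < (idet (b - a) (c - a) : ℤ) := by exact_mod_cast hD
    simpa [idet] using this
  obtain ⟨D, hDdef⟩ : ∃ D : ℝ, D = (b.1 - a.1) * (c.2 - a.2) - (b.2 - a.2) * (c.1 - a.1) := ⟨_, rfl⟩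
  rw [← hDdef] at hD'
  have hcast : InTri a b c z ↔
      (0 : ℝ) ≤ (b.1 - a.1) * (z.2 - 2 * a.2) - (b.2 - a.2) * (z.1 - 2 * a.1) ∧
      (0 : ℝ) ≤ (c.1 - b.1) * (z.2 - 2 * b.2) - (c.2 - b.2) * (z.1 - 2 * b.1) ∧
      (0 : ℝ) ≤ (a.1 - c.1) * (z.2 - 2 * c.2) - (a.2 - c.2) * (z.1 - 2 * c.1) := by
    simp only [InTri, lineDet_eq]
    exact_mod_cast Iff.rfl
  rw [hcast, mem_convexHull_triple hab hac hbc]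
  constructor
  · rintro ⟨u, v, w, hu, hv, hw, h1, hx⟩
    simp only [toPlane, halfPoint, Prod.ext_iff, Prod.fst_add, Prod.snd_add, Prod.smul_mk,
      smul_eq_mul] at hx
    obtain ⟨hx1, hx2⟩ := hx
    have z1 : (z.1 : ℝ) = 2 * (u * a.1 + v * b.1 + w * c.1) := by linarith
    have z2 : (z.2 : ℝ) = 2 * (u * a.2 + v * b.2 + w * c.2) := by linarith
    obtain rfl : u = 1 - v - w := by linarith
    rw [z1, z2]
    refine ⟨?_, ?_, ?_⟩
    · have := mul_nonneg hw hD'.le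
      rw [hDdef] at this; linarith
    · have := mul_nonneg hu hD'.le
      rw [hDdef] at this; linarith
    · have := mul_nonneg hv hD'.le
      rw [hDdef] at this; linarith
  · rintro ⟨h1, h2, h3⟩
    -- The weight of a vertex is the position relative to the opposite side divided by `2 * D`; the
    -- two appears because `z` is doubled.
    refine ⟨_, _, _, div_nonneg h2 (by positivity : 0 ≤ 2 * D),
      div_nonneg h3 (by positivity : 0 ≤ 2 * D), div_nonneg h1 (by positivity : 0 ≤ 2 * D), ?_, ?_⟩
    · rw [← add_div, ← add_div, div_eq_one_iff_eq (by positivity), hDdef]; ring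
    · have hne : (2 * D) ≠ 0 := by positivity
      simp only [toPlane, halfPoint]
      ext
      · simp only [Prod.fst_add, Prod.smul_mk, smul_eq_mul]
        rw [div_mul_eq_mul_div, div_mul_eq_mul_div, div_mul_eq_mul_div, ← add_div, ← add_div,
          div_eq_div_iff hne two_ne_zero, hDdef]
        ring
      · simp only [Prod.snd_add, Prod.smul_mk, smul_eq_mul]
        rw [div_mul_eq_mul_div, div_mul_eq_mul_div, div_mul_eq_mul_div, ← add_div, ← add_div,
          div_eq_div_iff hne two_ne_zero, hDdef]
        ring

/-- A set of pairwise noncrossing primitive segments in a face such that every half-integral point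
of the face is the midpoint of one of them. -/
structure IsFaceSystem (s : Finset (ℝ × ℝ)) (S : Set ((ℤ × ℤ) × (ℤ × ℤ))) : Prop where
  primitive : ∀ x ∈ S, IsCoprime x.2.1 x.2.2
  parity : ∀ x ∈ S, EvenDiff x.1 x.2
  mem_add : ∀ x ∈ S, halfPoint (x.1 + x.2) ∈ convexHull ℝ (s : Set (ℝ × ℝ))
  mem_sub : ∀ x ∈ S, halfPoint (x.1 - x.2) ∈ convexHull ℝ (s : Set (ℝ × ℝ))
  not_cross : ∀ x ∈ S, ∀ y ∈ S, ¬ SegCross (y.1 - x.1) x.2 y.2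
  complete : ∀ q, ¬ EvenDiff q 0 → halfPoint q ∈ convexHull ℝ (s : Set (ℝ × ℝ)) → ∃ U, (q, U) ∈ S

theorem exists_isFaceSystem {s : Finset (ℝ × ℝ)} (hs : AffineIndependent ℝ ((↑) : s → ℝ × ℝ))
    (hc : s.card = 3) (hv : ∀ v ∈ s, ∃ a : ℤ × ℤ, v = toPlane a) : ∃ S, IsFaceSystem s S := by
  have oriented : ∀ a b c : ℤ × ℤ, s = {toPlane a, toPlane b, toPlane c} →
      0 < idet (b - a) (c - a) → ∃ S, IsFaceSystem s S := by
    intro a b c hsabc hD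
    obtain ⟨S, hS⟩ := exists_isTriSystem a b c hD
    subst hsabc
    refine ⟨S, hS.primitive, hS.parity, fun x hx => ?_, fun x hx => ?_, hS.not_cross,
      fun q hq hqs => hS.complete q hq ((mem_convexHull_iff_inTri hD q).1 hqs)⟩
    · exact (mem_convexHull_iff_inTri hD _).2 (hS.inTri_add x hx)
    · exact (mem_convexHull_iff_inTri hD _).2 (hS.inTri_sub x hx)
  obtain ⟨a', b', c', hab, hac, hbc, rfl⟩ := Finset.card_eq_three.1 hc
  obtain ⟨a, rfl⟩ := hv a' (by simp)
  obtain ⟨b, rfl⟩ := hv b' (by simp)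
  obtain ⟨c, rfl⟩ := hv c' (by simp)
  have hne := planeDet_ne_zero hab hac hbc hs
  have hne' : idet (b - a) (c - a) ≠ 0 := by
    intro h0
    apply hne
    have : ((idet (b - a) (c - a) : ℤ) : ℝ) = 0 := by exact_mod_cast h0
    simpa [idet, toPlane] using this
  rcases lt_or_gt_of_ne hne' with h | h
  · refine oriented a c b ?_ (by rw [idet_comm]; omega)
    rw [Finset.pair_comm]
  · exact oriented a b c rfl h

end FaceSystems

/-! ### The exponential upper bound -/

section UpperBound

open Geometry

/-- The primitive segments contained in edges of a complex. -/
def edgeSegments (K : SimplicialComplex ℝ (ℝ × ℝ)) : Set ((ℤ × ℤ) × (ℤ × ℤ)) :=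
  {x | IsCoprime x.2.1 x.2.2 ∧ EvenDiff x.1 x.2 ∧ ∃ e ∈ K.faces, e.card = 2 ∧
    halfPoint (x.1 + x.2) ∈ convexHull ℝ (e : Set (ℝ × ℝ)) ∧
    halfPoint (x.1 - x.2) ∈ convexHull ℝ (e : Set (ℝ × ℝ))}

theorem neg_mem_edgeSegments {K : SimplicialComplex ℝ (ℝ × ℝ)} {q U : ℤ × ℤ}
    (h : (q, -U) ∈ edgeSegments K) : (q, U) ∈ edgeSegments K := by
  obtain ⟨h1, h2, e, he, hec, h3, h4⟩ := h
  refine ⟨?_, ?_, e, he, hec, ?_, ?_⟩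
  · exact (IsCoprime.neg_neg_iff U.1 U.2).1 h1
  · simp only [EvenDiff, Prod.fst_neg, Prod.snd_neg] at h2 ⊢; omega
  · simpa using h4
  · simpa [sub_eq_add_neg] using h3

theorem not_even_of_primitive {q U : ℤ × ℤ} (hU : IsCoprime U.1 U.2) (h : EvenDiff q U) :
    ¬ EvenDiff q 0 := by
  rintro ⟨⟨a, ha⟩, b, hb⟩
  obtain ⟨⟨c, hc⟩, d, hd⟩ := h
  simp only [Prod.fst_zero, Prod.snd_zero, sub_zero] at ha hb
  obtain ⟨x, y, hxy⟩ := hU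
  have : (1 : ℤ) = 2 * (x * (a - c) + y * (b - d)) := by
    linear_combination -hxy + x * (ha - hc) + y * (hb - hd)
  omega

theorem halfPoint_mem_rectangle {n : ℕ} {q : ℤ × ℤ} :
    halfPoint q ∈ latticeRectangle n n ↔
      (0 ≤ q.1 ∧ q.1 ≤ 2 * n) ∧ (0 ≤ q.2 ∧ q.2 ≤ 2 * n) := by
  have h1 : ∀ z : ℤ, (0 : ℝ) ≤ (z : ℝ) / 2 ↔ 0 ≤ z := fun z => by
    rw [le_div_iff₀ two_pos, zero_mul]; exact_mod_cast Iff.rfl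
  have h2 : ∀ z : ℤ, (z : ℝ) / 2 ≤ n ↔ z ≤ 2 * n := fun z => by
    rw [div_le_iff₀ two_pos, mul_comm]; exact_mod_cast Iff.rfl
  simp only [latticeRectangle, halfPoint, Set.mem_prod, Set.mem_Icc, h1, h2]

/-- Every lattice triangulation of a square refines to a direction field; the segments of the
direction field that are contained in edges cover all edges. -/
theorem exists_dirField_of_triangulation {n : ℕ} (hn : 0 < n) {K : SimplicialComplex ℝ (ℝ × ℝ)}
    (hK : K ∈ latticeTriangulations n n) :
    ∃ τ : ℤ × ℤ → ℤ × ℤ, IsDirField (2 * n) τ ∧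
      ∀ x ∈ edgeSegments K, x.1 ∈ midpointBox (2 * n) ∧ (x.2 = τ x.1 ∨ x.2 = -τ x.1) := by
  classical
  have hvert : ∀ s ∈ K.faces, ∀ v ∈ s, ∃ a : ℤ × ℤ, v = toPlane a := by
    intro s hs v hv
    obtain ⟨a, b, h⟩ := hK.2 v (K.down_closed hs (Finset.singleton_subset_iff.2 hv)
      (Finset.singleton_nonempty v))
    exact ⟨(a, b), h⟩
  have hsys : ∀ s, ∃ S, s ∈ K.faces → s.card = 3 → IsFaceSystem s S := by
    intro s
    by_cases h : s ∈ K.faces ∧ s.card = 3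
    · obtain ⟨S, hS⟩ := exists_isFaceSystem (K.indep h.1) h.2 (hvert s h.1)
      exact ⟨S, fun _ _ => hS⟩
    · exact ⟨∅, fun h1 h2 => absurd ⟨h1, h2⟩ h⟩
  choose Sys hSys using hsys
  -- Systems chosen in adjacent triangles need not be known to agree on a common edge: `hcross`
  -- covers all pairs in the union, including those with a common midpoint.
  obtain ⟨T, hT⟩ : ∃ T : Set ((ℤ × ℤ) × (ℤ × ℤ)), T = edgeSegments K ∪
      {x | ∃ s ∈ K.faces, s.card = 3 ∧ x ∈ Sys s} := ⟨_, rfl⟩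
  have hprim : ∀ x ∈ T, IsCoprime x.2.1 x.2.2 := by
    rw [hT]
    rintro x (hx | ⟨s, hs, hsc, hx⟩)
    · exact hx.1
    · exact (hSys s hs hsc).primitive x hx
  have hpar : ∀ x ∈ T, EvenDiff x.1 x.2 := by
    rw [hT]
    rintro x (hx | ⟨s, hs, hsc, hx⟩)
    · exact hx.2.1
    · exact (hSys s hs hsc).parity x hx
  have hface : ∀ x ∈ T, ∃ s ∈ K.faces, (s.card = 2 ∨ s.card = 3 ∧ x ∈ Sys s) ∧
      halfPoint (x.1 + x.2) ∈ convexHull ℝ (s : Set (ℝ × ℝ)) ∧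
      halfPoint (x.1 - x.2) ∈ convexHull ℝ (s : Set (ℝ × ℝ)) := by
    rw [hT]
    rintro x (⟨-, -, e, he, hec, h1, h2⟩ | ⟨s, hs, hsc, hx⟩)
    · exact ⟨e, he, Or.inl hec, h1, h2⟩
    · exact ⟨s, hs, Or.inr ⟨hsc, hx⟩, (hSys s hs hsc).mem_add x hx, (hSys s hs hsc).mem_sub x hx⟩
  -- A crossing point lies in the common face `s ∩ t`. As faces are extreme, all four end points lie
  -- there too. At most two vertices would make the segments parallel; three make both faces the
  -- same triangle, whose system has no crossings.
  have hcross : ∀ x ∈ T, ∀ y ∈ T, ¬ SegCross (y.1 - x.1) x.2 y.2 := by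
    intro x hx y hy hc
    obtain ⟨s, hs, hsc, hs1, hs2⟩ := hface x hx
    obtain ⟨t, ht, htc, ht1, ht2⟩ := hface y hy
    obtain ⟨p, hp1, hp2⟩ := hc.exists_mem_openSegment
    have hp := K.inter_subset_convexHull hs ht
      ⟨(convex_convexHull ℝ _).openSegment_subset hs1 hs2 hp1,
        (convex_convexHull ℝ _).openSegment_subset ht1 ht2 hp2⟩
    rw [← Finset.coe_inter] at hp
    have i1 := (K.indep hs).mem_convexHull_of_mem_openSegment Finset.inter_subset_left hs1 hs2 hp1 hp
    have i2 := (K.indep hs).mem_convexHull_of_mem_openSegment Finset.inter_subset_left hs2 hs1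
      (by rwa [openSegment_symm]) hp
    have i3 := (K.indep ht).mem_convexHull_of_mem_openSegment Finset.inter_subset_right ht1 ht2 hp2 hp
    have i4 := (K.indep ht).mem_convexHull_of_mem_openSegment Finset.inter_subset_right ht2 ht1
      (by rwa [openSegment_symm]) hp
    by_cases hcard : (s ∩ t).card ≤ 2
    · have h0 := idet_eq_zero_of_card_le_two hcard i1 i2 i3 i4
      have := hc.1
      rw [h0, abs_zero] at this
      exact absurd this (not_lt.2 (abs_nonneg _))
    · have l1 := Finset.card_le_card (Finset.inter_subset_left (s₁ := s) (s₂ := t))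
      have l2 := Finset.card_le_card (Finset.inter_subset_right (s₁ := s) (s₂ := t))
      have hsc' := hsc.resolve_left (by omega)
      have htc' := htc.resolve_left (by omega)
      have e1 : s ∩ t = s := Finset.eq_of_subset_of_card_le Finset.inter_subset_left (by omega)
      have e2 : s ∩ t = t := Finset.eq_of_subset_of_card_le Finset.inter_subset_right (by omega)
      have e3 : s = t := e1.symm.trans e2
      subst e3
      exact (hSys s hs hsc'.1).not_cross x hsc'.2 y htc'.2 hc
  have hrect : ∀ s ∈ K.faces, convexHull ℝ (s : Set (ℝ × ℝ)) ⊆ latticeRectangle n n :=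
    fun s hs => hK.1 ▸ SimplicialComplex.convexHull_subset_space hs
  have hbox : ∀ x ∈ T, (|x.2.1| ≤ x.1.1 ∧ |x.2.1| ≤ 2 * n - x.1.1) ∧
      (|x.2.2| ≤ x.1.2 ∧ |x.2.2| ≤ 2 * n - x.1.2) := by
    intro x hx
    obtain ⟨s, hs, -, h1, h2⟩ := hface x hx
    have h3 := halfPoint_mem_rectangle.1 (hrect s hs h1)
    have h4 := halfPoint_mem_rectangle.1 (hrect s hs h2)
    simp only [Prod.fst_add, Prod.snd_add, Prod.fst_sub, Prod.snd_sub] at h3 h4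
    simp only [abs_le]
    omega
  have hmid : ∀ x ∈ T, x.1 ∈ midpointBox (2 * n) := by
    intro x hx
    have h := hbox x hx
    have h1 := abs_nonneg x.2.1
    have h2 := abs_nonneg x.2.2
    exact ⟨by omega, by omega, by omega, by omega, not_even_of_primitive (hprim x hx) (hpar x hx)⟩
  have hcomp : ∀ q ∈ midpointBox (2 * n), ∃ U, IsUpper U ∧ ((q, U) ∈ T ∨ (q, -U) ∈ T) := by
    rintro q ⟨h1, h2, h3, h4, h5⟩
    obtain ⟨t, ht, htc, hqt⟩ := exists_triangle_of_mem_rectangle hn hn hK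
      (halfPoint_mem_rectangle.2 ⟨⟨h1, h2⟩, h3, h4⟩)
    obtain ⟨U, hU⟩ := (hSys t ht htc).complete q h5 hqt
    have hUT : (q, U) ∈ T := by rw [hT]; exact Or.inr ⟨t, ht, htc, hU⟩
    have hU0 : U ≠ 0 := by
      rintro rfl
      have := hprim _ hUT
      simp [isCoprime_zero_left] at this
    rcases isUpper_or_neg hU0 with h | h
    · exact ⟨U, h, Or.inl hUT⟩
    · exact ⟨-U, h, Or.inr (by rwa [neg_neg])⟩
  have hτ : ∀ q, ∃ U, q ∈ midpointBox (2 * n) → IsUpper U ∧ ((q, U) ∈ T ∨ (q, -U) ∈ T) := by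
    intro q
    by_cases hq : q ∈ midpointBox (2 * n)
    · obtain ⟨U, hU⟩ := hcomp q hq
      exact ⟨U, fun _ => hU⟩
    · exact ⟨0, fun h => absurd h hq⟩
  choose τ hτ using hτ
  have hfield : IsDirField (2 * n) τ := by
    constructor
    · exact fun q hq => (hτ q hq).1
    · intro q hq
      rcases (hτ q hq).2 with h | h
      · exact hprim _ h
      · exact (IsCoprime.neg_neg_iff _ _).1 (hprim _ h)
    · intro q hq
      rcases (hτ q hq).2 with h | h
      · exact hpar _ h
      · have := hpar _ h
        simp only [EvenDiff, Prod.fst_neg, Prod.snd_neg] at this ⊢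
        omega
    · intro q hq
      rcases (hτ q hq).2 with h | h
      · exact (hbox _ h).1
      · simpa using (hbox _ h).1
    · intro q hq
      rcases (hτ q hq).2 with h | h
      · exact (hbox _ h).2
      · simpa using (hbox _ h).2
    · intro q hq r hr hc
      rcases (hτ q hq).2 with h | h <;> rcases (hτ r hr).2 with h' | h'
      · exact hcross _ h _ h' hc
      · exact hcross _ h _ h' (segCross_neg_right.2 hc)
      · exact hcross _ h _ h' (segCross_neg_mid.2 hc)
      · exact hcross _ h _ h' (segCross_neg_mid.2 (segCross_neg_right.2 hc))
  refine ⟨τ, hfield, fun x hx => ?_⟩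
  have hxT : x ∈ T := by rw [hT]; exact Or.inl hx
  have hq := hmid x hxT
  refine ⟨hq, idet_eq_zero_of_primitive (hprim x hxT) (hfield.primitive _ hq) ?_⟩
  -- Nonparallel segments with the same midpoint cross, so the direction at each midpoint is unique
  -- up to sign.
  by_contra hne
  have hc : SegCross (x.1 - x.1) x.2 (τ x.1) := by
    rw [sub_self]
    simp only [SegCross, idet, Prod.fst_zero, Prod.snd_zero, zero_mul, sub_zero, abs_zero]
    exact ⟨abs_pos.2 hne, abs_pos.2 hne⟩
  rcases (hτ _ hq).2 with h | h
  · exact hcross _ hxT _ h hc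
  · exact hcross _ hxT _ h (segCross_neg_right.2 hc)

/-- The edges are unions of primitive segments, so `τ` together with the set of midpoints whose
segment lies in an edge recovers their union. -/
theorem edgeSpace_eq_of_dirField {n : ℕ} {K : SimplicialComplex ℝ (ℝ × ℝ)}
    (hK : K ∈ latticeTriangulations n n) {τ : ℤ × ℤ → ℤ × ℤ}
    (hτ : ∀ x ∈ edgeSegments K, x.1 ∈ midpointBox (2 * n) ∧ (x.2 = τ x.1 ∨ x.2 = -τ x.1)) :
    edgeSpace K = ⋃ q ∈ {q ∈ midpointBox (2 * n) | (q, τ q) ∈ edgeSegments K},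
      segment ℝ (halfPoint (q + τ q)) (halfPoint (q - τ q)) := by
  apply Set.Subset.antisymm
  · intro x hx
    obtain ⟨e, ⟨he, hec⟩, hxe⟩ := Set.mem_iUnion₂.1 hx
    have hvert : ∀ v ∈ e, ∃ a : ℤ × ℤ, v = toPlane a := by
      intro v hv
      obtain ⟨a, b, h⟩ := hK.2 v (K.down_closed he (Finset.singleton_subset_iff.2 hv)
        (Finset.singleton_nonempty v))
      exact ⟨(a, b), h⟩
    obtain ⟨a', b', hab, rfl⟩ := Finset.card_eq_two.1 hec
    obtain ⟨a, rfl⟩ := hvert a' (by simp)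
    obtain ⟨b, rfl⟩ := hvert b' (by simp)
    have hseg : convexHull ℝ ((({toPlane a, toPlane b} : Finset (ℝ × ℝ))) : Set (ℝ × ℝ)) =
        segment ℝ (toPlane a) (toPlane b) := by
      rw [Finset.coe_pair, convexHull_pair]
    rw [hseg] at hxe
    obtain ⟨q, U, hU, hqU, hxq, h1, h2⟩ := exists_primitive_piece
      (fun h : a = b => hab (by rw [h])) hxe
    have hmem : (q, U) ∈ edgeSegments K :=
      ⟨hU, hqU, _, he, hec, by rw [hseg]; exact h1, by rw [hseg]; exact h2⟩
    obtain ⟨hq, h | h⟩ := hτ _ hmem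
    · obtain rfl : U = τ q := h
      exact Set.mem_iUnion₂.2 ⟨q, ⟨hq, hmem⟩, hxq⟩
    · obtain rfl : U = -τ q := h
      refine Set.mem_iUnion₂.2 ⟨q, ⟨hq, neg_mem_edgeSegments hmem⟩, ?_⟩
      rw [segment_symm]
      simpa [sub_eq_add_neg] using hxq
  · intro x hx
    obtain ⟨q, ⟨-, -, -, e, he, hec, h1, h2⟩, hxq⟩ := Set.mem_iUnion₂.1 hx
    exact Set.mem_iUnion₂.2 ⟨e, ⟨he, hec⟩, (convex_convexHull ℝ _).segment_subset h1 h2 hxq⟩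

/-- The number of lattice triangulations of a square is at most exponential in its area. -/
theorem numLatticeTriangulations_le {n : ℕ} (hn : 0 < n) :
    numLatticeTriangulations n n ≤ 4 ^ ((2 * n + 1) ^ 2) := by
  classical
  obtain ⟨Φ, hΦ⟩ := exists_dirField_code (2 * n)
  have hex : ∀ K : SimplicialComplex ℝ (ℝ × ℝ), ∃ τ : ℤ × ℤ → ℤ × ℤ,
      K ∈ latticeTriangulations n n → IsDirField (2 * n) τ ∧
      ∀ x ∈ edgeSegments K, x.1 ∈ midpointBox (2 * n) ∧ (x.2 = τ x.1 ∨ x.2 = -τ x.1) := by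
    intro K
    by_cases h : K ∈ latticeTriangulations n n
    · obtain ⟨τ, hτ⟩ := exists_dirField_of_triangulation hn h
      exact ⟨τ, fun _ => hτ⟩
    · exact ⟨0, fun h' => absurd h' h⟩
  choose τ hτ using hex
  set C : Finset (ℤ × ℤ) := Finset.Icc 0 (2 * n : ℤ) ×ˢ Finset.Icc 0 (2 * n : ℤ) with hC
  have hCcard : C.card = (2 * n + 1) ^ 2 := by
    rw [hC, Finset.card_product, Int.card_Icc, sq]
    congr 1
  have hbC : ∀ q ∈ midpointBox (2 * n), q ∈ C := by
    rintro q ⟨h1, h2, h3, h4, -⟩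
    rw [hC, Finset.mem_product, Finset.mem_Icc, Finset.mem_Icc]
    exact ⟨⟨h1, h2⟩, h3, h4⟩
  have hmain : numLatticeTriangulations n n ≤
      ((C.powerset ×ˢ C.powerset : Finset (Finset (ℤ × ℤ) × Finset (ℤ × ℤ))) :
        Set (Finset (ℤ × ℤ) × Finset (ℤ × ℤ))).ncard := by
    refine Set.ncard_le_ncard_of_injOn
      -- Two bits per point of the doubled square: one encodes the direction field, the other marks
      -- the segments contained in edges. This is where the base 4 comes from.
      (fun K => (C.filter fun q => Φ (τ K) q, C.filter fun q => (q, τ K q) ∈ edgeSegments K))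
      ?_ ?_ (Finset.finite_toSet _)
    · intro K _
      simp only [Finset.mem_coe, Finset.mem_product, Finset.mem_powerset]
      exact ⟨Finset.filter_subset _ _, Finset.filter_subset _ _⟩
    · intro K hK L hL hKL
      simp only [Prod.mk.injEq] at hKL
      have hag : ∀ q ∈ midpointBox (2 * n), τ K q = τ L q := by
        refine hΦ _ _ (hτ K hK).1 (hτ L hL).1 fun q hq => ?_
        have := Finset.ext_iff.1 hKL.1 q
        simpa only [Finset.mem_filter, hbC q hq, true_and] using this
      refine eq_of_edgeSpace_eq hn hn hK hL ?_
      rw [edgeSpace_eq_of_dirField hK (hτ K hK).2, edgeSpace_eq_of_dirField hL (hτ L hL).2]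
      have hset : {q ∈ midpointBox (2 * n) | (q, τ K q) ∈ edgeSegments K} =
          {q ∈ midpointBox (2 * n) | (q, τ L q) ∈ edgeSegments L} := by
        ext q
        refine and_congr_right fun hq => ?_
        have := Finset.ext_iff.1 hKL.2 q
        simpa only [Finset.mem_filter, hbC q hq, true_and] using this
      rw [hset]
      refine Set.iUnion₂_congr fun q hq => ?_
      rw [hag q hq.1]
  rw [Set.ncard_coe_finset, Finset.card_product, Finset.card_powerset, hCcard, ← mul_pow] at hmain
  exact hmain

end UpperBound

namespace Geometry.SimplicialComplex

open Finset

/-! ### Gluing complexes along a line -/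

section Glue

/-- The union of two complexes, once faces of different complexes intersect well. -/
theorem exists_union {E : Type*} [AddCommGroup E] [Module ℝ E] (K L : SimplicialComplex ℝ E)
    (h : ∀ s ∈ K.faces, ∀ t ∈ L.faces,
      convexHull ℝ (s : Set E) ∩ convexHull ℝ (t : Set E) ⊆ convexHull ℝ (s ∩ t : Set E)) :
    ∃ M : SimplicialComplex ℝ E, M.faces = K.faces ∪ L.faces := by
  refine ⟨{ faces := K.faces ∪ L.faces
            isRelLowerSet_faces := K.isRelLowerSet_faces.union L.isRelLowerSet_faces
            indep := ?_
            inter_subset_convexHull := ?_ }, rfl⟩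
  · rintro s (hs | hs)
    · exact K.indep hs
    · exact L.indep hs
  · rintro s t (hs | hs) (ht | ht)
    · exact K.inter_subset_convexHull hs ht
    · exact h s hs t ht
    · rw [Set.inter_comm, Set.inter_comm (s : Set E)]
      exact h t ht s hs
    · exact L.inter_subset_convexHull hs ht

theorem space_of_faces_union {E : Type*} [AddCommGroup E] [Module ℝ E]
    {K L M : SimplicialComplex ℝ E} (h : M.faces = K.faces ∪ L.faces) :
    M.space = K.space ∪ L.space := by
  simp only [space]
  rw [h, Set.biUnion_union]

theorem vertices_of_faces_union {E : Type*} [AddCommGroup E] [Module ℝ E]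
    {K L M : SimplicialComplex ℝ E} (h : M.faces = K.faces ∪ L.faces) :
    M.vertices = K.vertices ∪ L.vertices := by
  ext x
  simp only [mem_vertices, h, Set.mem_union]

theorem mem_vertices_of_mem {E : Type*} [AddCommGroup E] [Module ℝ E]
    {K : SimplicialComplex ℝ E} {s : Finset E} (hs : s ∈ K.faces) {v : E} (hv : v ∈ s) :
    v ∈ K.vertices :=
  K.down_closed hs (singleton_subset_iff.2 hv) (singleton_nonempty v)

theorem exists_mem_le_of_mem_convexHull {E : Type*} [AddCommGroup E] [Module ℝ E] (m : E →ₗ[ℝ] ℝ)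
    {s : Finset E} {x : E} (hx : x ∈ convexHull ℝ (s : Set E)) : ∃ p ∈ s, m p ≤ m x := by
  by_contra! h
  have h1 : convexHull ℝ (s : Set E) ⊆ {y | m x < m y} :=
    convexHull_min (fun y hy => h y hy) (convex_halfSpace_gt m.isLinear _)
  exact lt_irrefl (m x) (show m x < m x from h1 hx)

/-- A point of a simplex on a supporting hyperplane lies in the face on that hyperplane. -/
theorem mem_convexHull_filter_of_le {E : Type*} [AddCommGroup E] [Module ℝ E] (l : E →ₗ[ℝ] ℝ)
    {c : ℝ} {s : Finset E} (hs : ∀ v ∈ s, l v ≤ c) {x : E} (hx : x ∈ convexHull ℝ (s : Set E))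
    (hxc : c ≤ l x) : x ∈ convexHull ℝ ((s.filter fun v => l v = c : Finset E) : Set E) := by
  obtain ⟨w, hw0, hw1, rfl⟩ := Finset.mem_convexHull'.1 hx
  have hsum : ∑ y ∈ s, w y * (c - l y) = c - l (∑ y ∈ s, w y • y) := by
    simp_rw [mul_sub, sum_sub_distrib, ← sum_mul, hw1, one_mul, map_sum, map_smul, smul_eq_mul]
  have hnn : ∀ y ∈ s, 0 ≤ w y * (c - l y) :=
    fun y hy => mul_nonneg (hw0 y hy) (sub_nonneg.2 (hs y hy))
  have hzero : ∑ y ∈ s, w y * (c - l y) = 0 :=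
    le_antisymm (by rw [hsum]; linarith) (sum_nonneg hnn)
  have hw : ∀ y ∈ s, ¬ l y = c → w y = 0 := by
    intro y hy hne
    exact (mul_eq_zero.1 ((sum_eq_zero_iff_of_nonneg hnn).1 hzero y hy)).resolve_right
      (sub_ne_zero.2 (Ne.symm hne))
  refine Finset.mem_convexHull'.2 ⟨w, fun y hy => hw0 y (mem_of_mem_filter y hy), ?_, ?_⟩
  · rw [← hw1]
    exact sum_subset (filter_subset _ _) fun y hy hn => hw y hy fun h => hn (mem_filter.2 ⟨hy, h⟩)
  · refine sum_subset (filter_subset _ _) fun y hy hn => ?_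
    rw [hw y hy fun h => hn (mem_filter.2 ⟨hy, h⟩), zero_smul]

theorem mem_segment_of_line {l m : ℝ × ℝ →ₗ[ℝ] ℝ} (hlm : ∀ v, l v = 0 → m v = 0 → v = 0) {c : ℝ}
    {u v w : ℝ × ℝ} (hu : l u = c) (hv : l v = c) (hw : l w = c) (h1 : m u ≤ m v)
    (h2 : m v ≤ m w) : v ∈ segment ℝ u w := by
  rcases (h1.trans h2).eq_or_lt with h | h
  · have : v - u = 0 := hlm _ (by rw [map_sub, hu, hv, sub_self]) (by rw [map_sub]; linarith)
    rw [sub_eq_zero.1 this]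
    exact left_mem_segment ℝ u w
  · have hd : 0 < m w - m u := sub_pos.2 h
    rw [segment_eq_image']
    refine ⟨(m v - m u) / (m w - m u), ⟨div_nonneg (by linarith) hd.le,
      (div_le_one hd).2 (by linarith)⟩, ?_⟩
    refine sub_eq_zero.1 (hlm _ ?_ ?_)
    · simp only [map_sub, map_add, map_smul, hu, hv, hw, sub_self, smul_zero, add_zero]
    · simp only [map_sub, map_add, map_smul, smul_eq_mul]
      rw [div_mul_cancel₀ _ hd.ne']; ring

/-- On the line take the last vertex `p` of either simplex that does not lie beyond `x`. It lies
between a vertex of the other simplex and `x`, hence in that simplex, and so is one of its vertices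
by `hst` or `hts`. -/
theorem exists_common_le {l m : ℝ × ℝ →ₗ[ℝ] ℝ} (hlm : ∀ v, l v = 0 → m v = 0 → v = 0) {c : ℝ}
    {s t : Finset (ℝ × ℝ)} (hs : ∀ v ∈ s, l v = c) (ht : ∀ v ∈ t, l v = c)
    (hst : ∀ v ∈ s, v ∈ convexHull ℝ (t : Set (ℝ × ℝ)) → v ∈ t)
    (hts : ∀ v ∈ t, v ∈ convexHull ℝ (s : Set (ℝ × ℝ)) → v ∈ s) {x : ℝ × ℝ} (hx : l x = c)
    (hxs : x ∈ convexHull ℝ (s : Set (ℝ × ℝ))) (hxt : x ∈ convexHull ℝ (t : Set (ℝ × ℝ))) :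
    ∃ p, p ∈ s ∧ p ∈ t ∧ m p ≤ m x := by
  classical
  obtain ⟨r, hr, hrx⟩ := exists_mem_le_of_mem_convexHull m hxs
  obtain ⟨r', hr', hrx'⟩ := exists_mem_le_of_mem_convexHull m hxt
  obtain ⟨p, hp, hmax⟩ := exists_max_image ((s ∪ t).filter fun v => m v ≤ m x) m
    ⟨r, mem_filter.2 ⟨mem_union_left _ hr, hrx⟩⟩
  obtain ⟨hp, hpx⟩ := mem_filter.1 hp
  have h1 := hmax r (mem_filter.2 ⟨mem_union_left _ hr, hrx⟩)
  have h2 := hmax r' (mem_filter.2 ⟨mem_union_right _ hr', hrx'⟩)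
  rcases mem_union.1 hp with hp | hp
  · refine ⟨p, hp, hst p hp ?_, hpx⟩
    exact (convex_convexHull ℝ _).segment_subset (subset_convexHull ℝ _ hr') hxt
      (mem_segment_of_line hlm (ht _ hr') (hs _ hp) hx h2 hpx)
  · refine ⟨p, hts p hp ?_, hp, hpx⟩
    exact (convex_convexHull ℝ _).segment_subset (subset_convexHull ℝ _ hr) hxs
      (mem_segment_of_line hlm (hs _ hr) (ht _ hp) hx h1 hpx)

/-- Two planar complexes on different sides of a line with the same vertices on that line can be
glued. -/
theorem exists_glue {K L : SimplicialComplex ℝ (ℝ × ℝ)} {l m : ℝ × ℝ →ₗ[ℝ] ℝ}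
    (hlm : ∀ v, l v = 0 → m v = 0 → v = 0) {c : ℝ} (hK : ∀ v ∈ K.vertices, l v ≤ c)
    (hL : ∀ v ∈ L.vertices, c ≤ l v)
    (hv : ∀ v, l v = c → (v ∈ K.vertices ↔ v ∈ L.vertices)) :
    ∃ M : SimplicialComplex ℝ (ℝ × ℝ), M.faces = K.faces ∪ L.faces := by
  classical
  refine exists_union K L ?_
  rintro s hs t ht x ⟨hxs, hxt⟩
  have hKs : ∀ v ∈ s, l v ≤ c := fun v hv => hK v (mem_vertices_of_mem hs hv)
  have hLt : ∀ v ∈ t, c ≤ l v := fun v hv => hL v (mem_vertices_of_mem ht hv)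
  have hx1 : l x ≤ c :=
    convexHull_min (t := {y | l y ≤ c}) hKs (convex_halfSpace_le l.isLinear _) hxs
  have hx2 : c ≤ l x :=
    convexHull_min (t := {y | c ≤ l y}) hLt (convex_halfSpace_ge l.isLinear _) hxt
  have hx : l x = c := le_antisymm hx1 hx2
  -- A common point lies on the line, so both simplices may be replaced by their faces on the line.
  have hxs' := mem_convexHull_filter_of_le l hKs hxs hx2
  have hxt' := mem_convexHull_filter_of_le (-l) (c := -c)
    (fun v hv => neg_le_neg (hLt v hv)) hxt (neg_le_neg hx1)
  simp only [LinearMap.neg_apply, neg_inj] at hxt'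
  obtain ⟨s', hs'⟩ : ∃ s', s' = s.filter fun v => l v = c := ⟨_, rfl⟩
  obtain ⟨t', ht'⟩ : ∃ t', t' = t.filter fun v => l v = c := ⟨_, rfl⟩
  rw [← hs'] at hxs'
  rw [← ht'] at hxt'
  have hss : s' ⊆ s := by rw [hs']; exact filter_subset _ _
  have htt : t' ⊆ t := by rw [ht']; exact filter_subset _ _
  have hs'l : ∀ v ∈ s', l v = c := by rw [hs']; exact fun v hv => (mem_filter.1 hv).2
  have ht'l : ∀ v ∈ t', l v = c := by rw [ht']; exact fun v hv => (mem_filter.1 hv).2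
  have hs'f : s' ∈ K.faces := K.down_closed hs hss (by
    rw [← coe_nonempty, ← convexHull_nonempty_iff (𝕜 := ℝ)]; exact ⟨x, hxs'⟩)
  have ht'f : t' ∈ L.faces := L.down_closed ht htt (by
    rw [← coe_nonempty, ← convexHull_nonempty_iff (𝕜 := ℝ)]; exact ⟨x, hxt'⟩)
  have hst : ∀ v ∈ s', v ∈ convexHull ℝ (t' : Set (ℝ × ℝ)) → v ∈ t' := fun v hvs hvt =>
    (vertex_mem_convexHull_iff ((hv v (hs'l v hvs)).1 (mem_vertices_of_mem hs'f hvs)) ht'f).1 hvt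
  have hts : ∀ v ∈ t', v ∈ convexHull ℝ (s' : Set (ℝ × ℝ)) → v ∈ s' := fun v hvt hvs =>
    (vertex_mem_convexHull_iff ((hv v (ht'l v hvt)).2 (mem_vertices_of_mem ht'f hvt)) hs'f).1 hvs
  -- Common vertices on both sides of `x`, the second one from the reversed coordinate `-m`, put `x`
  -- in the hull of the common face.
  obtain ⟨p, hps, hpt, hpx⟩ := exists_common_le hlm hs'l ht'l hst hts hx hxs' hxt'
  obtain ⟨q, hqs, hqt, hqx⟩ := exists_common_le (m := -m)
    (fun v h1 h2 => hlm v h1 (neg_eq_zero.1 h2)) hs'l ht'l hst hts hx hxs' hxt'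
  have hp : p ∈ (s ∩ t : Set (ℝ × ℝ)) := ⟨hss hps, htt hpt⟩
  have hq : q ∈ (s ∩ t : Set (ℝ × ℝ)) := ⟨hss hqs, htt hqt⟩
  refine (convex_convexHull ℝ _).segment_subset (subset_convexHull ℝ _ hp)
    (subset_convexHull ℝ _ hq)
    (mem_segment_of_line hlm (hs'l p hps) hx (hs'l q hqs) hpx ?_)
  simpa using hqx

/-- In a glued complex, the first part consists of the faces on its side of the line. -/
theorem mem_faces_left_iff {E : Type*} [AddCommGroup E] [Module ℝ E] {K L M : SimplicialComplex ℝ E}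
    (hM : M.faces = K.faces ∪ L.faces) {l : E → ℝ} {c : ℝ} (hK : ∀ v ∈ K.vertices, l v ≤ c)
    (hL : ∀ v ∈ L.vertices, c ≤ l v)
    (hsp : ∀ s ∈ L.faces, (∀ v ∈ s, l v = c) → convexHull ℝ (s : Set E) ⊆ K.space)
    (s : Finset E) : s ∈ K.faces ↔ s ∈ M.faces ∧ ∀ v ∈ s, l v ≤ c := by
  classical
  constructor
  · intro hs
    exact ⟨by rw [hM]; exact Or.inl hs, fun v hv => hK v (mem_vertices_of_mem hs hv)⟩
  · rintro ⟨hs, hsl⟩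
    have hs' := hs
    rw [hM] at hs'
    rcases hs' with hs' | hs'
    · exact hs'
    · have hsc : ∀ v ∈ s, l v = c :=
        fun v hv => le_antisymm (hsl v hv) (hL v (mem_vertices_of_mem hs' hv))
      have hne := nonempty_of_mem_faces hs
      -- The barycentre of `s` lies in some face `t` of `K`, which therefore contains `s`.
      obtain ⟨x, hxs, hx⟩ := (M.indep hs).exists_mem_convexHull_forall_subset hne
      obtain ⟨t, ht, hxt⟩ := mem_space_iff.1 (hsp s hs' hsc hxs)
      have htM : t ∈ M.faces := by rw [hM]; exact Or.inl ht
      have hst : s ∩ t = s := hx _ inter_subset_left (by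
        rw [coe_inter]; exact M.inter_subset_convexHull hs htM ⟨hxs, hxt⟩)
      exact K.down_closed ht (inter_eq_left.1 hst) hne

end Glue

/-! ### Affine images of complexes -/

section Map

variable {E F : Type*} [AddCommGroup E] [Module ℝ E] [AddCommGroup F] [Module ℝ F]

/-- The image of a complex under an affine equivalence. -/
def mapEquiv (K : SimplicialComplex ℝ E) (e : E ≃ᵃ[ℝ] F) : SimplicialComplex ℝ F where
  faces := (Finset.map e.toEquiv.toEmbedding) '' K.faces
  isRelLowerSet_faces := by
    rintro _ ⟨s, hs, rfl⟩
    refine ⟨(nonempty_of_mem_faces hs).map, fun t ht hne => ?_⟩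
    obtain ⟨u, hus, rfl⟩ := subset_map_iff.1 ht
    exact ⟨u, K.down_closed hs hus (map_nonempty.1 hne), rfl⟩
  indep := by
    rintro _ ⟨s, hs, rfl⟩
    have h2 := (e.affineIndependent_set_of_eq_iff (s := (s : Set E))).2 (K.indep hs)
    exact h2.mono (s := ((s.map e.toEquiv.toEmbedding : Finset F) : Set F)) (by rw [coe_map]; rfl)
  inter_subset_convexHull := by
    rintro _ _ ⟨s, hs, rfl⟩ ⟨t, ht, rfl⟩
    have h : ∀ u : Set E, convexHull ℝ (e '' u) = e '' convexHull ℝ u :=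
      fun u => (e.toAffineMap.image_convexHull u).symm
    rw [coe_map, coe_map]
    change convexHull ℝ (e '' s) ∩ convexHull ℝ (e '' t) ⊆ convexHull ℝ (e '' s ∩ e '' t)
    rw [← Set.image_inter e.injective, h, h, h, ← Set.image_inter e.injective]
    exact Set.image_mono (K.inter_subset_convexHull hs ht)

theorem mem_faces_mapEquiv {K : SimplicialComplex ℝ E} {e : E ≃ᵃ[ℝ] F} {s : Finset E} :
    s.map e.toEquiv.toEmbedding ∈ (K.mapEquiv e).faces ↔ s ∈ K.faces :=
  (map_injective _).mem_set_image

theorem mapEquiv_injective (e : E ≃ᵃ[ℝ] F) :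
    Function.Injective fun K : SimplicialComplex ℝ E => K.mapEquiv e := by
  intro K L h
  have h : K.mapEquiv e = L.mapEquiv e := h
  refine SimplicialComplex.ext (Set.ext fun s => ?_)
  rw [← mem_faces_mapEquiv (e := e), h, mem_faces_mapEquiv]

theorem space_mapEquiv (K : SimplicialComplex ℝ E) (e : E ≃ᵃ[ℝ] F) :
    (K.mapEquiv e).space = e '' K.space := by
  have h : ∀ u : Set E, convexHull ℝ (e '' u) = e '' convexHull ℝ u :=
    fun u => (e.toAffineMap.image_convexHull u).symm
  simp only [space, mapEquiv, Set.biUnion_image, coe_map, Set.image_iUnion₂]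
  exact Set.iUnion₂_congr fun s _ => h s

theorem vertices_mapEquiv (K : SimplicialComplex ℝ E) (e : E ≃ᵃ[ℝ] F) :
    (K.mapEquiv e).vertices = e '' K.vertices := by
  ext x
  obtain ⟨y, rfl⟩ := e.surjective x
  rw [e.injective.mem_set_image, mem_vertices, mem_vertices, ← mem_faces_mapEquiv (e := e)]
  rfl

end Map

/-! ### The complex of one simplex -/

section Simplex

variable {E : Type*} [AddCommGroup E] [Module ℝ E]

/-- The complex of all faces of one simplex. -/
theorem exists_simplex {s : Finset E} (hs : AffineIndependent ℝ ((↑) : s → E)) (hne : s.Nonempty) :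
    ∃ K : SimplicialComplex ℝ E, K.space = convexHull ℝ (s : Set E) ∧ K.vertices = s ∧
      K.faces = {t | t ⊆ s ∧ t.Nonempty} := by
  classical
  refine ⟨{ faces := {t | t ⊆ s ∧ t.Nonempty}
            isRelLowerSet_faces := fun {t} ht => ⟨ht.2, fun u hu hne => ⟨hu.trans ht.1, hne⟩⟩
            indep := fun {t} ht => hs.mono ht.1
            inter_subset_convexHull := fun {t u} ht hu => (hs.convexHull_inter ht.1 hu.1).superset },
    ?_, ?_, rfl⟩
  · apply Set.Subset.antisymm
    · exact Set.iUnion₂_subset fun t ht => convexHull_mono ht.1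
    · exact Set.subset_biUnion_of_mem (u := fun t : Finset E => convexHull ℝ (t : Set E))
        (show s ∈ {t | t ⊆ s ∧ t.Nonempty} from ⟨Subset.rfl, hne⟩)
  · ext x
    simp [vertices]

end Simplex

end Geometry.SimplicialComplex

/-! ### Triangulations of a strip of width one -/

section Ladders

open Geometry Geometry.SimplicialComplex

/-- The trapezoid with vertical sides from `(0, 0)` to `(0, a)` and from `(1, 0)` to `(1, b)`. -/
def trapezoid (a b : ℝ) : Set (ℝ × ℝ) :=
  {p | 0 ≤ p.1 ∧ p.1 ≤ 1 ∧ 0 ≤ p.2 ∧ p.2 ≤ (1 - p.1) * a + p.1 * b}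

/-- The functional that is constant on the line through `(0, a)` and `(1, b)`. -/
def rungForm (a b : ℝ) : ℝ × ℝ →ₗ[ℝ] ℝ :=
  LinearMap.snd ℝ ℝ ℝ + (a - b) • LinearMap.fst ℝ ℝ ℝ

theorem rungForm_apply (a b : ℝ) (p : ℝ × ℝ) : rungForm a b p = p.2 + (a - b) * p.1 := by
  simp [rungForm]

theorem affineIndependent_triple {a b c : ℝ × ℝ}
    (h : (b.1 - a.1) * (c.2 - a.2) - (b.2 - a.2) * (c.1 - a.1) ≠ 0) :
    AffineIndependent ℝ ((↑) : ({a, b, c} : Finset (ℝ × ℝ)) → ℝ × ℝ) := by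
  have h1 : AffineIndependent ℝ ![a, b, c] := by
    rw [affineIndependent_iff_of_fintype]
    intro w hw hw'
    rw [Finset.weightedVSub_eq_linear_combination _ hw] at hw'
    simp only [Fin.sum_univ_three, Matrix.cons_val_zero, Matrix.cons_val_one, Matrix.cons_val,
      Prod.ext_iff, Prod.fst_add, Prod.snd_add, Prod.smul_fst, Prod.smul_snd, smul_eq_mul,
      Prod.fst_zero, Prod.snd_zero] at hw hw'
    obtain ⟨e1, e2⟩ := hw'
    have k2 : w 2 = 0 := by
      refine (mul_eq_zero.1 (?_ : w 2 * ((b.1 - a.1) * (c.2 - a.2) -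
        (b.2 - a.2) * (c.1 - a.1)) = 0)).resolve_right h
      linear_combination (b.1 - a.1) * e2 - (b.2 - a.2) * e1 + (a.1 * b.2 - b.1 * a.2) * hw
    have k1 : w 1 = 0 := by
      refine (mul_eq_zero.1 (?_ : w 1 * ((b.1 - a.1) * (c.2 - a.2) -
        (b.2 - a.2) * (c.1 - a.1)) = 0)).resolve_right h
      linear_combination (c.2 - a.2) * e1 - (c.1 - a.1) * e2 + (c.1 * a.2 - a.1 * c.2) * hw
    have k0 : w 0 = 0 := by linarith
    intro i
    fin_cases i
    · exact k0
    · exact k1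
    · exact k2
  refine h1.range.mono (s := (({a, b, c} : Finset (ℝ × ℝ)) : Set (ℝ × ℝ))) ?_
  intro x hx
  simp only [Finset.coe_insert, Finset.coe_singleton, Set.mem_insert_iff,
    Set.mem_singleton_iff] at hx
  rcases hx with rfl | rfl | rfl
  · exact ⟨0, rfl⟩
  · exact ⟨1, rfl⟩
  · exact ⟨2, rfl⟩

/-- A triangle can be attached to a complex that fills a trapezoid. -/
theorem exists_attach_triangle {K : SimplicialComplex ℝ (ℝ × ℝ)} {a b : ℝ} (ha : 0 ≤ a) (hb : 0 ≤ b)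
    (hsp : K.space = trapezoid a b) (hK : ∀ v ∈ K.vertices, rungForm a b v ≤ a)
    (hKv : ∀ v, rungForm a b v = a → (v ∈ K.vertices ↔ v = (0, a) ∨ v = (1, b))) {r : ℝ × ℝ}
    (hr : a < rungForm a b r) :
    ∃ M : SimplicialComplex ℝ (ℝ × ℝ),
      M.space = trapezoid a b ∪
        convexHull ℝ ((({(0, a), (1, b), r} : Finset (ℝ × ℝ))) : Set (ℝ × ℝ)) ∧
      M.vertices = K.vertices ∪ {r} ∧
      (∀ u, u ∈ K.faces ↔ u ∈ M.faces ∧ ∀ v ∈ u, rungForm a b v ≤ a) ∧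
      {(0, a), (1, b)} ∈ M.faces := by
  classical
  have hp : rungForm a b (0, a) = a := by rw [rungForm_apply]; simp
  have hq : rungForm a b (1, b) = a := by rw [rungForm_apply]; simp
  have hind : AffineIndependent ℝ ((↑) : ({(0, a), (1, b), r} : Finset (ℝ × ℝ)) → ℝ × ℝ) := by
    -- The determinant of this triangle is `rungForm a b r - a`.
    apply affineIndependent_triple
    rw [rungForm_apply] at hr
    intro h0
    dsimp only at h0
    linarith
  obtain ⟨T, hTs, hTv, hTf⟩ := exists_simplex hind ⟨r, by simp⟩
  have hT : ∀ v ∈ T.vertices, a ≤ rungForm a b v := by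
    rw [hTv]
    intro v hv
    simp only [Finset.coe_insert, Finset.coe_singleton, Set.mem_insert_iff,
      Set.mem_singleton_iff] at hv
    rcases hv with rfl | rfl | rfl
    · exact hp.ge
    · exact hq.ge
    · exact hr.le
  obtain ⟨M, hM⟩ := exists_glue (K := K) (L := T) (l := rungForm a b) (m := LinearMap.fst ℝ ℝ ℝ)
    (by
      intro v h1 h2
      rw [LinearMap.fst_apply] at h2
      rw [rungForm_apply, h2, mul_zero, add_zero] at h1
      exact Prod.ext h2 h1) hK hT (by
      intro v hv
      rw [hKv v hv, hTv]
      simp only [Finset.coe_insert, Finset.coe_singleton, Set.mem_insert_iff,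
        Set.mem_singleton_iff]
      constructor
      · rintro (h | h)
        · exact Or.inl h
        · exact Or.inr (Or.inl h)
      · rintro (h | h | h)
        · exact Or.inl h
        · exact Or.inr h
        · rw [h] at hv; linarith)
  have hpq : ({(0, a), (1, b)} : Finset (ℝ × ℝ)) ∈ M.faces := by
    rw [hM, hTf]
    refine Or.inr ⟨?_, by simp⟩
    intro x hx
    simp only [Finset.mem_insert, Finset.mem_singleton] at hx ⊢
    tauto
  refine ⟨M, by rw [space_of_faces_union hM, hsp, hTs], ?_,
    mem_faces_left_iff hM hK hT ?_, hpq⟩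
  · rw [vertices_of_faces_union hM, hTv]
    ext x
    simp only [Set.mem_union, Finset.coe_insert, Finset.coe_singleton, Set.mem_insert_iff,
      Set.mem_singleton_iff]
    constructor
    · rintro (h | h | h | h)
      · exact Or.inl h
      · exact Or.inl (h ▸ (hKv _ hp).2 (Or.inl rfl))
      · exact Or.inl (h ▸ (hKv _ hq).2 (Or.inr rfl))
      · exact Or.inr h
    · rintro (h | h)
      · exact Or.inl h
      · exact Or.inr (Or.inr (Or.inr h))
  · intro u hu hul
    have hsub : (u : Set (ℝ × ℝ)) ⊆ {(0, a), (1, b)} := by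
      intro x hx
      rw [hTf] at hu
      have h1 := hu.1 hx
      simp only [Finset.mem_insert, Finset.mem_singleton] at h1
      rcases h1 with h | h | h
      · exact Or.inl h
      · exact Or.inr h
      · have := hul x hx
        rw [h] at this; linarith
    refine (convexHull_mono hsub).trans ?_
    rw [convexHull_pair, hsp]
    rintro _ ⟨x, y, hx, hy, hxy, rfl⟩
    refine ⟨?_, ?_, ?_, ?_⟩ <;> simp only [Prod.smul_mk, Prod.mk_add_mk, smul_eq_mul]
    · linarith
    · linarith
    · positivity
    · obtain rfl : x = 1 - y := by linarith
      apply le_of_eq; ring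

theorem trapezoid_union_left {a a' b : ℝ} (haa' : a < a') (hb : 0 ≤ b) (ha : 0 ≤ a) :
    trapezoid a b ∪ convexHull ℝ ((({(0, a), (1, b), (0, a')} : Finset (ℝ × ℝ))) : Set (ℝ × ℝ)) =
      trapezoid a' b := by
  have h1 : ((0, a) : ℝ × ℝ) ≠ (1, b) := by simp
  have h2 : ((0, a) : ℝ × ℝ) ≠ (0, a') := by simp [haa'.ne]
  have h3 : ((1, b) : ℝ × ℝ) ≠ (0, a') := by simp
  ext ⟨x, y⟩
  rw [Set.mem_union, mem_convexHull_triple h1 h2 h3]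
  simp only [trapezoid, Set.mem_ofPred_eq, Prod.smul_mk, Prod.mk_add_mk, smul_eq_mul, Prod.mk.injEq]
  constructor
  · rintro (⟨hx0, hx1, hy0, hy1⟩ | ⟨u, v, w, hu, hv, hw, h, hx, hy⟩)
    · exact ⟨hx0, hx1, hy0, hy1.trans (by nlinarith)⟩
    · obtain rfl : v = x := by linarith
      refine ⟨hv, by linarith, by rw [← hy]; have := ha.trans haa'.le; positivity, ?_⟩
      rw [← hy]
      nlinarith
  · rintro ⟨hx0, hx1, hy0, hy1⟩
    by_cases hy : y ≤ (1 - x) * a + x * b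
    · exact Or.inl ⟨hx0, hx1, hy0, hy⟩
    · right
      push Not at hy
      have hd : 0 < a' - a := sub_pos.2 haa'
      have hw : (y - (1 - x) * a - x * b) / (a' - a) * (a' - a) = y - (1 - x) * a - x * b :=
        div_mul_cancel₀ _ hd.ne'
      obtain ⟨w, hwdef⟩ : ∃ w, w = (y - (1 - x) * a - x * b) / (a' - a) := ⟨_, rfl⟩
      rw [← hwdef] at hw
      have hw0 : 0 ≤ w := by rw [hwdef]; exact div_nonneg (by linarith) hd.le
      have hw1 : w ≤ 1 - x := by rw [hwdef, div_le_iff₀ hd]; linarith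
      exact ⟨1 - x - w, x, w, by linarith, hx0, hw0, by ring, by ring, by linarith⟩

theorem trapezoid_union_right {a b b' : ℝ} (hbb' : b < b') (hb : 0 ≤ b) (ha : 0 ≤ a) :
    trapezoid a b ∪ convexHull ℝ ((({(0, a), (1, b), (1, b')} : Finset (ℝ × ℝ))) : Set (ℝ × ℝ)) =
      trapezoid a b' := by
  have h1 : ((0, a) : ℝ × ℝ) ≠ (1, b) := by simp
  have h2 : ((0, a) : ℝ × ℝ) ≠ (1, b') := by simp
  have h3 : ((1, b) : ℝ × ℝ) ≠ (1, b') := by simp [hbb'.ne]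
  ext ⟨x, y⟩
  rw [Set.mem_union, mem_convexHull_triple h1 h2 h3]
  simp only [trapezoid, Set.mem_ofPred_eq, Prod.smul_mk, Prod.mk_add_mk, smul_eq_mul, Prod.mk.injEq]
  constructor
  · rintro (⟨hx0, hx1, hy0, hy1⟩ | ⟨u, v, w, hu, hv, hw, h, hx, hy⟩)
    · exact ⟨hx0, hx1, hy0, hy1.trans (by nlinarith)⟩
    · obtain rfl : u = 1 - x := by linarith
      obtain rfl : v = x - w := by linarith
      refine ⟨by linarith, by linarith, by rw [← hy]; have := hb.trans hbb'.le; positivity, ?_⟩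
      rw [← hy]
      nlinarith
  · rintro ⟨hx0, hx1, hy0, hy1⟩
    by_cases hy : y ≤ (1 - x) * a + x * b
    · exact Or.inl ⟨hx0, hx1, hy0, hy⟩
    · right
      push Not at hy
      have hd : 0 < b' - b := sub_pos.2 hbb'
      have hw : (y - (1 - x) * a - x * b) / (b' - b) * (b' - b) = y - (1 - x) * a - x * b :=
        div_mul_cancel₀ _ hd.ne'
      obtain ⟨w, hwdef⟩ : ∃ w, w = (y - (1 - x) * a - x * b) / (b' - b) := ⟨_, rfl⟩
      rw [← hwdef] at hw
      have hw0 : 0 ≤ w := by rw [hwdef]; exact div_nonneg (by linarith) hd.le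
      have hw1 : w ≤ x := by rw [hwdef, div_le_iff₀ hd]; linarith
      exact ⟨1 - x, x - w, w, by linarith, by linarith, hw0, by ring, by ring, by linarith⟩

/-- A complex that fills a trapezoid and whose vertices are the first points of the sequence `s`
on the left side and of `t` on the right side. -/
structure IsLadder (s t : ℕ → ℝ) (i j : ℕ) (K : SimplicialComplex ℝ (ℝ × ℝ)) : Prop where
  space : K.space = trapezoid (s i) (t j)
  vertices : ∀ p, p ∈ K.vertices ↔ (∃ r ≤ i, p = (0, s r)) ∨ ∃ r ≤ j, p = (1, t r)

theorem exists_isLadder_zero {s t : ℕ → ℝ} (hs : s 0 = 0) (ht : t 0 = 0) :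
    ∃ K, IsLadder s t 0 0 K := by
  have hne : ((0, 0) : ℝ × ℝ) ≠ (1, 0) := by simp
  have hind : AffineIndependent ℝ ((↑) : ({(0, 0), (1, 0)} : Finset (ℝ × ℝ)) → ℝ × ℝ) := by
    have h1 := (affineIndependent_of_ne ℝ hne).range
    refine h1.mono (s := (({(0, 0), (1, 0)} : Finset (ℝ × ℝ)) : Set (ℝ × ℝ))) ?_
    intro x hx
    simp only [Finset.coe_insert, Finset.coe_singleton, Set.mem_insert_iff,
      Set.mem_singleton_iff] at hx
    rcases hx with rfl | rfl
    · exact ⟨0, rfl⟩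
    · exact ⟨1, rfl⟩
  obtain ⟨K, hKs, hKv, -⟩ := exists_simplex hind ⟨(0, 0), by simp⟩
  refine ⟨K, ?_, ?_⟩
  · rw [hKs, hs, ht, Finset.coe_pair, convexHull_pair]
    ext ⟨x, y⟩
    simp only [trapezoid, Set.mem_ofPred_eq, mul_zero, add_zero]
    constructor
    · rintro ⟨u, v, hu, hv, huv, h⟩
      simp only [Prod.smul_mk, Prod.mk_add_mk, smul_eq_mul, mul_zero, mul_one, zero_add,
        Prod.mk.injEq] at h
      obtain ⟨rfl, rfl⟩ := h
      exact ⟨hv, by linarith, le_rfl, le_rfl⟩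
    · rintro ⟨h1, h2, h3, h4⟩
      refine ⟨1 - x, x, by linarith, h1, by ring, ?_⟩
      ext
      · simp
      · simp; linarith
  · intro p
    rw [hKv]
    simp [hs, ht]

/-! ### Ladders and lattice paths -/

section Count

variable {s t : ℕ → ℝ} {I J : ℕ}

theorem IsLadder.exists_attach {i j : ℕ} {K : SimplicialComplex ℝ (ℝ × ℝ)} (hK : IsLadder s t i j K)
    (hs : ∀ r r', r < r' → r' ≤ I → s r < s r') (ht : ∀ r r', r < r' → r' ≤ J → t r < t r')
    (hs0 : s 0 = 0) (ht0 : t 0 = 0) (hi : i ≤ I) (hj : j ≤ J) {r : ℝ × ℝ}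
    (hr : s i < rungForm (s i) (t j) r) :
    ∃ M : SimplicialComplex ℝ (ℝ × ℝ),
      M.space = trapezoid (s i) (t j) ∪
        convexHull ℝ ((({(0, s i), (1, t j), r} : Finset (ℝ × ℝ))) : Set (ℝ × ℝ)) ∧
      M.vertices = K.vertices ∪ {r} ∧
      (∀ u, u ∈ K.faces ↔ u ∈ M.faces ∧ ∀ v ∈ u, rungForm (s i) (t j) v ≤ s i) ∧
      {(0, s i), (1, t j)} ∈ M.faces := by
  have hsle : ∀ r ≤ i, s r ≤ s i := by
    intro r hr
    rcases hr.eq_or_lt with rfl | h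
    · exact le_rfl
    · exact (hs _ _ h hi).le
  have htle : ∀ r ≤ j, t r ≤ t j := by
    intro r hr
    rcases hr.eq_or_lt with rfl | h
    · exact le_rfl
    · exact (ht _ _ h hj).le
  refine exists_attach_triangle (hs0 ▸ hsle 0 (Nat.zero_le _)) (ht0 ▸ htle 0 (Nat.zero_le _))
    hK.space ?_ ?_ hr
  · intro v hv
    rcases (hK.vertices v).1 hv with ⟨r, hr, rfl⟩ | ⟨r, hr, rfl⟩
    · rw [rungForm_apply]; simpa using hsle r hr
    · rw [rungForm_apply]
      have := htle r hr
      dsimp only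
      linarith
  · intro v hv
    rw [hK.vertices]
    constructor
    · rintro (⟨r, hr, rfl⟩ | ⟨r, hr, rfl⟩)
      · left
        rw [rungForm_apply] at hv
        simp only [mul_zero, add_zero] at hv
        rw [hv]
      · right
        rw [rungForm_apply] at hv
        dsimp only at hv
        rw [show t r = t j by linarith]
    · rintro (rfl | rfl)
      · exact Or.inl ⟨i, le_rfl, rfl⟩
      · exact Or.inr ⟨j, le_rfl, rfl⟩

theorem IsLadder.exists_left {i j : ℕ} (hs : ∀ r r', r < r' → r' ≤ I → s r < s r')
    (ht : ∀ r r', r < r' → r' ≤ J → t r < t r')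
    (hs0 : s 0 = 0) (ht0 : t 0 = 0) (hi : i + 1 ≤ I) (hj : j ≤ J)
    {K : SimplicialComplex ℝ (ℝ × ℝ)} (hK : IsLadder s t i j K) :
    ∃ M, IsLadder s t (i + 1) j M ∧
      (∀ u, u ∈ K.faces ↔ u ∈ M.faces ∧ ∀ v ∈ u, rungForm (s i) (t j) v ≤ s i) ∧
      {(0, s i), (1, t j)} ∈ M.faces := by
  have hlt := hs i (i + 1) (Nat.lt_succ_self i) hi
  have hsi : 0 ≤ s i := by
    rcases Nat.eq_zero_or_pos i with h | h
    · rw [h, hs0]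
    · exact hs0 ▸ (hs 0 i h (by omega)).le
  have htj : 0 ≤ t j := by
    rcases Nat.eq_zero_or_pos j with h | h
    · rw [h, ht0]
    · exact ht0 ▸ (ht 0 j h hj).le
  obtain ⟨M, hMs, hMv, hMf, hMr⟩ := hK.exists_attach hs ht hs0 ht0 (by omega) hj (r := (0, s (i + 1)))
    (by rw [rungForm_apply]; simpa using hlt)
  refine ⟨M, ⟨by rw [hMs, trapezoid_union_left hlt htj hsi], fun p => ?_⟩, hMf, hMr⟩
  rw [hMv, Set.mem_union, hK.vertices, Set.mem_singleton_iff]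
  constructor
  · rintro ((⟨r, hr, rfl⟩ | h) | rfl)
    · exact Or.inl ⟨r, by omega, rfl⟩
    · exact Or.inr h
    · exact Or.inl ⟨i + 1, le_rfl, rfl⟩
  · rintro (⟨r, hr, rfl⟩ | h)
    · rcases Nat.lt_or_ge i r with h | h
      · obtain rfl : r = i + 1 := by omega
        exact Or.inr rfl
      · exact Or.inl (Or.inl ⟨r, h, rfl⟩)
    · exact Or.inl (Or.inr h)

theorem IsLadder.exists_right {i j : ℕ} (hs : ∀ r r', r < r' → r' ≤ I → s r < s r')
    (ht : ∀ r r', r < r' → r' ≤ J → t r < t r')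
    (hs0 : s 0 = 0) (ht0 : t 0 = 0) (hi : i ≤ I) (hj : j + 1 ≤ J)
    {K : SimplicialComplex ℝ (ℝ × ℝ)} (hK : IsLadder s t i j K) :
    ∃ M, IsLadder s t i (j + 1) M ∧
      (∀ u, u ∈ K.faces ↔ u ∈ M.faces ∧ ∀ v ∈ u, rungForm (s i) (t j) v ≤ s i) ∧
      {(0, s i), (1, t j)} ∈ M.faces := by
  have hlt := ht j (j + 1) (Nat.lt_succ_self j) hj
  have hsi : 0 ≤ s i := by
    rcases Nat.eq_zero_or_pos i with h | h
    · rw [h, hs0]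
    · exact hs0 ▸ (hs 0 i h (by omega)).le
  have htj : 0 ≤ t j := by
    rcases Nat.eq_zero_or_pos j with h | h
    · rw [h, ht0]
    · exact ht0 ▸ (ht 0 j h (by omega)).le
  obtain ⟨M, hMs, hMv, hMf, hMr⟩ := hK.exists_attach hs ht hs0 ht0 hi (by omega) (r := (1, t (j + 1)))
    (by rw [rungForm_apply]; dsimp only; linarith)
  refine ⟨M, ⟨by rw [hMs, trapezoid_union_right hlt htj hsi], fun p => ?_⟩, hMf, hMr⟩
  rw [hMv, Set.mem_union, hK.vertices, Set.mem_singleton_iff]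
  constructor
  · rintro ((h | ⟨r, hr, rfl⟩) | rfl)
    · exact Or.inl h
    · exact Or.inr ⟨r, by omega, rfl⟩
    · exact Or.inr ⟨j + 1, le_rfl, rfl⟩
  · rintro (h | ⟨r, hr, rfl⟩)
    · exact Or.inl (Or.inl h)
    · rcases Nat.lt_or_ge j r with h | h
      · obtain rfl : r = j + 1 := by omega
        exact Or.inr rfl
      · exact Or.inl (Or.inr ⟨r, h, rfl⟩)

/-- The two rungs meet at abscissa `θ` but share no vertex. This separates the ladders whose last
step was on the left from those whose last step was on the right. -/
theorem not_crossing_rungs {M : SimplicialComplex ℝ (ℝ × ℝ)} {a a' b b' : ℝ} (ha : a < a')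
    (hb : b < b') (h1 : {(0, a), (1, b')} ∈ M.faces) (h2 : {(0, a'), (1, b)} ∈ M.faces) : False := by
  have hd : 0 < a' - a + (b' - b) := by linarith
  obtain ⟨θ, hθ⟩ : ∃ θ, θ = (a' - a) / (a' - a + (b' - b)) := ⟨_, rfl⟩
  have hθ' : θ * (a' - a + (b' - b)) = a' - a := by rw [hθ, div_mul_cancel₀ _ hd.ne']
  have hθ0 : 0 ≤ θ := by rw [hθ]; exact div_nonneg (by linarith) hd.le
  have hθ1 : θ ≤ 1 := by rw [hθ, div_le_one hd]; linarith
  have hx : ((θ, (1 - θ) * a + θ * b') : ℝ × ℝ) ∈ convexHull ℝ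
      ((({(0, a), (1, b')} : Finset (ℝ × ℝ))) : Set (ℝ × ℝ)) := by
    rw [Finset.coe_pair, convexHull_pair]
    exact ⟨1 - θ, θ, by linarith, hθ0, by ring, by simp⟩
  have hx' : ((θ, (1 - θ) * a + θ * b') : ℝ × ℝ) ∈ convexHull ℝ
      ((({(0, a'), (1, b)} : Finset (ℝ × ℝ))) : Set (ℝ × ℝ)) := by
    rw [Finset.coe_pair, convexHull_pair]
    refine ⟨1 - θ, θ, by linarith, hθ0, by ring, ?_⟩
    ext
    · simp
    · simp; linarith
  have h := M.inter_subset_convexHull h1 h2 ⟨hx, hx'⟩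
  have hemp : ((({(0, a), (1, b')} : Finset (ℝ × ℝ))) : Set (ℝ × ℝ)) ∩
      (({(0, a'), (1, b)} : Finset (ℝ × ℝ)) : Set (ℝ × ℝ)) = ∅ := by
    ext x
    simp only [Finset.coe_pair, Set.mem_inter_iff, Set.mem_insert_iff, Set.mem_singleton_iff,
      Set.mem_empty_iff_false, iff_false, not_and, not_or]
    rintro (rfl | rfl)
    · simp [ha.ne]
    · simp [hb.ne']
  rw [hemp, convexHull_empty] at h
  exact h

/-- The number of ladders is at least the number of lattice paths. -/
theorem exists_ladders (hs : ∀ r r', r < r' → r' ≤ I → s r < s r')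
    (ht : ∀ r r', r < r' → r' ≤ J → t r < t r') (hs0 : s 0 = 0) (ht0 : t 0 = 0) {i j : ℕ}
    (hi : i ≤ I) (hj : j ≤ J) :
    ∃ F : Finset (SimplicialComplex ℝ (ℝ × ℝ)), F.card = (i + j).choose i ∧
      ∀ K ∈ F, IsLadder s t i j K := by
  classical
  have left : ∀ i j, i + 1 ≤ I → j ≤ J → ∀ K : SimplicialComplex ℝ (ℝ × ℝ), ∃ M,
      IsLadder s t i j K → IsLadder s t (i + 1) j M ∧
      (∀ u, u ∈ K.faces ↔ u ∈ M.faces ∧ ∀ v ∈ u, rungForm (s i) (t j) v ≤ s i) ∧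
      {(0, s i), (1, t j)} ∈ M.faces := by
    intro i j hi hj K
    by_cases hK : IsLadder s t i j K
    · obtain ⟨M, hM⟩ := IsLadder.exists_left hs ht hs0 ht0 hi hj hK
      exact ⟨M, fun _ => hM⟩
    · exact ⟨K, fun h => absurd h hK⟩
  have right : ∀ i j, i ≤ I → j + 1 ≤ J → ∀ K : SimplicialComplex ℝ (ℝ × ℝ), ∃ M,
      IsLadder s t i j K → IsLadder s t i (j + 1) M ∧
      (∀ u, u ∈ K.faces ↔ u ∈ M.faces ∧ ∀ v ∈ u, rungForm (s i) (t j) v ≤ s i) ∧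
      {(0, s i), (1, t j)} ∈ M.faces := by
    intro i j hi hj K
    by_cases hK : IsLadder s t i j K
    · obtain ⟨M, hM⟩ := IsLadder.exists_right hs ht hs0 ht0 hi hj hK
      exact ⟨M, fun _ => hM⟩
    · exact ⟨K, fun h => absurd h hK⟩
  -- Attaching a triangle is injective, since the old ladder consists of the faces not above its top
  -- rung.
  have image : ∀ (i j i' j' : ℕ) (F : Finset (SimplicialComplex ℝ (ℝ × ℝ)))
      (G : SimplicialComplex ℝ (ℝ × ℝ) → SimplicialComplex ℝ (ℝ × ℝ)),
      (∀ K ∈ F, IsLadder s t i j K) →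
      (∀ K, IsLadder s t i j K → IsLadder s t i' j' (G K) ∧
        (∀ u, u ∈ K.faces ↔ u ∈ (G K).faces ∧ ∀ v ∈ u, rungForm (s i) (t j) v ≤ s i) ∧
        {(0, s i), (1, t j)} ∈ (G K).faces) →
      (F.image G).card = F.card ∧ ∀ M ∈ F.image G, IsLadder s t i' j' M ∧
        {(0, s i), (1, t j)} ∈ M.faces := by
    intro i j i' j' F G hF hG
    constructor
    · refine Finset.card_image_of_injOn fun K hK L hL hKL => ?_
      refine SimplicialComplex.ext (Set.ext fun u => ?_)
      have hKL : G K = G L := hKL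
      rw [(hG K (hF K hK)).2.1 u, (hG L (hF L hL)).2.1 u, hKL]
    · intro M hM
      obtain ⟨K, hK, rfl⟩ := Finset.mem_image.1 hM
      exact ⟨(hG K (hF K hK)).1, (hG K (hF K hK)).2.2⟩
  obtain ⟨k, hk⟩ : ∃ k, k = i + j := ⟨_, rfl⟩
  induction k generalizing i j with
  | zero =>
    obtain ⟨rfl, rfl⟩ : i = 0 ∧ j = 0 := by omega
    obtain ⟨K, hK⟩ := exists_isLadder_zero hs0 ht0
    exact ⟨{K}, by simp, by simpa using hK⟩
  | succ k ih =>
    rcases Nat.eq_zero_or_pos i with rfl | hi0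
    · obtain ⟨j, rfl⟩ : ∃ j', j = j' + 1 := ⟨j - 1, by omega⟩
      obtain ⟨F, hFc, hF⟩ := ih hi (by omega : j ≤ J) (by omega)
      choose G hG using right 0 j hi hj
      obtain ⟨h1, h2⟩ := image _ _ _ _ F G hF hG
      exact ⟨F.image G, by rw [h1, hFc]; simp, fun M hM => (h2 M hM).1⟩
    · obtain ⟨i, rfl⟩ : ∃ i', i = i' + 1 := ⟨i - 1, by omega⟩
      obtain ⟨F, hFc, hF⟩ := ih (by omega : i ≤ I) hj (by omega)
      choose G hG using left i j hi hj
      obtain ⟨h1, h2⟩ := image _ _ _ _ F G hF hG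
      rcases Nat.eq_zero_or_pos j with rfl | hj0
      · exact ⟨F.image G, by rw [h1, hFc]; simp, fun M hM => (h2 M hM).1⟩
      · obtain ⟨j, rfl⟩ : ∃ j', j = j' + 1 := ⟨j - 1, by omega⟩
        obtain ⟨F', hFc', hF'⟩ := ih hi (by omega : j ≤ J) (by omega)
        choose G' hG' using right (i + 1) j hi hj
        obtain ⟨h1', h2'⟩ := image _ _ _ _ F' G' hF' hG'
        -- Pascal's rule: the last step is left or right, and the top rungs of the two previous
        -- ladders cross, so the families are disjoint.
        refine ⟨F.image G ∪ F'.image G', ?_, fun M hM => ?_⟩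
        · rw [Finset.card_union_of_disjoint, h1, h1', hFc, hFc',
            show i + 1 + (j + 1) = (i + 1 + j) + 1 by ring, Nat.choose_succ_succ,
            show i + (j + 1) = i + 1 + j by ring]
          rw [Finset.disjoint_left]
          intro M hM hM'
          exact not_crossing_rungs (hs i (i + 1) (Nat.lt_succ_self i) hi)
            (ht j (j + 1) (Nat.lt_succ_self j) hj) (h2 M hM).2 (h2' M hM').2
        · rcases Finset.mem_union.1 hM with h | h
          · exact (h2 M h).1
          · exact (h2' M h).1

end Count

/-- There are many triangulations of a strip of width one with given vertices on both sides. -/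
theorem exists_strips {n : ℕ} {S T : Finset ℕ} (hS : ∀ y ∈ S, y ≤ n) (hT : ∀ y ∈ T, y ≤ n)
    (hS0 : 0 ∈ S) (hT0 : 0 ∈ T) (hSn : n ∈ S) (hTn : n ∈ T) :
    ∃ F : Finset (SimplicialComplex ℝ (ℝ × ℝ)),
      F.card = (S.card - 1 + (T.card - 1)).choose (S.card - 1) ∧
      ∀ K ∈ F, K.space = latticeRectangle 1 n ∧ ∀ p, p ∈ K.vertices ↔
        (∃ y ∈ S, p = ((0 : ℝ), (y : ℝ))) ∨ ∃ y ∈ T, p = ((1 : ℝ), (y : ℝ)) := by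
  -- The increasing enumeration of `U`; with index starting at zero its last term has index `U.card
  -- - 1`.
  have enum : ∀ U : Finset ℕ, (∀ y ∈ U, y ≤ n) → 0 ∈ U → n ∈ U → ∃ u : ℕ → ℝ,
      (∀ r r', r < r' → r' ≤ U.card - 1 → u r < u r') ∧ u 0 = 0 ∧ u (U.card - 1) = n ∧
      ∀ x : ℝ, (∃ y ∈ U, x = y) ↔ ∃ r ≤ U.card - 1, x = u r := by
    intro U hU h0 hn
    have hfin : (Set.ofPred fun y => y ∈ U).Finite := U.finite_toSet
    have hcard : hfin.toFinset.card = U.card := by congr 1; ext y; simp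
    have hpos : 0 < U.card := Finset.card_pos.2 ⟨0, h0⟩
    have hmono := Nat.nth_strictMonoOn hfin
    have himg := Nat.image_nth_Iio_card hfin
    rw [hcard] at hmono himg
    have hrange : ∀ y, y ∈ U ↔ ∃ r ≤ U.card - 1, Nat.nth (fun y => y ∈ U) r = y := by
      intro y
      have h := Set.ext_iff.1 himg y
      rw [Set.mem_ofPred_eq] at h
      rw [← h]
      constructor
      · rintro ⟨r, hr, rfl⟩
        exact ⟨r, by rw [Set.mem_Iio] at hr; omega, rfl⟩
      · rintro ⟨r, hr, rfl⟩
        exact ⟨r, by rw [Set.mem_Iio]; omega, rfl⟩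
    have hlt : ∀ r r', r < r' → r' ≤ U.card - 1 →
        Nat.nth (fun y => y ∈ U) r < Nat.nth (fun y => y ∈ U) r' := fun r r' hrr' hr' =>
      hmono (by rw [Set.mem_Iio]; omega) (by rw [Set.mem_Iio]; omega) hrr'
    have hle : ∀ r r', r ≤ r' → r' ≤ U.card - 1 →
        Nat.nth (fun y => y ∈ U) r ≤ Nat.nth (fun y => y ∈ U) r' := fun r r' hrr' hr' => by
      rcases hrr'.eq_or_lt with rfl | h
      · exact le_rfl
      · exact (hlt r r' h hr').le
    refine ⟨fun r => Nat.nth (fun y => y ∈ U) r, ?_, ?_, ?_, ?_⟩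
    · intro r r' h h'
      exact Nat.cast_lt.2 (hlt r r' h h')
    · obtain ⟨r, hr, hr0⟩ := (hrange 0).1 h0
      have := hle 0 r (Nat.zero_le _) hr
      rw [hr0] at this
      exact Nat.cast_eq_zero.2 (Nat.le_zero.1 this)
    · obtain ⟨r, hr, hrn⟩ := (hrange n).1 hn
      have h1 := hle r _ hr le_rfl
      rw [hrn] at h1
      have h2 := hU _ ((hrange _).2 ⟨_, le_rfl, rfl⟩)
      exact congrArg Nat.cast (le_antisymm h2 h1)
    · intro x
      constructor
      · rintro ⟨y, hy, rfl⟩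
        obtain ⟨r, hr, h⟩ := (hrange y).1 hy
        exact ⟨r, hr, congrArg Nat.cast h.symm⟩
      · rintro ⟨r, hr, rfl⟩
        exact ⟨_, (hrange _).2 ⟨r, hr, rfl⟩, rfl⟩
  obtain ⟨s, hs, hs0, hsn, hsS⟩ := enum S hS hS0 hSn
  obtain ⟨t, ht, ht0, htn, htT⟩ := enum T hT hT0 hTn
  obtain ⟨F, hFc, hF⟩ := exists_ladders hs ht hs0 ht0 le_rfl le_rfl
  refine ⟨F, hFc, fun K hK => ⟨?_, fun p => ?_⟩⟩
  · rw [(hF K hK).space, hsn, htn]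
    ext ⟨x, y⟩
    simp only [trapezoid, latticeRectangle, Set.mem_ofPred_eq, Set.mem_prod, Set.mem_Icc,
      Nat.cast_one]
    rw [show (1 - x) * (n : ℝ) + x * n = n by ring]
    tauto
  · rw [(hF K hK).vertices]
    have aux : ∀ (e : ℝ) (U : Finset ℕ) (u : ℕ → ℝ),
        (∀ x : ℝ, (∃ y ∈ U, x = y) ↔ ∃ r ≤ U.card - 1, x = u r) →
        ((∃ r ≤ U.card - 1, p = (e, u r)) ↔ ∃ y ∈ U, p = (e, (y : ℝ))) := by
      intro e U u h
      have h' := h p.2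
      constructor
      · rintro ⟨r, hr, hp⟩
        obtain ⟨y, hy, hpy⟩ := h'.2 ⟨r, hr, by rw [hp]⟩
        exact ⟨y, hy, by rw [← hpy, hp]⟩
      · rintro ⟨y, hy, hp⟩
        obtain ⟨r, hr, hpr⟩ := h'.1 ⟨y, hy, by rw [hp]⟩
        exact ⟨r, hr, by rw [← hpr, hp]⟩
    rw [aux 0 S s hsS, aux 1 T t htT]

end Ladders

/-! ### Vertices on the sides of a rectangle -/

section Sides

open Geometry Geometry.SimplicialComplex

theorem exists_nat_of_mem_vertices {m n : ℕ} {K : SimplicialComplex ℝ (ℝ × ℝ)}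
    (hK : K ∈ latticeTriangulations m n) {v : ℝ × ℝ} (hv : v ∈ K.vertices) :
    ∃ a b : ℕ, a ≤ m ∧ b ≤ n ∧ v = ((a : ℝ), (b : ℝ)) := by
  have hr : v ∈ latticeRectangle m n := hK.1 ▸ K.vertices_subset_space hv
  obtain ⟨a, b, rfl⟩ := hK.2 v hv
  obtain ⟨⟨h1, h2⟩, h3, h4⟩ := hr
  dsimp only at h1 h2 h3 h4
  have h1 : 0 ≤ a := by exact_mod_cast h1
  have h3 : 0 ≤ b := by exact_mod_cast h3
  have h2 : a ≤ m := by exact_mod_cast h2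
  have h4 : b ≤ n := by exact_mod_cast h4
  lift a to ℕ using h1
  lift b to ℕ using h3
  exact ⟨a, b, by exact_mod_cast h2, by exact_mod_cast h4, by simp⟩

/-- An extreme point of the whole space is extreme in any simplex containing it. This makes the
corners of the rectangle vertices. -/
theorem mem_vertices_of_mem_extremePoints {K : SimplicialComplex ℝ (ℝ × ℝ)} {x : ℝ × ℝ}
    (hx : x ∈ K.space.extremePoints ℝ) : x ∈ K.vertices := by
  obtain ⟨s, hs, hxs⟩ := mem_space_iff.1 hx.1
  have h := inter_extremePoints_subset_extremePoints_of_subset (𝕜 := ℝ)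
    (K.convexHull_subset_space hs) ⟨hxs, hx⟩
  exact mem_vertices_of_mem hs (extremePoints_convexHull_subset h)

theorem mem_extremePoints_Icc {a b x : ℝ} (hab : a ≤ b) (hx : x = a ∨ x = b) :
    x ∈ (Set.Icc a b).extremePoints ℝ := by
  refine ⟨by rcases hx with rfl | rfl <;> simp [hab], ?_⟩
  rintro y ⟨hy1, hy2⟩ z ⟨hz1, hz2⟩ ⟨u, v, hu, hv, huv, h⟩
  rw [smul_eq_mul, smul_eq_mul] at h
  obtain rfl : u = 1 - v := by linarith
  rcases hx with rfl | rfl <;> nlinarith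

theorem corner_mem_vertices {m n : ℕ} {K : SimplicialComplex ℝ (ℝ × ℝ)}
    (hK : K ∈ latticeTriangulations m n) {x y : ℝ} (hx : x = 0 ∨ x = m) (hy : y = 0 ∨ y = n) :
    (x, y) ∈ K.vertices := by
  apply mem_vertices_of_mem_extremePoints
  rw [hK.1, latticeRectangle, extremePoints_prod]
  exact ⟨mem_extremePoints_Icc (Nat.cast_nonneg m) hx, mem_extremePoints_Icc (Nat.cast_nonneg n) hy⟩

open Classical in
/-- The heights of the vertices of a complex on the vertical line of abscissa `x`. -/
noncomputable def sideHeights (K : SimplicialComplex ℝ (ℝ × ℝ)) (x n : ℕ) : Finset ℕ :=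
  (Finset.range (n + 1)).filter fun y => ((x : ℝ), (y : ℝ)) ∈ K.vertices

theorem mem_sideHeights {m n : ℕ} {K : SimplicialComplex ℝ (ℝ × ℝ)}
    (hK : K ∈ latticeTriangulations m n) {x y : ℕ} :
    y ∈ sideHeights K x n ↔ ((x : ℝ), (y : ℝ)) ∈ K.vertices := by
  classical
  rw [sideHeights, Finset.mem_filter, Finset.mem_range, and_iff_right_iff_imp]
  intro h
  obtain ⟨a, b, -, hb, hab⟩ := exists_nat_of_mem_vertices hK h
  have : y = b := Nat.cast_injective (R := ℝ) (Prod.ext_iff.1 hab).2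
  omega

theorem le_of_mem_sideHeights {K : SimplicialComplex ℝ (ℝ × ℝ)} {x n y : ℕ}
    (hy : y ∈ sideHeights K x n) : y ≤ n := by
  classical
  have := Finset.mem_range.1 (Finset.mem_filter.1 hy).1
  omega

end Sides

/-! ### Joining rectangles -/

section Join

open Geometry Geometry.SimplicialComplex

/-- Horizontal translation of the plane. -/
noncomputable def shiftEquiv (m : ℕ) : (ℝ × ℝ) ≃ᵃ[ℝ] (ℝ × ℝ) :=
  AffineEquiv.constVAdd ℝ (ℝ × ℝ) ((m : ℝ), (0 : ℝ))

theorem shiftEquiv_apply (m : ℕ) (p : ℝ × ℝ) : shiftEquiv m p = (m + p.1, p.2) := by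
  ext <;> simp [shiftEquiv]

theorem mem_image_shiftEquiv {m : ℕ} {A : Set (ℝ × ℝ)} {p : ℝ × ℝ} :
    p ∈ shiftEquiv m '' A ↔ (p.1 - m, p.2) ∈ A := by
  constructor
  · rintro ⟨q, hq, rfl⟩
    rw [shiftEquiv_apply]
    simpa using hq
  · intro h
    exact ⟨_, h, by rw [shiftEquiv_apply]; simp⟩

/-- Triangulations of adjacent rectangles with the same vertices on the common side can be
joined. -/
theorem exists_join {m₁ m₂ n : ℕ} {K₁ K₂ : SimplicialComplex ℝ (ℝ × ℝ)}
    (h₁ : K₁ ∈ latticeTriangulations m₁ n) (h₂ : K₂ ∈ latticeTriangulations m₂ n)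
    (hv : ∀ y : ℕ, ((m₁ : ℝ), (y : ℝ)) ∈ K₁.vertices ↔ ((0 : ℝ), (y : ℝ)) ∈ K₂.vertices) :
    ∃ M ∈ latticeTriangulations (m₁ + m₂) n,
      (∀ s, s ∈ K₁.faces ↔ s ∈ M.faces ∧ ∀ v ∈ s, v.1 ≤ m₁) ∧
      (∀ s : Finset (ℝ × ℝ), s ∈ K₂.faces ↔
        s.map (shiftEquiv m₁).toEquiv.toEmbedding ∈ M.faces ∧ ∀ v ∈ s, 0 ≤ v.1) ∧
      M.vertices = K₁.vertices ∪ shiftEquiv m₁ '' K₂.vertices := by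
  have hl : ∀ v ∈ K₁.vertices, v.1 ≤ m₁ := by
    intro v hv
    obtain ⟨a, b, ha, -, rfl⟩ := exists_nat_of_mem_vertices h₁ hv
    exact Nat.cast_le.2 ha
  have hr₂ : ∀ v ∈ K₂.vertices, 0 ≤ v.1 := by
    intro v hv
    obtain ⟨a, b, -, -, rfl⟩ := exists_nat_of_mem_vertices h₂ hv
    exact Nat.cast_nonneg a
  have hr : ∀ v ∈ (K₂.mapEquiv (shiftEquiv m₁)).vertices, (m₁ : ℝ) ≤ v.1 := by
    intro v hv
    rw [vertices_mapEquiv, mem_image_shiftEquiv] at hv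
    have := hr₂ _ hv
    dsimp only at this
    linarith
  have hline : ∀ v : ℝ × ℝ, v.1 = m₁ →
      (v ∈ K₁.vertices ↔ v ∈ (K₂.mapEquiv (shiftEquiv m₁)).vertices) := by
    rintro ⟨x, y⟩ rfl
    rw [vertices_mapEquiv, mem_image_shiftEquiv, sub_self]
    constructor
    · intro h
      obtain ⟨a, b, -, -, hab⟩ := exists_nat_of_mem_vertices h₁ h
      obtain rfl : y = b := (Prod.ext_iff.1 hab).2
      exact (hv b).1 h
    · intro h
      obtain ⟨a, b, -, -, hab⟩ := exists_nat_of_mem_vertices h₂ h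
      obtain rfl : y = b := (Prod.ext_iff.1 hab).2
      exact (hv b).2 h
  obtain ⟨M, hM⟩ := exists_glue (l := LinearMap.fst ℝ ℝ ℝ) (m := LinearMap.snd ℝ ℝ ℝ)
    (fun v h1 h2 => Prod.ext h1 h2) hl hr hline
  have hspace : (K₂.mapEquiv (shiftEquiv m₁)).space =
      Set.Icc (m₁ : ℝ) ((m₁ + m₂ : ℕ) : ℝ) ×ˢ Set.Icc (0 : ℝ) (n : ℝ) := by
    rw [space_mapEquiv, h₂.1]
    ext p
    rw [mem_image_shiftEquiv]
    simp only [latticeRectangle, Set.mem_prod, Set.mem_Icc, Nat.cast_add]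
    constructor
    · rintro ⟨⟨a, b⟩, c⟩
      exact ⟨⟨by linarith, by linarith⟩, c⟩
    · rintro ⟨⟨a, b⟩, c⟩
      exact ⟨⟨by linarith, by linarith⟩, c⟩
  have hside : ∀ (s : Finset (ℝ × ℝ)), (∀ v ∈ s, v.1 = (m₁ : ℝ)) →
      ∀ x ∈ convexHull ℝ (s : Set (ℝ × ℝ)), x.1 = m₁ := fun s hs x hx =>
    convexHull_min (t := {x : ℝ × ℝ | x.1 = m₁}) hs
      (convex_hyperplane (LinearMap.fst ℝ ℝ ℝ).isLinear _) hx
  refine ⟨M, ⟨?_, ?_⟩, ?_, ?_, ?_⟩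
  · rw [space_of_faces_union hM, hspace, h₁.1, latticeRectangle, latticeRectangle,
      ← Set.union_prod, Set.Icc_union_Icc_eq_Icc (Nat.cast_nonneg _) (Nat.cast_le.2 (by omega))]
  · rw [vertices_of_faces_union hM, vertices_mapEquiv]
    rintro v (hv | hv)
    · exact h₁.2 v hv
    · rw [mem_image_shiftEquiv] at hv
      obtain ⟨a, b, h⟩ := h₂.2 _ hv
      refine ⟨a + m₁, b, ?_⟩
      rw [Prod.mk.injEq] at h
      refine Prod.ext ?_ h.2
      push_cast
      linarith [h.1]
  · refine mem_faces_left_iff hM (l := Prod.fst) hl hr fun s hs hsl x hx => ?_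
    have hx1 := hside s hsl x hx
    have hx2 := (K₂.mapEquiv (shiftEquiv m₁)).convexHull_subset_space hs hx
    rw [hspace] at hx2
    rw [h₁.1]
    exact ⟨⟨by rw [hx1]; exact Nat.cast_nonneg _, hx1.le⟩, hx2.2⟩
  · intro s
    -- The right part is recovered in the same way as the left one after reversing the abscissa.
    rw [← mem_faces_mapEquiv (e := shiftEquiv m₁), mem_faces_left_iff (l := fun v => -v.1)
      (c := -(m₁ : ℝ)) (L := K₁) (by rw [hM, Set.union_comm]) (fun v hv => neg_le_neg (hr v hv))
      (fun v hv => neg_le_neg (hl v hv))]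
    · refine and_congr_right fun _ => ?_
      rw [Finset.forall_mem_map]
      refine forall₂_congr fun v _ => ?_
      change -(shiftEquiv m₁ v).1 ≤ _ ↔ _
      rw [shiftEquiv_apply]
      simp
    · intro s hs hsl x hx
      have hx1 := hside s (fun v hv => neg_inj.1 (hsl v hv)) x hx
      have hx2 := K₁.convexHull_subset_space hs hx
      rw [h₁.1] at hx2
      rw [hspace]
      exact ⟨⟨hx1.ge, by rw [hx1]; exact Nat.cast_le.2 (by omega)⟩, hx2.2⟩
  · rw [vertices_of_faces_union hM, vertices_mapEquiv]

theorem strip_mem_latticeTriangulations {n : ℕ} {S T : Finset ℕ} {K : SimplicialComplex ℝ (ℝ × ℝ)}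
    (hK : K.space = latticeRectangle 1 n) (hv : ∀ p, p ∈ K.vertices ↔
      (∃ y ∈ S, p = ((0 : ℝ), (y : ℝ))) ∨ ∃ y ∈ T, p = ((1 : ℝ), (y : ℝ))) :
    K ∈ latticeTriangulations 1 n := by
  refine ⟨hK, fun v hvK => ?_⟩
  rcases (hv v).1 hvK with ⟨y, -, rfl⟩ | ⟨y, -, rfl⟩
  · exact ⟨0, y, by simp⟩
  · exact ⟨1, y, by simp⟩

theorem left_mem_strip_iff {S T : Finset ℕ} {K : SimplicialComplex ℝ (ℝ × ℝ)} (hv : ∀ p,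
    p ∈ K.vertices ↔ (∃ y ∈ S, p = ((0 : ℝ), (y : ℝ))) ∨ ∃ y ∈ T, p = ((1 : ℝ), (y : ℝ))) (y : ℕ) :
    ((0 : ℝ), (y : ℝ)) ∈ K.vertices ↔ y ∈ S := by
  rw [hv]; simp

theorem right_mem_strip_iff {S T : Finset ℕ} {K : SimplicialComplex ℝ (ℝ × ℝ)} (hv : ∀ p,
    p ∈ K.vertices ↔ (∃ y ∈ S, p = ((0 : ℝ), (y : ℝ))) ∨ ∃ y ∈ T, p = ((1 : ℝ), (y : ℝ))) (y : ℕ) :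
    ((1 : ℝ), (y : ℝ)) ∈ K.vertices ↔ y ∈ T := by
  rw [hv]; simp

/-- Any two triangulations can be joined by a strip of width one. -/
theorem exists_bridge {m₁ m₂ n : ℕ} {K₁ K₂ : SimplicialComplex ℝ (ℝ × ℝ)}
    (h₁ : K₁ ∈ latticeTriangulations m₁ n) (h₂ : K₂ ∈ latticeTriangulations m₂ n) :
    ∃ M ∈ latticeTriangulations (m₁ + 1 + m₂) n,
      (∀ s, s ∈ K₁.faces ↔ s ∈ M.faces ∧ ∀ v ∈ s, v.1 ≤ m₁) ∧
      (∀ s : Finset (ℝ × ℝ), s ∈ K₂.faces ↔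
        s.map (shiftEquiv (m₁ + 1)).toEquiv.toEmbedding ∈ M.faces ∧ ∀ v ∈ s, 0 ≤ v.1) := by
  -- The sides of the strip carry exactly the vertices that `K₁` and `K₂` have there. The corners
  -- are always among them, and the binomial coefficient counting such strips is positive.
  obtain ⟨F, hFc, hF⟩ := exists_strips (S := sideHeights K₁ m₁ n) (T := sideHeights K₂ 0 n)
    (fun y => le_of_mem_sideHeights) (fun y => le_of_mem_sideHeights)
    ((mem_sideHeights h₁).2 (corner_mem_vertices h₁ (Or.inr rfl) (Or.inl Nat.cast_zero)))
    ((mem_sideHeights h₂).2 (corner_mem_vertices h₂ (Or.inl Nat.cast_zero) (Or.inl Nat.cast_zero)))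
    ((mem_sideHeights h₁).2 (corner_mem_vertices h₁ (Or.inr rfl) (Or.inr rfl)))
    ((mem_sideHeights h₂).2 (corner_mem_vertices h₂ (Or.inl Nat.cast_zero) (Or.inr rfl)))
  obtain ⟨P, hP⟩ := Finset.card_pos.1 (hFc ▸ Nat.choose_pos (Nat.le_add_right _ _))
  obtain ⟨hPs, hPv⟩ := hF P hP
  have hPT := strip_mem_latticeTriangulations hPs hPv
  obtain ⟨M₁, hM₁, hM₁K, -, hM₁v⟩ := exists_join h₁ hPT fun y => by
    rw [left_mem_strip_iff hPv, mem_sideHeights h₁]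
  obtain ⟨M, hM, hML, hMR, -⟩ := exists_join hM₁ h₂ fun y => by
    rw [hM₁v, Set.mem_union, mem_image_shiftEquiv]
    have h1 : (((m₁ + 1 : ℕ) : ℝ), (y : ℝ)) ∉ K₁.vertices := by
      intro h
      obtain ⟨a, b, ha, -, hab⟩ := exists_nat_of_mem_vertices h₁ h
      have : m₁ + 1 = a := Nat.cast_injective (R := ℝ) (Prod.ext_iff.1 hab).1
      omega
    rw [or_iff_right h1]
    simp only [Nat.cast_add, Nat.cast_one, add_sub_cancel_left]
    rw [right_mem_strip_iff hPv, mem_sideHeights h₂, Nat.cast_zero]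
  refine ⟨M, hM, fun s => ?_, hMR⟩
  rw [hM₁K, hML, and_assoc, and_congr_right_iff]
  intro _
  rw [and_iff_right_iff_imp]
  intro h v hv
  have := h v hv
  push_cast
  linarith

end Join

/-! ### Supermultiplicativity, symmetry and monotonicity -/

section Counting

open Geometry Geometry.SimplicialComplex

/-- Bridging is injective because both triangulations can be read off from the result. The extra 1
is the width of the bridge. -/
theorem numLatticeTriangulations_mul_le (m₁ m₂ n : ℕ) :
    numLatticeTriangulations m₁ n * numLatticeTriangulations m₂ n ≤
      numLatticeTriangulations (m₁ + 1 + m₂) n := by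
  have h : ∀ p : SimplicialComplex ℝ (ℝ × ℝ) × SimplicialComplex ℝ (ℝ × ℝ), ∃ M,
      p ∈ latticeTriangulations m₁ n ×ˢ latticeTriangulations m₂ n →
      M ∈ latticeTriangulations (m₁ + 1 + m₂) n ∧
      (∀ s, s ∈ p.1.faces ↔ s ∈ M.faces ∧ ∀ v ∈ s, v.1 ≤ m₁) ∧
      (∀ s : Finset (ℝ × ℝ), s ∈ p.2.faces ↔
        s.map (shiftEquiv (m₁ + 1)).toEquiv.toEmbedding ∈ M.faces ∧ ∀ v ∈ s, 0 ≤ v.1) := by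
    intro p
    by_cases hp : p ∈ latticeTriangulations m₁ n ×ˢ latticeTriangulations m₂ n
    · obtain ⟨M, hM⟩ := exists_bridge hp.1 hp.2
      exact ⟨M, fun _ => hM⟩
    · exact ⟨p.1, fun h => absurd h hp⟩
  choose g hg using h
  rw [numLatticeTriangulations, numLatticeTriangulations, ← Set.ncard_prod]
  refine Set.ncard_le_ncard_of_injOn g (fun p hp => (hg p hp).1) ?_
    (latticeTriangulations_finite _ _)
  intro p hp q hq hpq
  refine Prod.ext (SimplicialComplex.ext (Set.ext fun s => ?_))
    (SimplicialComplex.ext (Set.ext fun s => ?_))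
  · rw [(hg p hp).2.1, (hg q hq).2.1, hpq]
  · rw [(hg p hp).2.2, (hg q hq).2.2, hpq]

theorem numLatticeTriangulations_le_swap (m n : ℕ) :
    numLatticeTriangulations m n ≤ numLatticeTriangulations n m := by
  let e : (ℝ × ℝ) ≃ᵃ[ℝ] (ℝ × ℝ) := (LinearEquiv.prodComm ℝ ℝ ℝ).toAffineEquiv
  have he : ∀ (A : Set (ℝ × ℝ)) (p : ℝ × ℝ), p ∈ e '' A ↔ p.swap ∈ A := by
    intro A p
    constructor
    · rintro ⟨q, hq, rfl⟩
      exact hq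
    · intro h
      exact ⟨p.swap, h, rfl⟩
  refine Set.ncard_le_ncard_of_injOn (fun K => K.mapEquiv e) ?_ (mapEquiv_injective e).injOn
    (latticeTriangulations_finite _ _)
  rintro K ⟨hKs, hKv⟩
  refine ⟨?_, fun v hv => ?_⟩
  · rw [space_mapEquiv, hKs]
    ext p
    rw [he]
    exact and_comm
  · rw [vertices_mapEquiv, he] at hv
    obtain ⟨a, b, h⟩ := hKv _ hv
    exact ⟨b, a, by rw [← Prod.swap_swap v, h]; rfl⟩

theorem numLatticeTriangulations_comm (m n : ℕ) :
    numLatticeTriangulations m n = numLatticeTriangulations n m :=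
  (numLatticeTriangulations_le_swap m n).antisymm (numLatticeTriangulations_le_swap n m)

/-- A rectangle of width zero is a segment, or a point for `n = 0`. Bridging from it adds just one
strip, which turns supermultiplicativity into monotonicity. -/
theorem numLatticeTriangulations_zero_pos (n : ℕ) : 0 < numLatticeTriangulations 0 n := by
  have hind : AffineIndependent ℝ
      ((↑) : ({((0 : ℝ), (0 : ℝ)), ((0 : ℝ), (n : ℝ))} : Finset (ℝ × ℝ)) → ℝ × ℝ) := by
    rcases Nat.eq_zero_or_pos n with rfl | hn
    · have : Subsingleton ({((0 : ℝ), (0 : ℝ)), ((0 : ℝ), ((0 : ℕ) : ℝ))} : Finset (ℝ × ℝ)) := by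
        constructor
        rintro ⟨x, hx⟩ ⟨y, hy⟩
        simp only [Nat.cast_zero, Finset.mem_singleton, Finset.insert_eq_of_mem] at hx hy
        exact Subtype.ext (hx.trans hy.symm)
      exact affineIndependent_of_subsingleton ℝ _
    · have hne : (((0 : ℝ), (0 : ℝ)) : ℝ × ℝ) ≠ ((0 : ℝ), (n : ℝ)) := by
        intro h
        exact hn.ne (Nat.cast_injective (R := ℝ) (by simpa using (Prod.ext_iff.1 h).2))
      refine (affineIndependent_of_ne ℝ hne).range.mono (s := (({((0 : ℝ), (0 : ℝ)),
        ((0 : ℝ), (n : ℝ))} : Finset (ℝ × ℝ)) : Set (ℝ × ℝ))) ?_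
      intro x hx
      simp only [Finset.coe_insert, Finset.coe_singleton, Set.mem_insert_iff,
        Set.mem_singleton_iff] at hx
      rcases hx with rfl | rfl
      · exact ⟨0, rfl⟩
      · exact ⟨1, rfl⟩
  obtain ⟨K, hKs, hKv, -⟩ := exists_simplex hind ⟨_, Finset.mem_insert_self _ _⟩
  refine (Set.ncard_pos (latticeTriangulations_finite _ _)).2 ⟨K, ?_, ?_⟩
  · rw [hKs, Finset.coe_pair, convexHull_pair]
    ext ⟨x, y⟩
    have hn : (0 : ℝ) ≤ n := Nat.cast_nonneg n
    simp only [latticeRectangle, Nat.cast_zero, Set.Icc_self, Set.mem_prod, Set.mem_singleton_iff]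
    constructor
    · rintro ⟨u, v, hu, hv, huv, h⟩
      simp only [Prod.smul_mk, Prod.mk_add_mk, smul_eq_mul, mul_zero, zero_add,
        Prod.mk.injEq] at h
      obtain ⟨rfl, rfl⟩ := h
      exact ⟨rfl, by positivity, by nlinarith⟩
    · rintro ⟨rfl, h1, h2⟩
      rcases hn.eq_or_lt with h | h
      · obtain rfl : y = 0 := by linarith
        exact ⟨1, 0, zero_le_one, le_rfl, by ring, by simp⟩
      · refine ⟨1 - y / n, y / n, sub_nonneg.2 ((div_le_one h).2 h2), div_nonneg h1 hn, by ring, ?_⟩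
        ext
        · simp
        · simp [div_mul_cancel₀ _ h.ne']
  · rw [hKv]
    intro v hv
    simp only [Finset.coe_insert, Finset.coe_singleton, Set.mem_insert_iff,
      Set.mem_singleton_iff] at hv
    rcases hv with rfl | rfl
    · exact ⟨0, 0, by simp⟩
    · exact ⟨0, n, by simp⟩

theorem numLatticeTriangulations_le_succ (m n : ℕ) :
    numLatticeTriangulations m n ≤ numLatticeTriangulations (m + 1) n := by
  have h := numLatticeTriangulations_mul_le 0 m n
  rw [show 0 + 1 + m = m + 1 by ring] at h
  exact (Nat.le_mul_of_pos_left _ (numLatticeTriangulations_zero_pos n)).trans h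

theorem numLatticeTriangulations_mono {m m' n n' : ℕ} (hm : m ≤ m') (hn : n ≤ n') :
    numLatticeTriangulations m n ≤ numLatticeTriangulations m' n' := by
  have h : ∀ n, Monotone fun m => numLatticeTriangulations m n :=
    fun n => monotone_nat_of_le_succ fun m => numLatticeTriangulations_le_succ m n
  refine (h n hm).trans ?_
  rw [numLatticeTriangulations_comm m']
  exact (numLatticeTriangulations_comm m' n).trans_le (h m' hn)

theorem numLatticeTriangulations_pos (m n : ℕ) : 0 < numLatticeTriangulations m n :=
  (numLatticeTriangulations_zero_pos n).trans_le
    (numLatticeTriangulations_mono (Nat.zero_le m) le_rfl)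

end Counting

/-! ### The lower bound by strips -/

section Strips

open Geometry Geometry.SimplicialComplex

/-- The lattice triangulations of the rectangle with exactly `j` vertices in the interior of the
right side. -/
def triangulationsWithSide (j m n : ℕ) : Set (SimplicialComplex ℝ (ℝ × ℝ)) :=
  {K | K ∈ latticeTriangulations m n ∧ (sideHeights K m n).card = j + 2}

theorem triangulationsWithSide_finite (j m n : ℕ) : (triangulationsWithSide j m n).Finite :=
  (latticeTriangulations_finite m n).subset fun _ h => h.1

/-- The vertical side of height `n` with additional vertices at the heights in `A`. -/
def sideInsert (n : ℕ) (A : Finset ℕ) : Finset ℕ :=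
  insert 0 (insert n A)

theorem sideInsert_le {n : ℕ} {A : Finset ℕ} (hA : A ⊆ Finset.Ioo 0 n) :
    ∀ y ∈ sideInsert n A, y ≤ n := by
  intro y hy
  rcases Finset.mem_insert.1 hy with rfl | hy
  · exact Nat.zero_le _
  · rcases Finset.mem_insert.1 hy with rfl | hy
    · exact le_rfl
    · exact (Finset.mem_Ioo.1 (hA hy)).2.le

theorem card_sideInsert {n : ℕ} (hn : 0 < n) {A : Finset ℕ} (hA : A ⊆ Finset.Ioo 0 n) :
    (sideInsert n A).card = A.card + 2 := by
  rw [sideInsert, Finset.card_insert_of_notMem, Finset.card_insert_of_notMem]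
  · intro h
    exact lt_irrefl _ (Finset.mem_Ioo.1 (hA h)).2
  · rw [Finset.mem_insert]
    rintro (h | h)
    · omega
    · exact lt_irrefl _ (Finset.mem_Ioo.1 (hA h)).1

theorem sideInsert_inter {n : ℕ} {A : Finset ℕ} (hA : A ⊆ Finset.Ioo 0 n) :
    (sideInsert n A) ∩ Finset.Ioo 0 n = A := by
  ext y
  simp only [sideInsert, Finset.mem_inter, Finset.mem_insert, Finset.mem_Ioo]
  constructor
  · rintro ⟨rfl | rfl | h, h1, h2⟩
    · omega
    · omega
    · exact h
  · intro h
    exact ⟨Or.inr (Or.inr h), Finset.mem_Ioo.1 (hA h)⟩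

theorem sideHeights_eq_of_forall {m n : ℕ} {K : SimplicialComplex ℝ (ℝ × ℝ)}
    (hK : K ∈ latticeTriangulations m n) {x : ℕ} {T : Finset ℕ}
    (h : ∀ y : ℕ, ((x : ℝ), (y : ℝ)) ∈ K.vertices ↔ y ∈ T) : sideHeights K x n = T := by
  ext y
  rw [mem_sideHeights hK, h]

/-- Prescribing the same number `j` of interior vertices on the old and the new right side makes the
count the central binomial coefficient at every step. -/
theorem exists_append_strips {j m n : ℕ} (hn : 0 < n) {K : SimplicialComplex ℝ (ℝ × ℝ)}
    (hK : K ∈ triangulationsWithSide j m n) {A : Finset ℕ} (hA : A ⊆ Finset.Ioo 0 n)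
    (hAj : A.card = j) :
    ∃ φ : Fin ((2 * j + 2).choose (j + 1)) → SimplicialComplex ℝ (ℝ × ℝ),
      Function.Injective φ ∧ ∀ i, φ i ∈ triangulationsWithSide j (m + 1) n ∧
        (∀ s, s ∈ K.faces ↔ s ∈ (φ i).faces ∧ ∀ v ∈ s, v.1 ≤ m) ∧
        sideHeights (φ i) (m + 1) n = sideInsert n A := by
  obtain ⟨hKL, hKc⟩ := hK
  have hAc := card_sideInsert hn hA
  obtain ⟨F, hFc, hF⟩ := exists_strips (S := sideHeights K m n) (T := sideInsert n A)
    (fun y => le_of_mem_sideHeights) (sideInsert_le hA)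
    ((mem_sideHeights hKL).2 (corner_mem_vertices hKL (Or.inr rfl) (Or.inl Nat.cast_zero)))
    (Finset.mem_insert_self _ _)
    ((mem_sideHeights hKL).2 (corner_mem_vertices hKL (Or.inr rfl) (Or.inr rfl)))
    (Finset.mem_insert_of_mem (Finset.mem_insert_self _ _))
  rw [hKc, hAc, hAj, show j + 2 - 1 = j + 1 by omega,
    show j + 1 + (j + 1) = 2 * j + 2 by ring] at hFc
  let ψ : Fin ((2 * j + 2).choose (j + 1)) → F := (F.equivFinOfCardEq hFc).symm
  have hψ : Function.Injective ψ := Equiv.injective _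
  have hjoin : ∀ i, ∃ M ∈ latticeTriangulations (m + 1) n,
      (∀ s, s ∈ K.faces ↔ s ∈ M.faces ∧ ∀ v ∈ s, v.1 ≤ m) ∧
      (∀ s : Finset (ℝ × ℝ), s ∈ (ψ i).1.faces ↔
        s.map (shiftEquiv m).toEquiv.toEmbedding ∈ M.faces ∧ ∀ v ∈ s, 0 ≤ v.1) ∧
      M.vertices = K.vertices ∪ shiftEquiv m '' (ψ i).1.vertices := by
    intro i
    obtain ⟨hPs, hPv⟩ := hF _ (ψ i).2
    exact exists_join hKL (strip_mem_latticeTriangulations hPs hPv) fun y => by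
      rw [left_mem_strip_iff hPv, mem_sideHeights hKL]
  choose φ hφ hφl hφr hφv using hjoin
  have hside : ∀ i, sideHeights (φ i) (m + 1) n = sideInsert n A := by
    intro i
    refine sideHeights_eq_of_forall (hφ i) fun y => ?_
    rw [hφv, Set.mem_union, mem_image_shiftEquiv]
    have h1 : (((m + 1 : ℕ) : ℝ), (y : ℝ)) ∉ K.vertices := by
      intro h
      obtain ⟨a, b, ha, -, hab⟩ := exists_nat_of_mem_vertices hKL h
      have : m + 1 = a := Nat.cast_injective (R := ℝ) (Prod.ext_iff.1 hab).1
      omega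
    rw [or_iff_right h1]
    simp only [Nat.cast_add, Nat.cast_one, add_sub_cancel_left]
    exact right_mem_strip_iff (hF _ (ψ i).2).2 y
  refine ⟨φ, ?_, fun i => ⟨⟨hφ i, by rw [hside, hAc, hAj]⟩, hφl i, hside i⟩⟩
  intro i i' h
  refine hψ (Subtype.ext (SimplicialComplex.ext (Set.ext fun s => ?_)))
  rw [hφr i, hφr i', h]

/-- From the enlarged triangulation one recovers the old one as its part to the left, the set `A`
from the heights on the new side, and then the strip. -/
theorem ncard_triangulationsWithSide_mul_le {j m n : ℕ} (hn : 0 < n) :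
    (triangulationsWithSide j m n).ncard *
        ((n - 1).choose j * (2 * j + 2).choose (j + 1)) ≤
      (triangulationsWithSide j (m + 1) n).ncard := by
  have h : ∀ (K : SimplicialComplex ℝ (ℝ × ℝ)) (A : Finset ℕ),
      ∃ φ : Fin ((2 * j + 2).choose (j + 1)) → SimplicialComplex ℝ (ℝ × ℝ),
      K ∈ triangulationsWithSide j m n → A ∈ (Finset.Ioo 0 n).powersetCard j →
      Function.Injective φ ∧ ∀ i, φ i ∈ triangulationsWithSide j (m + 1) n ∧
        (∀ s, s ∈ K.faces ↔ s ∈ (φ i).faces ∧ ∀ v ∈ s, v.1 ≤ m) ∧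
        sideHeights (φ i) (m + 1) n = sideInsert n A := by
    intro K A
    by_cases hK : K ∈ triangulationsWithSide j m n
    · by_cases hA : A ∈ (Finset.Ioo 0 n).powersetCard j
      · obtain ⟨hA1, hA2⟩ := Finset.mem_powersetCard.1 hA
        obtain ⟨φ, hφ⟩ := exists_append_strips hn hK hA1 hA2
        exact ⟨φ, fun _ _ => hφ⟩
      · exact ⟨fun _ => K, fun _ h => absurd h hA⟩
    · exact ⟨fun _ => K, fun h => absurd h hK⟩
  choose φ hφ using h
  have hcard : (triangulationsWithSide j m n ×ˢ (((Finset.Ioo 0 n).powersetCard j :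
      Set (Finset ℕ)) ×ˢ (Set.univ : Set (Fin ((2 * j + 2).choose (j + 1)))))).ncard =
      (triangulationsWithSide j m n).ncard * ((n - 1).choose j * (2 * j + 2).choose (j + 1)) := by
    rw [Set.ncard_prod, Set.ncard_prod, Set.ncard_coe_finset, Set.ncard_univ, Nat.card_fin,
      Finset.card_powersetCard, Nat.card_Ioo, Nat.sub_zero]
  rw [← hcard]
  refine Set.ncard_le_ncard_of_injOn (fun p => φ p.1 p.2.1 p.2.2)
    (fun p hp => ((hφ _ _ hp.1 hp.2.1).2 _).1) ?_ (triangulationsWithSide_finite _ _ _)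
  rintro ⟨K, A, i⟩ ⟨hK, hA, -⟩ ⟨K', A', i'⟩ ⟨hK', hA', -⟩ h
  dsimp only at h hK hA hK' hA'
  obtain ⟨hinj, hp⟩ := hφ K A hK hA
  obtain ⟨-, hp'⟩ := hφ K' A' hK' hA'
  obtain rfl : K = K' := by
    refine SimplicialComplex.ext (Set.ext fun s => ?_)
    rw [(hp i).2.1, (hp' i').2.1, h]
  obtain rfl : A = A' := by
    rw [← sideInsert_inter (Finset.mem_powersetCard.1 hA).1,
      ← sideInsert_inter (Finset.mem_powersetCard.1 hA').1, ← (hp i).2.2, ← (hp' i').2.2, h]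
  rw [hinj h]

theorem triangulationsWithSide_one_nonempty {j n : ℕ} (hj : j < n) :
    (triangulationsWithSide j 1 n).Nonempty := by
  obtain ⟨A, hA, hAj⟩ := Finset.exists_subset_card_eq (s := Finset.Ioo 0 n) (n := j)
    (by rw [Nat.card_Ioo]; omega)
  obtain ⟨F, hFc, hF⟩ := exists_strips (sideInsert_le hA) (sideInsert_le hA)
    (Finset.mem_insert_self _ _) (Finset.mem_insert_self _ _)
    (Finset.mem_insert_of_mem (Finset.mem_insert_self _ _))
    (Finset.mem_insert_of_mem (Finset.mem_insert_self _ _))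
  obtain ⟨P, hP⟩ := Finset.card_pos.1 (hFc ▸ Nat.choose_pos (Nat.le_add_right _ _))
  obtain ⟨hPs, hPv⟩ := hF P hP
  have hPT := strip_mem_latticeTriangulations hPs hPv
  refine ⟨P, hPT, ?_⟩
  rw [sideHeights_eq_of_forall hPT (T := sideInsert n A), card_sideInsert (by omega) hA, hAj]
  intro y
  rw [Nat.cast_one]
  exact right_mem_strip_iff hPv y

theorem pow_le_numLatticeTriangulations {j m n : ℕ} (hj : j < n) :
    ((n - 1).choose j * (2 * j + 2).choose (j + 1)) ^ m ≤ numLatticeTriangulations (m + 1) n := by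
  have h : ∀ m, ((n - 1).choose j * (2 * j + 2).choose (j + 1)) ^ m ≤
      (triangulationsWithSide j (m + 1) n).ncard := by
    intro m
    induction m with
    | zero =>
      rw [pow_zero]
      exact (Set.ncard_pos (triangulationsWithSide_finite _ _ _)).2
        (triangulationsWithSide_one_nonempty hj)
    | succ m ih =>
      rw [pow_succ]
      exact (Nat.mul_le_mul_right _ ih).trans
        (ncard_triangulationsWithSide_mul_le (by omega))
  exact (h m).trans (Set.ncard_le_ncard (fun _ h => h.1) (latticeTriangulations_finite _ _))

/-- The terms C(n-1, j) 4^j sum to 5^(n-1), so the largest of these `n` terms loses one factor `n`.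
Replacing 4^j by the central binomial coefficient loses another. -/
theorem exists_five_pow_le {n : ℕ} (hn : 0 < n) :
    ∃ j < n, 5 ^ (n - 1) ≤ n ^ 2 * ((n - 1).choose j * (2 * j + 2).choose (j + 1)) := by
  have hsum : ∑ j ∈ Finset.range n, (n - 1).choose j * 4 ^ j = 5 ^ (n - 1) := by
    have h := add_pow 4 1 (n - 1)
    rw [Nat.sub_add_cancel hn] at h
    rw [show (5 : ℕ) = 4 + 1 by norm_num, h]
    refine Finset.sum_congr rfl fun j _ => ?_
    rw [one_pow, mul_one, mul_comm, Nat.cast_id]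
  obtain ⟨j, hj, hmax⟩ := Finset.exists_max_image (Finset.range n)
    (fun j => (n - 1).choose j * 4 ^ j) ⟨0, Finset.mem_range.2 hn⟩
  have hjn := Finset.mem_range.1 hj
  refine ⟨j, hjn, ?_⟩
  have h1 : 5 ^ (n - 1) ≤ n * ((n - 1).choose j * 4 ^ j) := by
    rw [← hsum]
    refine (Finset.sum_le_card_nsmul _ _ _ hmax).trans ?_
    rw [Finset.card_range, smul_eq_mul]
  have h2 : 4 ^ j ≤ n * (2 * j + 2).choose (j + 1) := by
    have h := Nat.four_pow_le_two_mul_self_mul_centralBinom (j + 1) (Nat.succ_pos j)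
    rw [Nat.centralBinom_eq_two_mul_choose, pow_succ, show 2 * (j + 1) = 2 * j + 2 by ring] at h
    have h3 : (2 * j + 2) * (2 * j + 2).choose (j + 1) ≤ 4 * (n * (2 * j + 2).choose (j + 1)) := by
      rw [← mul_assoc]
      exact Nat.mul_le_mul_right _ (by omega)
    omega
  calc 5 ^ (n - 1) ≤ n * ((n - 1).choose j * 4 ^ j) := h1
    _ ≤ n * ((n - 1).choose j * (n * (2 * j + 2).choose (j + 1))) := by gcongr
    _ = n ^ 2 * ((n - 1).choose j * (2 * j + 2).choose (j + 1)) := by ring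

/-- One strip starts the construction and `n - 1` are appended. The loss `n ^ (2 * (n - 1))` is
exp(O(n log n)), which disappears in the limit. -/
theorem five_pow_le_mul_numLatticeTriangulations {n : ℕ} (hn : 0 < n) :
    5 ^ ((n - 1) ^ 2) ≤ n ^ (2 * (n - 1)) * numLatticeTriangulations n n := by
  obtain ⟨j, hj, h⟩ := exists_five_pow_le hn
  have h1 := pow_le_numLatticeTriangulations (m := n - 1) hj
  rw [Nat.sub_add_cancel hn] at h1
  calc 5 ^ ((n - 1) ^ 2) = (5 ^ (n - 1)) ^ (n - 1) := by rw [← pow_mul, sq]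
    _ ≤ (n ^ 2 * ((n - 1).choose j * (2 * j + 2).choose (j + 1))) ^ (n - 1) := by gcongr
    _ = n ^ (2 * (n - 1)) * ((n - 1).choose j * (2 * j + 2).choose (j + 1)) ^ (n - 1) := by
      rw [mul_pow, ← pow_mul]
    _ ≤ _ := by gcongr

end Strips

/-! ### The limit -/

section Limit

open Filter Topology

/-- A two-dimensional version of Fekete's lemma. -/
theorem tendsto_div_sq_of_supermultiplicative {u : ℕ → ℝ} (h0 : ∀ n, 0 ≤ u n)
    (hu : ∀ k m n : ℕ, k * (m + 1) ≤ n + 1 → (k : ℝ) ^ 2 * u m ≤ u n) {C : ℝ}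
    (hC : ∀ n, u n ≤ C * ((n : ℝ) + 1) ^ 2) :
    Tendsto (fun n : ℕ => u n / (n : ℝ) ^ 2) atTop (𝓝 (⨆ m : ℕ, u m / ((m : ℝ) + 1) ^ 2)) := by
  have hpos : ∀ m : ℕ, (0 : ℝ) < ((m : ℝ) + 1) ^ 2 := fun m => by positivity
  have hbdd : BddAbove (Set.range fun m : ℕ => u m / ((m : ℝ) + 1) ^ 2) := by
    refine ⟨C, ?_⟩
    rintro _ ⟨m, rfl⟩
    exact (div_le_iff₀ (hpos m)).2 (hC m)
  have hinv : Tendsto (fun n : ℕ => ((n : ℝ))⁻¹) atTop (𝓝 0) := tendsto_inv_atTop_nhds_zero_nat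
  refine tendsto_order.2 ⟨fun c hc => ?_, fun c hc => ?_⟩
  · obtain ⟨m, hm⟩ := exists_lt_of_lt_ciSup hc
    have hlim : Tendsto (fun n : ℕ => (1 - m * (n : ℝ)⁻¹) ^ 2 * (u m / ((m : ℝ) + 1) ^ 2)) atTop
        (𝓝 ((1 - m * 0) ^ 2 * (u m / ((m : ℝ) + 1) ^ 2))) :=
      ((tendsto_const_nhds.sub (hinv.const_mul _)).pow 2).mul_const _
    rw [mul_zero, sub_zero, one_pow, one_mul] at hlim
    filter_upwards [hlim.eventually_const_lt hm, eventually_ge_atTop (m + 1)] with n hn hmn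
    refine hn.trans_le ?_
    have hn0 : (0 : ℝ) < n := Nat.cast_pos.2 (by omega)
    have hmn' : (m : ℝ) ≤ n := Nat.cast_le.2 (by omega)
    -- The number of blocks of side `m`, separated by unit gaps, that fit into length `n`; it is at
    -- least (n - m)/(m + 1).
    have hk := hu ((n + 1) / (m + 1)) m n (Nat.div_mul_le_self _ _)
    have hk1 : ((n : ℝ) - m) / (m + 1) ≤ ((n + 1) / (m + 1) : ℕ) := by
      rw [div_le_iff₀ (by positivity)]
      have h := Nat.lt_div_mul_add (a := n + 1) (b := m + 1) (Nat.succ_pos m)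
      have h' : ((n + 1 : ℕ) : ℝ) ≤ (((n + 1) / (m + 1) * (m + 1) + m : ℕ) : ℝ) :=
        Nat.cast_le.2 (by omega)
      rw [Nat.cast_add _ m, Nat.cast_mul] at h'
      push_cast at h' ⊢
      linarith
    have hk2 : (((n : ℝ) - m) / (m + 1)) ^ 2 * u m ≤ u n :=
      (mul_le_mul_of_nonneg_right (pow_le_pow_left₀ (div_nonneg (by linarith) (by positivity)) hk1 2)
        (h0 m)).trans hk
    calc (1 - m * (n : ℝ)⁻¹) ^ 2 * (u m / ((m : ℝ) + 1) ^ 2)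
        = (((n : ℝ) - m) / (m + 1)) ^ 2 * u m / n ^ 2 := by field_simp
      _ ≤ u n / n ^ 2 := by gcongr
  · have hlim : Tendsto (fun n : ℕ => (1 + (n : ℝ)⁻¹) ^ 2 * ⨆ m : ℕ, u m / ((m : ℝ) + 1) ^ 2) atTop
        (𝓝 ((1 + 0) ^ 2 * ⨆ m : ℕ, u m / ((m : ℝ) + 1) ^ 2)) :=
      ((tendsto_const_nhds.add hinv).pow 2).mul_const _
    rw [add_zero, one_pow, one_mul] at hlim
    filter_upwards [hlim.eventually_lt_const hc, eventually_ge_atTop 1] with n hn hn1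
    refine lt_of_le_of_lt ?_ hn
    have hn0 : (0 : ℝ) < n := Nat.cast_pos.2 hn1
    calc u n / (n : ℝ) ^ 2 = (1 + (n : ℝ)⁻¹) ^ 2 * (u n / ((n : ℝ) + 1) ^ 2) := by field_simp
      _ ≤ _ := by
        refine mul_le_mul_of_nonneg_left ?_ (by positivity)
        exact le_ciSup hbdd n

theorem numLatticeTriangulations_pow_le (m n k : ℕ) :
    numLatticeTriangulations m n ^ (k + 1) ≤ numLatticeTriangulations (m + k * (m + 1)) n := by
  induction k with
  | zero => simp
  | succ k ih =>
    rw [pow_succ, show m + (k + 1) * (m + 1) = m + k * (m + 1) + 1 + m by ring]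
    exact (Nat.mul_le_mul_right _ ih).trans (numLatticeTriangulations_mul_le _ _ _)

/-- A `k` by `k` array of squares of side `m` with unit gaps has side k(m+1) - 1 ≤ n. It is filled
in one direction, then by symmetry in the other. -/
theorem numLatticeTriangulations_pow_sq_le {k m n : ℕ} (h : k * (m + 1) ≤ n + 1) :
    numLatticeTriangulations m m ^ k ^ 2 ≤ numLatticeTriangulations n n := by
  rcases k with _ | k
  · exact numLatticeTriangulations_pos n n
  · have hle : m + k * (m + 1) ≤ n := by
      rw [Nat.succ_mul] at h
      omega
    rw [sq, pow_mul]
    calc (numLatticeTriangulations m m ^ (k + 1)) ^ (k + 1)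
        ≤ numLatticeTriangulations n m ^ (k + 1) := by
          gcongr
          exact (numLatticeTriangulations_pow_le m m k).trans
            (numLatticeTriangulations_mono hle le_rfl)
      _ = numLatticeTriangulations m n ^ (k + 1) := by rw [numLatticeTriangulations_comm]
      _ ≤ numLatticeTriangulations n n := (numLatticeTriangulations_pow_le m n k).trans
            (numLatticeTriangulations_mono hle le_rfl)

theorem log_numLatticeTriangulations_le (n : ℕ) :
    Real.log (numLatticeTriangulations n n) ≤ 9 * Real.log 4 * ((n : ℝ) + 1) ^ 2 := by
  -- The exponential bound needs a positive side, so it is applied to `n + 1`; then 2(n+1) + 1 ≤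
  -- 3(n+1) gives the factor 9.
  have h : numLatticeTriangulations n n ≤ 4 ^ (9 * (n + 1) ^ 2) :=
    ((numLatticeTriangulations_mono (Nat.le_succ n) (Nat.le_succ n)).trans
      (numLatticeTriangulations_le (Nat.succ_pos n))).trans
      (Nat.pow_le_pow_right (by norm_num) (by
        rw [show 9 * (n + 1) ^ 2 = (3 * (n + 1)) ^ 2 by ring]
        exact Nat.pow_le_pow_left (by omega) 2))
  have h' : ((numLatticeTriangulations n n : ℕ) : ℝ) ≤ (4 : ℝ) ^ (9 * (n + 1) ^ 2) := by
    exact_mod_cast h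
  refine (Real.log_le_log (Nat.cast_pos.2 (numLatticeTriangulations_pos n n)) h').trans_eq ?_
  rw [Real.log_pow]
  push_cast
  ring

theorem log_five_le_of_tendsto {L : ℝ} (hL : Tendsto (fun n : ℕ =>
    Real.log (numLatticeTriangulations n n) / (n : ℝ) ^ 2) atTop (𝓝 L)) : Real.log 5 ≤ L := by
  have hinv : Tendsto (fun n : ℕ => ((n : ℝ))⁻¹) atTop (𝓝 0) := tendsto_inv_atTop_nhds_zero_nat
  have hlog : Tendsto (fun n : ℕ => Real.log n / n) atTop (𝓝 0) :=
    Real.isLittleO_log_id_atTop.tendsto_div_nhds_zero.comp tendsto_natCast_atTop_atTop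
  -- The logarithm of the lower bound divided by n^2, with the loss 2(n-1) log n rounded up to 2n
  -- log n.
  have hlim : Tendsto (fun n : ℕ => (1 - (n : ℝ)⁻¹) ^ 2 * Real.log 5 - 2 * (Real.log n / n)) atTop
      (𝓝 ((1 - 0) ^ 2 * Real.log 5 - 2 * 0)) :=
    (((tendsto_const_nhds.sub hinv).pow 2).mul_const _).sub (hlog.const_mul 2)
  rw [sub_zero, one_pow, one_mul, mul_zero, sub_zero] at hlim
  refine le_of_tendsto_of_tendsto hlim hL ?_
  filter_upwards [eventually_ge_atTop 1] with n hn
  have hn0 : (0 : ℝ) < n := Nat.cast_pos.2 hn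
  have h : (5 : ℝ) ^ ((n - 1) ^ 2) ≤ (n : ℝ) ^ (2 * (n - 1)) * numLatticeTriangulations n n := by
    exact_mod_cast five_pow_le_mul_numLatticeTriangulations hn
  have h' := Real.log_le_log (by positivity) h
  rw [Real.log_mul (by positivity) (Nat.cast_ne_zero.2 (numLatticeTriangulations_pos n n).ne'),
    Real.log_pow, Real.log_pow] at h'
  push_cast [Nat.cast_sub hn] at h'
  have hlogn : 0 ≤ Real.log n := Real.log_natCast_nonneg n
  rw [le_div_iff₀ (by positivity)]
  have e1 : ((1 - (n : ℝ)⁻¹) ^ 2 * Real.log 5 - 2 * (Real.log n / n)) * (n : ℝ) ^ 2 =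
      ((n : ℝ) - 1) ^ 2 * Real.log 5 - 2 * n * Real.log n := by field_simp
  rw [e1]
  nlinarith

end Limit

theorem mainTheorem3 :
    ∃ L : ℝ,
      Filter.Tendsto
        (fun n : ℕ => (numLatticeTriangulations n n : ℝ) ^ ((1 : ℝ) / (n : ℝ) ^ 2))
        Filter.atTop (nhds L) ∧
      5 ≤ L := by
  have hL := tendsto_div_sq_of_supermultiplicative
    (u := fun n => Real.log (numLatticeTriangulations n n)) (fun n => Real.log_natCast_nonneg _)
    (fun k m n h => by
      have h' : ((numLatticeTriangulations m m : ℕ) : ℝ) ^ k ^ 2 ≤ numLatticeTriangulations n n := by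
        exact_mod_cast numLatticeTriangulations_pow_sq_le h
      have hpos : (0 : ℝ) < numLatticeTriangulations m m :=
        Nat.cast_pos.2 (numLatticeTriangulations_pos m m)
      have := Real.log_le_log (pow_pos hpos _) h'
      rw [Real.log_pow] at this
      exact_mod_cast this)
    log_numLatticeTriangulations_le
  -- The root is exp(log f / n^2), so the limit is the exponential of the limit of logarithms.
  refine ⟨_, ((Real.continuous_exp.tendsto _).comp hL).congr fun n => ?_,
    (Real.log_le_iff_le_exp (by norm_num)).1 (log_five_le_of_tendsto hL)⟩
  rw [Function.comp_apply, Real.rpow_def_of_pos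
    (Nat.cast_pos.2 (numLatticeTriangulations_pos n n)), mul_one_div]
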